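/- Let $d_1,d_2\ge 0$ be integers with $d:=d_1+d_2\ge 1$, let $Z=\mathbb R^{d_1}\times\mathbb T^{d_2}$ with $\mathbb T=\mathbb R/2\pi\mathbb Z$, let $p\ge 2$ and $0\le q\le p$ be integers, let $\nu\in\mathbb C\setminus\{0\}$ and $s\in\mathbb R$. Consider the initial value problem $$i\partial_t u+\Delta u=\nu u^q\bar u^{\,p-q}\quad\text{on }[0,T]\times Z,\qquad u(0,\cdot)=\phi. \tag{NLS}$$ Let $\|f\|_{H^s}=\|(1+|\xi|^2)^{s/2}\widehat f(\xi)\|_{L^2(\mathbb R^{d_1}\times\mathbb Z^{d_2})}$, let $H^\infty(Z)=\bigcap_k H^k(Z)$, and let $s_c(d,p)=\frac d2-\frac2{p-1}$. We say that (NLS) exhibits norm inflation in $H^s(Z)$ if for every $\delta>0$ there exist $\phi\in H^\infty(Z)$ and $T>0$ with $\|\phi\|_{H^s}<\delta$ and $0<T<\delta$ such that the corresponding smooth solution $u\in C([0,T];H^\infty(Z))$ of (NLS) exists on $[0,T]$ and $\|u(T)\|_{H^s}>\delta^{-1}$. Then (NLS) exhibits norm inflation in $H^s(Z)$ in each of the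 following cases: (i) $Z$ and $(p,q)$ are arbitrary and $s<\min\{s_c(d,p),0\}$; (ii) $s=s_c(d,p)=-\frac d2$, that is, $(d,p,s)=(1,3,-\frac12)$ or $(d,p,s)=(2,2,-1)$, with $Z$ and $q$ otherwise arbitrary; (iii) $d=1$, $(p,q)\in\{(2,0),(2,2)\}$ and $s<-1$; (iv) $Z=\mathbb R^d$ with $1\le d\le 3$, $(p,q)=(2,1)$ and $s<-\frac14$; (v) $Z=\mathbb R^{d_1}\times\mathbb T^{d_2}$ with $d_1+d_2\le 3$, $d_2\ge 1$, $(p,q)=(2,1)$ and $s<0$; (vi) $Z=\mathbb T$, $(p,q)\in\{(4,1),(4,2),(4,3)\}$ and $s<0$. -/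

import Mathlib

open MeasureTheory Filter Topology Laplacian
open scoped Real ENNReal

noncomputable section

namespace NLS

/-- The spatial domain `Z = ℝ^{d₁} × 𝕋^{d₂}`, with `𝕋 = ℝ / 2πℤ`. -/
abbrev Space (d₁ d₂ : ℕ) : Type :=
  EuclideanSpace ℝ (Fin d₁) × (Fin d₂ → AddCircle (2 * π))

/-- The Euclidean space `ℝ^{d₁ + d₂}`, the universal cover of `Z`. -/
abbrev Cover (d₁ d₂ : ℕ) : Type :=
  EuclideanSpace ℝ (Fin d₁ ⊕ Fin d₂)

/-- The covering map `ℝ^{d₁ + d₂} → Z`, reducing the last `d₂` coordinates modulo `2π`. -/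
def proj {d₁ d₂ : ℕ} (y : Cover d₁ d₂) : Space d₁ d₂ :=
  (WithLp.toLp 2 fun i => y (Sum.inl i), fun j => ((y (Sum.inr j) : ℝ) : AddCircle (2 * π)))

/-- The frequency domain `ℝ^{d₁} × ℤ^{d₂}`. -/
abbrev Freq (d₁ d₂ : ℕ) : Type :=
  EuclideanSpace ℝ (Fin d₁) × (Fin d₂ → ℤ)

/-- Lebesgue measure times counting measure on the frequency domain. -/
def freqMeasure (d₁ d₂ : ℕ) : Measure (Freq d₁ d₂) :=
  (volume : Measure (EuclideanSpace ℝ (Fin d₁))).prod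
    (Measure.count : Measure (Fin d₂ → ℤ))

/-- The Japanese bracket `⟨ξ⟩ = (1 + |ξ|²)^{1/2}`. -/
def bracket {d₁ d₂ : ℕ} (ξ : Freq d₁ d₂) : ℝ :=
  √(1 + (‖ξ.1‖ ^ 2 + ∑ j, (ξ.2 j : ℝ) ^ 2))

/-- The character `e^{i x·ξ}`, for `x ∈ Z` and a frequency `ξ`. (On `ℝ / 2πℤ`, `fourier n` is
`x ↦ e^{i n x}`.) -/
def character {d₁ d₂ : ℕ} (ξ : Freq d₁ d₂) (x : Space d₁ d₂) : ℂ :=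
  Complex.exp (Complex.I * ((inner ℝ ξ.1 x.1 : ℝ) : ℂ)) * ∏ j, fourier (ξ.2 j) (x.2 j)

/-- The norm `‖⟨ξ⟩^s g‖_{L²}` of a function `g` on the frequency domain. -/
def weightedNorm {d₁ d₂ : ℕ} (s : ℝ) (g : Freq d₁ d₂ → ℂ) : ℝ≥0∞ :=
  eLpNorm (fun ξ => bracket ξ ^ s • g ξ) 2 (freqMeasure d₁ d₂)

/-- `g` is the (unitary) Fourier transform of the function `f ∈ H^∞(Z)`: `⟨ξ⟩^k g ∈ L²` for every
`k`, so that `g` is integrable, and `f` is given by the Fourier inversion formula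
`f(x) = (2π)^{-d/2} ∫ g(ξ) e^{i x·ξ} dξ`. Such a `g` is unique almost everywhere. -/
structure IsFourierTransform {d₁ d₂ : ℕ} (f : Space d₁ d₂ → ℂ) (g : Freq d₁ d₂ → ℂ) : Prop where
  aestronglyMeasurable : AEStronglyMeasurable g (freqMeasure d₁ d₂)
  weightedNorm_lt_top : ∀ k : ℕ, weightedNorm (k : ℝ) g < ∞
  inversion : ∀ x, f x =
    (((2 * π) ^ (-(((d₁ + d₂ : ℕ) : ℝ) / 2)) : ℝ) : ℂ) *
      ∫ ξ, g ξ * character ξ x ∂(freqMeasure d₁ d₂)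

/-- The space `H^∞(Z) = ⋂ₖ H^k(Z)`, where an element is represented by its smooth
representative. -/
def MemHInfty {d₁ d₂ : ℕ} (f : Space d₁ d₂ → ℂ) : Prop :=
  ∃ g, IsFourierTransform f g

open scoped Classical in
/-- The Fourier transform of a function `f ∈ H^∞(Z)` (and `0` for other functions). -/
def fourierTransform {d₁ d₂ : ℕ} (f : Space d₁ d₂ → ℂ) : Freq d₁ d₂ → ℂ :=
  if h : MemHInfty f then h.choose else 0

/-- The Sobolev norm `‖f‖_{H^s} = ‖⟨ξ⟩^s f̂‖_{L²}`, for `f ∈ H^∞(Z)` and any real `s`. -/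
def sobolevNorm {d₁ d₂ : ℕ} (s : ℝ) (f : Space d₁ d₂ → ℂ) : ℝ≥0∞ :=
  weightedNorm s (fourierTransform f)

/-- `u` is a smooth solution on `[0, T] × Z` of `i ∂ₜ u + Δ u = ν u^q ū^{p-q}`, `u(0) = φ`:
it belongs to `C([0, T]; H^∞(Z))`, is differentiable in time on `[0, T]` (one-sidedly at the end
points), and satisfies the equation at every point of `[0, T] × Z`. -/
structure IsSmoothSolution {d₁ d₂ : ℕ} (p q : ℕ) (ν : ℂ) (φ : Space d₁ d₂ → ℂ) (T : ℝ)
    (u : ℝ → Space d₁ d₂ → ℂ) : Prop where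
  mem_HInfty : ∀ t ∈ Set.Icc 0 T, MemHInfty (u t)
  continuous : ∀ k : ℕ, ∀ t₀ ∈ Set.Icc 0 T,
    Tendsto (fun t => sobolevNorm (k : ℝ) (u t - u t₀)) (𝓝[Set.Icc 0 T] t₀) (𝓝 0)
  differentiable : ∀ t ∈ Set.Icc 0 T, ∀ x : Space d₁ d₂,
    DifferentiableWithinAt ℝ (fun τ => u τ x) (Set.Icc 0 T) t
  equation : ∀ t ∈ Set.Icc 0 T, ∀ y : Cover d₁ d₂,
    Complex.I * derivWithin (fun τ => u τ (proj y)) (Set.Icc 0 T) t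
        + Δ (fun y' : Cover d₁ d₂ => u t (proj y')) y
      = ν * u t (proj y) ^ q * (starRingEnd ℂ (u t (proj y))) ^ (p - q)
  initial : u 0 = φ

/-- Norm inflation in `H^s(Z)` for `i ∂ₜ u + Δ u = ν u^q ū^{p-q}` on `Z = ℝ^{d₁} × 𝕋^{d₂}`. -/
def NormInflation (d₁ d₂ p q : ℕ) (ν : ℂ) (s : ℝ) : Prop :=
  ∀ δ : ℝ, 0 < δ → ∃ (φ : Space d₁ d₂ → ℂ) (T : ℝ) (u : ℝ → Space d₁ d₂ → ℂ),
    MemHInfty φ ∧ sobolevNorm s φ < ENNReal.ofReal δ ∧ 0 < T ∧ T < δ ∧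
    IsSmoothSolution p q ν φ T u ∧ ENNReal.ofReal δ⁻¹ < sobolevNorm s (u T)

/-- The scaling critical exponent `s_c(d, p) = d/2 - 2/(p-1)`. -/
def criticalExponent (d p : ℕ) : ℝ :=
  (d : ℝ) / 2 - 2 / ((p : ℝ) - 1)

end NLS

end

/-! Norm inflation comes from one high-to-low frequency interaction in the first Picard iterate. The
data have Fourier transform `h` times the indicator of a set Ω at frequencies of size N, chosen so
that p frequencies from Ω, with signs dictated by q, can add up to a point of a low-frequency set P.
When s < 0 the weight makes the data small in H^s, while the output on P is damped much less or not
at all. With m the measure of Ω, the first iterate on P has size T h (h m)^(p-1), and all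
corrections are smaller by a factor of order T (h m)^(p-1). So T, T (h m)^(p-1) and the H^s norm of
the data should tend to zero while T h (h m)^(p-1) ‖1_P‖_{H^s} tends to infinity. The oscillation of
e^{-it|ξ|²} on [0, T] must not destroy the interaction.

The solution is built on the Fourier side, where the nonlinearity is a p-fold convolution. A
pointwise majorant V with a finite exponential moment (`exists_majorant`) traps every Picard
iterate, and the Picard map contracts the supremum norm over times and frequencies
(`exists_profile`). The exponential moment gives all Sobolev norms at once, so the fixed point is a
smooth solution (`isSmoothSolution_evolve`). The comparison with the first iterate is
`exists_solution_lower_bound`; `normInflation_of_inflationData` turns it into a criterion on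
sequences of parameters.

Oscillation is neutralised in three ways. (a) T is much smaller than N^(-2), so all phases are
nearly 1. Boxes around ±N e and ±2N e then interact for every p and q (`inflationData_boxes`). Boxes
of size N^(1-ε) give (i) and unit boxes give (iii). In (ii) boxes comparable to N are used: the data
stay bounded up to `h`, while the H^(-d/2) norm of a centred box diverges logarithmically. (b) If p
= 2q the nonlinearity is invariant under a common unimodular factor. It suffices that |ξ|² is
constant on Ω up to O(1) (`inflationData_box`), and T need only tend to zero. On ℝ^d this forces a
width 1/N in one direction, whence the exponent -1/4 in (iv). A periodic direction allows a single
integer frequency, which gives (v) and the case q = 2 of (vi). (c) For p = 4 and q = 1 or 3 on 𝕋,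
exact resonance is used: 2 + 2 - 1 = 3 and 4 + 4 + 1 = 9 (`cpow_resonant`). -/

noncomputable section

set_option linter.unusedSectionVars false

namespace NLS

/-! ### Convolution powers on an abelian group and their majorants -/

section Convolution

variable {G : Type*} [AddCommGroup G] [MeasurableSpace G]

/-- The `(k + 1)`-fold convolution power of a nonnegative function. -/
def lpow (μ : Measure G) (V : G → ℝ≥0∞) : ℕ → G → ℝ≥0∞
  | 0 => V
  | k + 1 => fun ξ => ∫⁻ η, lpow μ V k η * V (ξ - η) ∂μ

/-- The function `g` itself, or the conjugate reflection `ξ ↦ conj (g (-ξ))`: the Fourier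
transforms of `f` and of `conj f`, if `g` is that of `f`. -/
def twist (b : Bool) (g : G → ℂ) (ξ : G) : ℂ :=
  if b then g ξ else starRingEnd ℂ (g (-ξ))

/-- The `(k + 1)`-fold convolution product whose factors are `g` or its conjugate reflection, as
prescribed by `σ`. -/
def cpow (μ : Measure G) (σ : ℕ → Bool) (g : G → ℂ) : ℕ → G → ℂ
  | 0 => twist (σ 0) g
  | k + 1 => fun ξ => ∫ η, cpow μ σ g k η * twist (σ (k + 1)) g (ξ - η) ∂μ

lemma iSup_mul_iSup_of_monotone {a b : ℕ → ℝ≥0∞} (ha : Monotone a) (hb : Monotone b) :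
    (⨆ n, a n) * (⨆ n, b n) = ⨆ n, a n * b n := by
  apply le_antisymm
  · rw [ENNReal.iSup_mul]
    refine iSup_le fun i => ?_
    rw [ENNReal.mul_iSup]
    refine iSup_le fun j => ?_
    exact (mul_le_mul' (ha (le_max_left i j)) (hb (le_max_right i j))).trans
      (le_iSup (fun n => a n * b n) (max i j))
  · exact iSup_le fun n => mul_le_mul' (le_iSup a n) (le_iSup b n)

lemma lpow_mono (μ : Measure G) {V W : G → ℝ≥0∞} (h : V ≤ W) (k : ℕ) :
    lpow μ V k ≤ lpow μ W k := by
  induction k with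
  | zero => exact h
  | succ k ih => exact fun ξ => lintegral_mono fun η => mul_le_mul' (ih η) (h _)

variable [MeasurableAdd₂ G] [MeasurableNeg G] (μ : Measure G) [SFinite μ]

lemma measurable_lpow {V : G → ℝ≥0∞} (hV : Measurable V) (k : ℕ) : Measurable (lpow μ V k) := by
  induction k with
  | zero => exact hV
  | succ k ih =>
    refine Measurable.lintegral_prod_right' (f := fun z : G × G => lpow μ V k z.2 * V (z.1 - z.2)) ?_
    exact (ih.comp measurable_snd).mul (hV.comp (measurable_fst.sub measurable_snd))

lemma lpow_iSup {V : ℕ → G → ℝ≥0∞} (hV : ∀ n, Measurable (V n)) (hmono : Monotone V) (k : ℕ)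
    (ξ : G) : lpow μ (fun ξ => ⨆ n, V n ξ) k ξ = ⨆ n, lpow μ (V n) k ξ := by
  induction k generalizing ξ with
  | zero => rfl
  | succ k ih =>
    simp only [lpow]
    have hm : Monotone fun n => lpow μ (V n) k := fun i j hij => lpow_mono μ (hmono hij) k
    rw [← lintegral_iSup]
    · refine lintegral_congr fun η => ?_
      rw [ih η]
      exact iSup_mul_iSup_of_monotone (fun i j hij => hm hij η) (fun i j hij => hmono hij _)
    · intro n
      exact (measurable_lpow μ (hV n) k).mul ((hV n).comp (measurable_const.sub measurable_id))
    · exact fun i j hij η => mul_le_mul' (hm hij η) (hmono hij _)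

variable [μ.IsAddLeftInvariant]

/-- A submultiplicative weight splits along ξ = η + (ξ - η), so it distributes over the factors of
the convolution; Tonelli and translation invariance finish each step. -/
lemma lintegral_weight_mul_lpow_le {w V : G → ℝ≥0∞} (hw : Measurable w) (hV : Measurable V)
    (hsub : ∀ ξ η, w (ξ + η) ≤ w ξ * w η) (k : ℕ) :
    ∫⁻ ξ, w ξ * lpow μ V k ξ ∂μ ≤ (∫⁻ ξ, w ξ * V ξ ∂μ) ^ (k + 1) := by
  induction k with
  | zero => simp [lpow]
  | succ k ih =>
    have hl := measurable_lpow μ hV k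
    calc ∫⁻ ξ, w ξ * lpow μ V (k + 1) ξ ∂μ
        ≤ ∫⁻ ξ, ∫⁻ η, (w η * lpow μ V k η) * (w (ξ - η) * V (ξ - η)) ∂μ ∂μ := by
          refine lintegral_mono fun ξ => ?_
          simp only [lpow]
          rw [← lintegral_const_mul]
          · refine lintegral_mono fun η => ?_
            have := hsub η (ξ - η)
            rw [add_sub_cancel] at this
            calc w ξ * (lpow μ V k η * V (ξ - η))
                ≤ (w η * w (ξ - η)) * (lpow μ V k η * V (ξ - η)) := by gcongr
              _ = _ := by ring
          · exact hl.mul (hV.comp (measurable_const.sub measurable_id))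
      _ = ∫⁻ η, ∫⁻ ξ, (w η * lpow μ V k η) * (w (ξ - η) * V (ξ - η)) ∂μ ∂μ := by
          refine lintegral_lintegral_swap (Measurable.aemeasurable ?_)
          exact ((hw.mul hl).comp measurable_snd).mul
            ((hw.mul hV).comp (measurable_fst.sub measurable_snd))
      _ = ∫⁻ η, (w η * lpow μ V k η) * ∫⁻ ξ, w ξ * V ξ ∂μ ∂μ := by
          refine lintegral_congr fun η => ?_
          rw [← lintegral_sub_right_eq_self (fun ξ => w ξ * V ξ) η]
          exact lintegral_const_mul _ ((hw.mul hV).comp (measurable_id.sub_const η))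
      _ = (∫⁻ η, w η * lpow μ V k η ∂μ) * ∫⁻ ξ, w ξ * V ξ ∂μ :=
          lintegral_mul_const _ (hw.mul hl)
      _ ≤ _ := by rw [pow_succ _ (k + 1)]; gcongr

lemma lintegral_lpow_le {V : G → ℝ≥0∞} (hV : Measurable V) (k : ℕ) :
    ∫⁻ ξ, lpow μ V k ξ ∂μ ≤ (∫⁻ ξ, V ξ ∂μ) ^ (k + 1) := by
  simpa using lintegral_weight_mul_lpow_le μ (w := fun _ => 1) measurable_const hV (by simp) k

variable [μ.IsNegInvariant]

/-- One factor is estimated in supremum and the other k in L¹. -/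
lemma lpow_le {V : G → ℝ≥0∞} (hV : Measurable V) {B : ℝ≥0∞} (hB : ∀ ξ, V ξ ≤ B) (k : ℕ) (ξ : G) :
    lpow μ V k ξ ≤ (∫⁻ ξ, V ξ ∂μ) ^ k * B := by
  cases k with
  | zero => simpa [lpow] using hB ξ
  | succ k =>
    calc lpow μ V (k + 1) ξ ≤ ∫⁻ η, lpow μ V k η * B ∂μ :=
          lintegral_mono fun η => by gcongr; exact hB _
      _ = (∫⁻ η, lpow μ V k η ∂μ) * B := lintegral_mul_const _ (measurable_lpow μ hV k)
      _ ≤ _ := by gcongr; exact lintegral_lpow_le μ hV k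

lemma lpow_neg {V : G → ℝ≥0∞} (hs : ∀ ξ, V (-ξ) = V ξ) (k : ℕ) (ξ : G) :
    lpow μ V k (-ξ) = lpow μ V k ξ := by
  induction k generalizing ξ with
  | zero => exact hs ξ
  | succ k ih =>
    simp only [lpow]
    rw [← lintegral_neg_eq_self]
    refine lintegral_congr fun η => ?_
    rw [ih, ← hs]
    congr 2
    abel

/-- Evenness of V is what lets one majorant serve both `g` and its conjugate reflection. -/
lemma enorm_twist_le {V : G → ℝ≥0∞} (hs : ∀ ξ, V (-ξ) = V ξ) {g : G → ℂ}
    (hg : ∀ ξ, ‖g ξ‖ₑ ≤ V ξ) (b : Bool) (ξ : G) : ‖twist b g ξ‖ₑ ≤ V ξ := by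
  cases b with
  | true => simpa [twist] using hg ξ
  | false => simpa [twist, hs ξ] using hg (-ξ)

lemma enorm_twist_sub_le {g g' : G → ℂ} {D : ℝ≥0∞} (hD : ∀ ξ, ‖g ξ - g' ξ‖ₑ ≤ D) (b : Bool)
    (ξ : G) : ‖twist b g ξ - twist b g' ξ‖ₑ ≤ D := by
  cases b with
  | true => simpa [twist] using hD ξ
  | false =>
    have := hD (-ξ)
    simpa [twist, ← map_sub] using this

lemma measurable_twist_uncurry {α : Type*} [MeasurableSpace α] {f : α → G → ℂ}
    (hf : Measurable (Function.uncurry f)) (b : Bool) :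
    Measurable fun z : α × G => twist b (f z.1) z.2 := by
  cases b with
  | true => simpa [twist, Function.uncurry_def] using hf
  | false =>
    simp only [twist, Bool.false_eq_true, if_false]
    exact (Complex.continuous_conj.measurable).comp
      (hf.comp (measurable_fst.prodMk measurable_snd.neg))

lemma measurable_cpow_uncurry {α : Type*} [MeasurableSpace α] {f : α → G → ℂ}
    (hf : Measurable (Function.uncurry f)) (σ : ℕ → Bool) (k : ℕ) :
    Measurable fun z : α × G => cpow μ σ (f z.1) k z.2 := by
  induction k with
  | zero => exact measurable_twist_uncurry hf _
  | succ k ih =>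
    have h1 : Measurable fun z : (α × G) × G => cpow μ σ (f z.1.1) k z.2 :=
      ih.comp ((measurable_fst.comp measurable_fst).prodMk measurable_snd)
    have h2 : Measurable fun z : (α × G) × G => twist (σ (k + 1)) (f z.1.1) (z.1.2 - z.2) :=
      (measurable_twist_uncurry hf _).comp ((measurable_fst.comp measurable_fst).prodMk
        ((measurable_snd.comp measurable_fst).sub measurable_snd))
    exact ((h1.mul h2).stronglyMeasurable.integral_prod_right' (ν := μ)).measurable

lemma measurable_cpow {g : G → ℂ} (hg : Measurable g) (σ : ℕ → Bool) (k : ℕ) :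
    Measurable (cpow μ σ g k) :=
  (measurable_cpow_uncurry μ (f := fun _ : Unit => g) (hg.comp measurable_snd) σ k).comp
    (measurable_const (a := ()) |>.prodMk measurable_id)

lemma measurable_twist {g : G → ℂ} (hg : Measurable g) (b : Bool) :
    Measurable (twist b g) :=
  (measurable_twist_uncurry (f := fun _ : Unit => g) (hg.comp measurable_snd) b).comp
    (measurable_const (a := ()) |>.prodMk measurable_id)

lemma enorm_cpow_le {V : G → ℝ≥0∞} (hs : ∀ ξ, V (-ξ) = V ξ) {g : G → ℂ}
    (hg : ∀ ξ, ‖g ξ‖ₑ ≤ V ξ) (σ : ℕ → Bool) (k : ℕ) (ξ : G) :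
    ‖cpow μ σ g k ξ‖ₑ ≤ lpow μ V k ξ := by
  induction k generalizing ξ with
  | zero => exact enorm_twist_le hs hg _ ξ
  | succ k ih =>
    refine (enorm_integral_le_lintegral_enorm _).trans (lintegral_mono fun η => ?_)
    rw [enorm_mul]
    exact mul_le_mul' (ih η) (enorm_twist_le hs hg _ _)

section Bounded

variable {V : G → ℝ≥0∞} (hV : Measurable V) (hs : ∀ ξ, V (-ξ) = V ξ) {B : ℝ≥0∞} (hBt : B ≠ ∞)
  (hB : ∀ ξ, V ξ ≤ B) (hI : ∫⁻ ξ, V ξ ∂μ ≠ ∞)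

include hV hBt hB hI in
lemma lpow_lt_top (k : ℕ) (ξ : G) : lpow μ V k ξ < ∞ :=
  (lpow_le μ hV hB k ξ).trans_lt (ENNReal.mul_lt_top (ENNReal.pow_lt_top hI.lt_top) hBt.lt_top)

include hV hBt hB hI in
lemma lintegral_lpow_mul_lt_top (k : ℕ) (ξ : G) :
    ∫⁻ η, lpow μ V k η * V (ξ - η) ∂μ < ∞ :=
  lpow_lt_top μ hV hBt hB hI (k + 1) ξ

include hV hs hBt hB hI in
lemma integrable_cpow_mul_twist {g h : G → ℂ} (hgm : Measurable g) (hhm : Measurable h)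
    (hg : ∀ ξ, ‖g ξ‖ₑ ≤ V ξ) (hh : ∀ ξ, ‖h ξ‖ₑ ≤ V ξ) (σ : ℕ → Bool) (b : Bool) (k : ℕ) (ξ : G) :
    Integrable (fun η => cpow μ σ g k η * twist b h (ξ - η)) μ := by
  refine ⟨((measurable_cpow μ hgm σ k).mul
    ((measurable_twist hhm b).comp (measurable_const.sub measurable_id))).aestronglyMeasurable,
    lt_of_le_of_lt (lintegral_mono fun η => ?_) (lintegral_lpow_mul_lt_top μ hV hBt hB hI k ξ)⟩
  rw [enorm_mul]
  exact mul_le_mul' (enorm_cpow_le μ hs hg σ k η) (enorm_twist_le hs hh _ _)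

include hV hs hBt hB hI in
-- Telescoping: the k + 1 factors are exchanged one at a time, each exchange costing D times the L¹
-- norms of the other k factors.
lemma enorm_cpow_sub_le {g h : G → ℂ} (hgm : Measurable g) (hhm : Measurable h)
    (hg : ∀ ξ, ‖g ξ‖ₑ ≤ V ξ) (hh : ∀ ξ, ‖h ξ‖ₑ ≤ V ξ) {D : ℝ≥0∞} (hD : ∀ ξ, ‖g ξ - h ξ‖ₑ ≤ D)
    (σ : ℕ → Bool) (k : ℕ) (ξ : G) :
    ‖cpow μ σ g k ξ - cpow μ σ h k ξ‖ₑ ≤ (k + 1) * (∫⁻ ξ, V ξ ∂μ) ^ k * D := by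
  induction k generalizing ξ with
  | zero => simpa [cpow] using enorm_twist_sub_le hD (σ 0) ξ
  | succ k ih =>
    set I := ∫⁻ ξ, V ξ ∂μ
    have e : cpow μ σ g (k + 1) ξ - cpow μ σ h (k + 1) ξ
        = ∫ η, (cpow μ σ g k η * (twist (σ (k + 1)) g (ξ - η) - twist (σ (k + 1)) h (ξ - η))
          + (cpow μ σ g k η - cpow μ σ h k η) * twist (σ (k + 1)) h (ξ - η)) ∂μ := by
      simp only [cpow]
      rw [← integral_sub (integrable_cpow_mul_twist μ hV hs hBt hB hI hgm hgm hg hg σ _ k ξ)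
        (integrable_cpow_mul_twist μ hV hs hBt hB hI hhm hhm hh hh σ _ k ξ)]
      congr 1
      funext η
      ring
    rw [e]
    calc _ ≤ ∫⁻ η, (lpow μ V k η * D + ((k + 1) * I ^ k * D) * V (ξ - η)) ∂μ := by
          refine (enorm_integral_le_lintegral_enorm _).trans (lintegral_mono fun η => ?_)
          refine (enorm_add_le _ _).trans ?_
          rw [enorm_mul, enorm_mul]
          gcongr
          · exact enorm_cpow_le μ hs hg σ k η
          · exact enorm_twist_sub_le hD _ _
          · exact ih η
          · exact enorm_twist_le hs hh _ _
      _ = (∫⁻ η, lpow μ V k η ∂μ) * D + ((k + 1) * I ^ k * D) * I := by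
          have hV' : Measurable fun η => V (ξ - η) := hV.comp (measurable_const.sub measurable_id)
          rw [lintegral_add_left ((measurable_lpow μ hV k).mul_const D),
            lintegral_mul_const _ (measurable_lpow μ hV k), lintegral_const_mul _ hV',
            lintegral_sub_left_eq_self]
      _ ≤ I ^ (k + 1) * D + ((k + 1) * I ^ k * D) * I := by
          gcongr
          exact lintegral_lpow_le μ hV k
      _ = _ := by push_cast; ring

include hV hBt hB hI in
-- Dominated convergence under the convolution power of V. It supplies the time continuity that
-- allows the integral equation to be differentiated.
lemma continuousOn_cpow {X : Type*} [TopologicalSpace X] [FirstCountableTopology X]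
    (hs : ∀ ξ, V (-ξ) = V ξ)
    {f : X → G → ℂ} (hfm : ∀ x, Measurable (f x)) (hf : ∀ x ξ, ‖f x ξ‖ₑ ≤ V ξ)
    (hc : ∀ ξ, Continuous fun x => f x ξ) (σ : ℕ → Bool) (k : ℕ) (ξ : G) :
    Continuous fun x => cpow μ σ (f x) k ξ := by
  have ht : ∀ b ξ, Continuous fun x => twist b (f x) ξ := by
    intro b ξ
    cases b with
    | true => simpa [twist] using hc ξ
    | false =>
      simp only [twist, Bool.false_eq_true, if_false]
      exact Complex.continuous_conj.comp (hc _)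
  induction k generalizing ξ with
  | zero => exact ht _ ξ
  | succ k ih =>
    simp only [cpow]
    have hfin := (lintegral_lpow_mul_lt_top μ hV hBt hB hI k ξ).ne
    have hm : Measurable fun η => lpow μ V k η * V (ξ - η) :=
      (measurable_lpow μ hV k).mul (hV.comp (measurable_const.sub measurable_id))
    refine continuous_of_dominated (bound := fun η => (lpow μ V k η * V (ξ - η)).toReal)
      (fun x => ?_) (fun x => ?_) ?_ ?_
    · exact ((measurable_cpow μ (hfm x) σ k).mul
        ((measurable_twist (hfm x) _).comp (measurable_const.sub measurable_id))).aestronglyMeasurable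
    · refine Eventually.of_forall fun η => ?_
      have hη : lpow μ V k η * V (ξ - η) ≠ ∞ :=
        ENNReal.mul_ne_top (lpow_lt_top μ hV hBt hB hI k η).ne ((hB _).trans_lt hBt.lt_top).ne
      rw [← toReal_enorm]
      refine ENNReal.toReal_mono hη ?_
      rw [enorm_mul]
      exact mul_le_mul' (enorm_cpow_le μ hs (hf x) σ k η) (enorm_twist_le hs (hf x) _ _)
    · exact integrable_toReal_of_lintegral_ne_top hm.aemeasurable hfin
    · exact Eventually.of_forall fun η => (ih η).mul (ht _ _)

end Bounded

/-- A fixed majorant for the Picard iteration. -/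
lemma exists_majorant {w m : G → ℝ≥0∞} (hw : Measurable w) (hm : Measurable m)
    (hsub : ∀ ξ η, w (ξ + η) ≤ w ξ * w η) (hw1 : ∀ ξ, 1 ≤ w ξ) (hms : ∀ ξ, m (-ξ) = m ξ)
    {B a : ℝ≥0∞} (hB : ∀ ξ, m ξ ≤ B) (k : ℕ)
    (ha : a * (2 * ∫⁻ ξ, w ξ * m ξ ∂μ) ^ k ≤ 2⁻¹) :
    ∃ V : G → ℝ≥0∞, Measurable V ∧ (∀ ξ, V (-ξ) = V ξ) ∧ (∀ ξ, V ξ ≤ 2 * B) ∧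
      ∫⁻ ξ, w ξ * V ξ ∂μ ≤ 2 * ∫⁻ ξ, w ξ * m ξ ∂μ ∧ ∀ ξ, m ξ + a * lpow μ V k ξ ≤ V ξ := by
  set M := ∫⁻ ξ, w ξ * m ξ ∂μ with hM
  -- Monotone iteration from 0. Smallness of a (2M)^k makes Φ preserve both bounds V ≤ 2B and ∫ w V
  -- ≤ 2M, since x + (1/2)(2x) = 2x. The supremum of the increasing iterates is the majorant.
  let Φ : (G → ℝ≥0∞) → G → ℝ≥0∞ := fun V ξ => m ξ + a * lpow μ V k ξ
  have hΦ : Monotone Φ := fun V W h ξ => by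
    have := lpow_mono μ h k ξ
    simp only [Φ]
    gcongr
  let U : ℕ → G → ℝ≥0∞ := fun n => Φ^[n] 0
  have hU : ∀ n, U (n + 1) = Φ (U n) := fun n => Function.iterate_succ_apply' Φ n 0
  have hUmono : Monotone U := by
    refine monotone_nat_of_le_succ fun n => ?_
    induction n with
    | zero => exact fun ξ => zero_le
    | succ n ih => rw [hU, hU (n + 1)]; exact hΦ ih
  have half : ∀ x : ℝ≥0∞, x + 2⁻¹ * (2 * x) = 2 * x := fun x => by
    rw [← mul_assoc, ENNReal.inv_mul_cancel (by simp) (by simp)]; ring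
  have key : ∀ n, Measurable (U n) ∧ (∀ ξ, U n (-ξ) = U n ξ) ∧ (∀ ξ, U n ξ ≤ 2 * B) ∧
      ∫⁻ ξ, w ξ * U n ξ ∂μ ≤ 2 * M := by
    intro n
    induction n with
    | zero => exact ⟨measurable_const, fun _ => rfl, fun _ => zero_le, by simp [U]⟩
    | succ n ih =>
      obtain ⟨h1, h2, h3, h4⟩ := ih
      have hl := measurable_lpow μ h1 k
      have h5 : ∫⁻ ξ, U n ξ ∂μ ≤ 2 * M := (lintegral_mono fun ξ => by
        simpa using mul_le_mul' (hw1 ξ) (le_refl (U n ξ))).trans h4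
      rw [hU]
      refine ⟨hm.add (hl.const_mul a), fun ξ => ?_, fun ξ => ?_, ?_⟩
      · simp only [Φ, hms, lpow_neg μ h2]
      · calc Φ (U n) ξ ≤ B + a * ((2 * M) ^ k * (2 * B)) := by
              simp only [Φ]
              gcongr
              · exact hB ξ
              · exact (lpow_le μ h1 h3 k ξ).trans (by gcongr)
          _ = B + (a * (2 * M) ^ k) * (2 * B) := by ring
          _ ≤ B + 2⁻¹ * (2 * B) := by gcongr
          _ = 2 * B := half B
      · calc ∫⁻ ξ, w ξ * Φ (U n) ξ ∂μ = ∫⁻ ξ, (w ξ * m ξ + a * (w ξ * lpow μ (U n) k ξ)) ∂μ := by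
              refine lintegral_congr fun ξ => ?_
              simp only [Φ]
              ring
          _ = M + a * ∫⁻ ξ, w ξ * lpow μ (U n) k ξ ∂μ := by
              have e1 : Measurable fun ξ => w ξ * m ξ := hw.mul hm
              have e2 : Measurable fun ξ => w ξ * lpow μ (U n) k ξ := hw.mul hl
              rw [lintegral_add_left e1, lintegral_const_mul _ e2]
          _ ≤ M + a * (2 * M) ^ (k + 1) := by
              gcongr
              exact (lintegral_weight_mul_lpow_le μ hw h1 hsub k).trans (by gcongr)
          _ = M + (a * (2 * M) ^ k) * (2 * M) := by ring
          _ ≤ M + 2⁻¹ * (2 * M) := by gcongr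
          _ = 2 * M := half M
  refine ⟨fun ξ => ⨆ n, U n ξ, .iSup fun n => (key n).1, fun ξ => ?_, fun ξ => ?_, ?_, fun ξ => ?_⟩
  · simp only [fun n => (key n).2.1 ξ]
  · exact iSup_le fun n => (key n).2.2.1 ξ
  · simp only [ENNReal.mul_iSup]
    have e1 : ∀ n, Measurable fun ξ => w ξ * U n ξ := fun n => hw.mul (key n).1
    rw [lintegral_iSup e1 (fun i j hij ξ => mul_le_mul' le_rfl (hUmono hij ξ))]
    exact iSup_le fun n => (key n).2.2.2
  · rw [lpow_iSup μ (fun n => (key n).1) hUmono, ENNReal.mul_iSup, ENNReal.add_iSup]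
    refine iSup_le fun n => ?_
    have := congrFun (hU n) ξ
    exact this.symm.le.trans (le_iSup (fun n => U n ξ) (n + 1))

end Convolution
end NLS
end

/-! ### Picard iteration for the profile v = e^{itω} û -/

noncomputable section

set_option linter.unusedSectionVars false

namespace NLS

lemma enorm_intervalIntegral_le {f : ℝ → ℂ} {a b : ℝ} (hab : a ≤ b) {C : ℝ≥0∞}
    (hf : ∀ s ∈ Set.Ioc a b, ‖f s‖ₑ ≤ C) : ‖∫ s in a..b, f s‖ₑ ≤ C * ENNReal.ofReal (b - a) := by
  rw [intervalIntegral.integral_of_le hab]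
  refine (enorm_integral_le_lintegral_enorm _).trans ?_
  refine (setLIntegral_mono' measurableSet_Ioc hf).trans ?_
  simp

/-- The projection of `ℝ` onto `[0, T]`. -/
def clamp (T t : ℝ) : ℝ := max 0 (min t T)

lemma clamp_nonneg (T t : ℝ) : 0 ≤ clamp T t := le_max_left _ _

lemma clamp_le {T : ℝ} (hT : 0 ≤ T) (t : ℝ) : clamp T t ≤ T := max_le hT (min_le_right _ _)

lemma clamp_of_mem {T t : ℝ} (ht : t ∈ Set.Icc 0 T) : clamp T t = t := by
  simp [clamp, ht.1, ht.2]

lemma continuous_clamp (T : ℝ) : Continuous (clamp T) := by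
  unfold clamp
  fun_prop

section Picard

variable {G : Type*}

/-- The unimodular factor `e^{-itω}`. -/
def phase (ω : G → ℝ) (t : ℝ) (ξ : G) : ℂ := Complex.exp (((-(t * ω ξ) : ℝ) : ℂ) * Complex.I)

lemma norm_phase (ω : G → ℝ) (t : ℝ) (ξ : G) : ‖phase ω t ξ‖ = 1 :=
  Complex.norm_exp_ofReal_mul_I _

lemma enorm_phase (ω : G → ℝ) (t : ℝ) (ξ : G) : ‖phase ω t ξ‖ₑ = 1 := by
  rw [← ofReal_norm, norm_phase]; simp

lemma phase_mul_neg (ω : G → ℝ) (t : ℝ) (ξ : G) : phase ω t ξ * phase ω (-t) ξ = 1 := by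
  rw [phase, phase, ← Complex.exp_add, ← add_mul, ← Complex.ofReal_add]
  simp

lemma norm_phase_sub_le (ω ω' : G → ℝ) (t : ℝ) (ξ : G) :
    ‖phase ω t ξ - phase ω' t ξ‖ ≤ |t| * |ω ξ - ω' ξ| := by
  have h : phase ω t ξ - phase ω' t ξ = phase ω' t ξ *
      (Complex.exp (Complex.I * ((-(t * (ω ξ - ω' ξ)) : ℝ) : ℂ)) - 1) := by
    rw [mul_sub, mul_one, phase, phase, ← Complex.exp_add]
    congr 2
    push_cast
    ring
  rw [h, norm_mul, norm_phase, one_mul]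
  refine (Real.norm_exp_I_mul_ofReal_sub_one_le).trans ?_
  rw [Real.norm_eq_abs, abs_neg, abs_mul]

lemma continuous_phase (ω : G → ℝ) (ξ : G) : Continuous fun t => phase ω t ξ := by
  unfold phase
  fun_prop

variable [AddCommGroup G] [MeasurableSpace G]

lemma measurable_phase {ω : G → ℝ} (hω : Measurable ω) :
    Measurable fun z : ℝ × G => phase ω z.1 z.2 := by
  unfold phase
  have h1 : Measurable fun z : ℝ × G => -(z.1 * ω z.2) :=
    (measurable_fst.mul (hω.comp measurable_snd)).neg
  exact Complex.continuous_exp.measurable.comp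
    ((Complex.measurable_ofReal.comp h1).mul_const Complex.I)

lemma measurable_phase_right {ω : G → ℝ} (hω : Measurable ω) (t : ℝ) :
    Measurable (phase ω t) :=
  (measurable_phase hω).comp (measurable_prodMk_left (x := t))

/-- The nonlinear term of the equation for the profile `v = e^{itω} û`. -/
def profileNonlinearity (μ : Measure G) (σ : ℕ → Bool) (k : ℕ) (ω : G → ℝ) (v : ℝ → G → ℂ) (t : ℝ)
    (ξ : G) : ℂ :=
  phase ω (-t) ξ * cpow μ σ (fun η => phase ω t η * v t η) k ξ

/-- The Picard map of the equation for the profile. -/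
def picardMap (μ : Measure G) (σ : ℕ → Bool) (k : ℕ) (ω : G → ℝ) (c : ℂ) (T : ℝ) (g₀ : G → ℂ)
    (v : ℝ → G → ℂ) (t : ℝ) (ξ : G) : ℂ :=
  g₀ ξ + c * ∫ s in 0..clamp T t, profileNonlinearity μ σ k ω v s ξ

variable [MeasurableAdd₂ G] [MeasurableNeg G] (μ : Measure G) [SFinite μ] [μ.IsAddLeftInvariant]
  [μ.IsNegInvariant] (σ : ℕ → Bool) (k : ℕ) {ω : G → ℝ} (hω : Measurable ω)

lemma enorm_profileNonlinearity_le {V : G → ℝ≥0∞} (hs : ∀ ξ, V (-ξ) = V ξ)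
    {v : ℝ → G → ℂ} (hv : ∀ t ξ, ‖v t ξ‖ₑ ≤ V ξ) (t : ℝ) (ξ : G) :
    ‖profileNonlinearity μ σ k ω v t ξ‖ₑ ≤ lpow μ V k ξ := by
  rw [profileNonlinearity, enorm_mul, enorm_phase, one_mul]
  refine enorm_cpow_le μ hs (fun η => ?_) σ k ξ
  rw [enorm_mul, enorm_phase, one_mul]
  exact hv t η

include hω in
lemma measurable_phase_mul {v : ℝ → G → ℂ} (hv : Measurable (Function.uncurry v)) :
    Measurable (Function.uncurry fun t η => phase ω t η * v t η) := by
  have : (Function.uncurry fun t η => phase ω t η * v t η)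
      = fun z : ℝ × G => phase ω z.1 z.2 * Function.uncurry v z := rfl
  rw [this]
  exact (measurable_phase hω).mul hv

include hω in
lemma measurable_profileNonlinearity {v : ℝ → G → ℂ} (hv : Measurable (Function.uncurry v)) :
    Measurable fun z : ℝ × G => profileNonlinearity μ σ k ω v z.1 z.2 := by
  unfold profileNonlinearity
  refine Measurable.mul ?_ ?_
  · exact (measurable_phase hω).comp (measurable_fst.neg.prodMk measurable_snd)
  · exact measurable_cpow_uncurry μ (measurable_phase_mul hω hv) σ k

variable {V : G → ℝ≥0∞} (hV : Measurable V) (hs : ∀ ξ, V (-ξ) = V ξ) {B : ℝ≥0∞} (hBt : B ≠ ∞)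
  (hB : ∀ ξ, V ξ ≤ B) (hI : ∫⁻ ξ, V ξ ∂μ ≠ ∞)

include hω hV hs hBt hB hI in
lemma intervalIntegrable_profileNonlinearity {v : ℝ → G → ℂ}
    (hvm : Measurable (Function.uncurry v)) (hv : ∀ t ξ, ‖v t ξ‖ₑ ≤ V ξ) (ξ : G) (a b : ℝ) :
    IntervalIntegrable (fun s => profileNonlinearity μ σ k ω v s ξ) volume a b := by
  have hm : Measurable fun s => profileNonlinearity μ σ k ω v s ξ := by
    have h1 : Measurable fun s : ℝ => (s, ξ) := measurable_prodMk_right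
    have h2 := (measurable_profileNonlinearity μ σ k hω hvm).comp h1
    exact h2
  refine (intervalIntegrable_const (c := (lpow μ V k ξ).toReal)).mono_fun
    hm.aestronglyMeasurable (Eventually.of_forall fun s => ?_)
  simp only [Real.norm_eq_abs, abs_of_nonneg ENNReal.toReal_nonneg]
  rw [← toReal_enorm]
  exact ENNReal.toReal_mono (lpow_lt_top μ hV hBt hB hI k ξ).ne
    (enorm_profileNonlinearity_le μ σ k hs hv s ξ)

variable (c : ℂ) {T : ℝ} (hT : 0 ≤ T) {g₀ : G → ℂ} (hg₀ : Measurable g₀)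
  (hmaj : ∀ ξ, ‖g₀ ξ‖ₑ + ‖c‖ₑ * ENNReal.ofReal T * lpow μ V k ξ ≤ V ξ)
  (hcontr : ‖c‖ₑ * ENNReal.ofReal T * ((k + 1) * (∫⁻ ξ, V ξ ∂μ) ^ k) ≤ 2⁻¹)

include hs hT in
-- Besides keeping the iterates below V, this bound later measures how far the true profile moves
-- from the data.
lemma enorm_picardMap_sub_le {v : ℝ → G → ℂ} (hv : ∀ t ξ, ‖v t ξ‖ₑ ≤ V ξ) (t : ℝ) (ξ : G) :
    ‖picardMap μ σ k ω c T g₀ v t ξ - g₀ ξ‖ₑ ≤ ‖c‖ₑ * ENNReal.ofReal T * lpow μ V k ξ := by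
  rw [picardMap, add_sub_cancel_left, enorm_mul, mul_assoc]
  gcongr
  refine (enorm_intervalIntegral_le (clamp_nonneg T t)
    (fun s _ => enorm_profileNonlinearity_le μ σ k hs hv s ξ)).trans ?_
  rw [mul_comm]
  gcongr
  simpa using clamp_le hT t

include hs hT hmaj in
lemma enorm_picardMap_le {v : ℝ → G → ℂ} (hv : ∀ t ξ, ‖v t ξ‖ₑ ≤ V ξ) (t : ℝ) (ξ : G) :
    ‖picardMap μ σ k ω c T g₀ v t ξ‖ₑ ≤ V ξ := by
  refine le_trans ?_ (hmaj ξ)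
  have h := enorm_picardMap_sub_le μ σ k (ω := ω) hs c hT (g₀ := g₀) hv t ξ
  calc _ = ‖g₀ ξ + (picardMap μ σ k ω c T g₀ v t ξ - g₀ ξ)‖ₑ := by rw [add_sub_cancel]
    _ ≤ _ := (enorm_add_le _ _).trans (by gcongr)

include hω hg₀ in
lemma measurable_picardMap {v : ℝ → G → ℂ} (hvm : Measurable (Function.uncurry v)) :
    Measurable (Function.uncurry (picardMap μ σ k ω c T g₀ v)) := by
  have hF := measurable_profileNonlinearity μ σ k hω hvm
  have e : Function.uncurry (picardMap μ σ k ω c T g₀ v) = fun z : ℝ × G => g₀ z.2 + c *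
      ∫ s, (Set.Ioc 0 (clamp T z.1)).indicator
        (fun s => profileNonlinearity μ σ k ω v s z.2) s := by
    funext z
    simp only [Function.uncurry, picardMap]
    rw [intervalIntegral.integral_of_le (clamp_nonneg T z.1),
      integral_indicator measurableSet_Ioc]
  rw [e]
  refine (hg₀.comp measurable_snd).add (Measurable.const_mul ?_ c)
  -- The variable endpoint of integration is absorbed into an indicator on the product space, so
  -- that measurability of parametric integrals over a fixed domain applies.
  let S : Set ((ℝ × G) × ℝ) := {p | 0 < p.2 ∧ p.2 ≤ clamp T p.1.1}
  have hS : MeasurableSet S :=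
    (measurableSet_lt measurable_const measurable_snd).inter (measurableSet_le measurable_snd
      ((continuous_clamp T).measurable.comp (measurable_fst.comp measurable_fst)))
  have h1 : Measurable (S.indicator
      fun p : (ℝ × G) × ℝ => profileNonlinearity μ σ k ω v p.2 p.1.2) :=
    (hF.comp (measurable_snd.prodMk (measurable_snd.comp measurable_fst))).indicator hS
  have h2 := (h1.stronglyMeasurable.integral_prod_right' (ν := (volume : Measure ℝ))).measurable
  exact h2

include hω hV hs hBt hB hI hT hcontr in
-- The contraction is in the supremum norm over all times and frequencies; the L¹ bounds it needs
-- come from the common majorant, not from the distance itself.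
lemma enorm_picardMap_sub_picardMap_le {v v' : ℝ → G → ℂ}
    (hvm : Measurable (Function.uncurry v)) (hvm' : Measurable (Function.uncurry v'))
    (hv : ∀ t ξ, ‖v t ξ‖ₑ ≤ V ξ) (hv' : ∀ t ξ, ‖v' t ξ‖ₑ ≤ V ξ) {D : ℝ≥0∞}
    (hD : ∀ t ξ, ‖v t ξ - v' t ξ‖ₑ ≤ D) (t : ℝ) (ξ : G) :
    ‖picardMap μ σ k ω c T g₀ v t ξ - picardMap μ σ k ω c T g₀ v' t ξ‖ₑ ≤ 2⁻¹ * D := by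
  have hi := intervalIntegrable_profileNonlinearity μ σ k hω hV hs hBt hB hI hvm hv ξ 0 (clamp T t)
  have hi' :=
    intervalIntegrable_profileNonlinearity μ σ k hω hV hs hBt hB hI hvm' hv' ξ 0 (clamp T t)
  rw [picardMap, picardMap, add_sub_add_left_eq_sub, ← mul_sub, enorm_mul,
    ← intervalIntegral.integral_sub hi hi']
  have hsec : ∀ {f : ℝ → G → ℂ}, Measurable (Function.uncurry f) → ∀ s,
      Measurable fun η => phase ω s η * f s η := fun hf s =>
    (measurable_phase_mul hω hf).comp (measurable_prodMk_left (x := s))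
  have hbd : ∀ {f : ℝ → G → ℂ}, (∀ t ξ, ‖f t ξ‖ₑ ≤ V ξ) → ∀ s ξ,
      ‖phase ω s ξ * f s ξ‖ₑ ≤ V ξ := fun hf s ξ => by
    rw [enorm_mul, enorm_phase, one_mul]; exact hf s ξ
  have key : ∀ s, ‖profileNonlinearity μ σ k ω v s ξ - profileNonlinearity μ σ k ω v' s ξ‖ₑ
      ≤ (k + 1) * (∫⁻ ξ, V ξ ∂μ) ^ k * D := by
    intro s
    rw [profileNonlinearity, profileNonlinearity, ← mul_sub, enorm_mul, enorm_phase, one_mul]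
    refine enorm_cpow_sub_le μ hV hs hBt hB hI (hsec hvm s) (hsec hvm' s) (hbd hv s) (hbd hv' s)
      (fun η => ?_) σ k ξ
    rw [← mul_sub, enorm_mul, enorm_phase, one_mul]
    exact hD s η
  calc _ ≤ ‖c‖ₑ * ((k + 1) * (∫⁻ ξ, V ξ ∂μ) ^ k * D * ENNReal.ofReal T) := by
        gcongr
        refine (enorm_intervalIntegral_le (clamp_nonneg T t) fun s _ => key s).trans ?_
        gcongr
        simpa using clamp_le hT t
    _ = ‖c‖ₑ * ENNReal.ofReal T * ((k + 1) * (∫⁻ ξ, V ξ ∂μ) ^ k) * D := by ring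
    _ ≤ _ := by gcongr

include hω hV hs hBt hB hI hT hg₀ hmaj hcontr in
/-- Solutions of the integral equation for the profile. -/
theorem exists_profile :
    ∃ v : ℝ → G → ℂ, Measurable (Function.uncurry v) ∧ (∀ t ξ, ‖v t ξ‖ₑ ≤ V ξ) ∧
      (∀ ξ, Continuous fun t => v t ξ) ∧
      ∀ t ξ, v t ξ = picardMap μ σ k ω c T g₀ v t ξ := by
  set Γ := picardMap μ σ k ω c T g₀
  let U : ℕ → ℝ → G → ℂ := fun n => Γ^[n] fun _ => g₀
  have hU : ∀ n, U (n + 1) = Γ (U n) := fun n => Function.iterate_succ_apply' Γ n _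
  have hprop : ∀ n, Measurable (Function.uncurry (U n)) ∧ ∀ t ξ, ‖U n t ξ‖ₑ ≤ V ξ := by
    intro n
    induction n with
    | zero => exact ⟨hg₀.comp measurable_snd, fun t ξ => le_self_add.trans (hmaj ξ)⟩
    | succ n ih =>
      rw [hU]
      exact ⟨measurable_picardMap μ σ k hω c hg₀ ih.1, enorm_picardMap_le μ σ k hs c hT hmaj ih.2⟩
  -- The first two iterates both lie below V ≤ B, hence 2B; each later step halves the distance.
  have hstep : ∀ n t ξ, edist (U n t ξ) (U (n + 1) t ξ) ≤ (2 * B) / 2 ^ n := by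
    intro n
    induction n with
    | zero =>
      intro t ξ
      rw [edist_eq_enorm_sub]
      refine (enorm_sub_le).trans ?_
      rw [pow_zero, div_one, two_mul]
      exact add_le_add (((hprop 0).2 t ξ).trans (hB ξ)) (((hprop 1).2 t ξ).trans (hB ξ))
    | succ n ih =>
      intro t ξ
      rw [hU (n + 1), hU n, edist_eq_enorm_sub]
      refine (enorm_picardMap_sub_picardMap_le μ σ k hω hV hs hBt hB hI c hT hcontr
        (hprop n).1 (by rw [← hU]; exact (hprop (n + 1)).1) (hprop n).2
        (by rw [← hU]; exact (hprop (n + 1)).2)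
        (D := (2 * B) / 2 ^ n) (fun s η => ?_) t ξ).trans ?_
      · rw [← edist_eq_enorm_sub, ← hU]
        exact ih s η
      · rw [pow_succ, ENNReal.div_eq_inv_mul, ENNReal.div_eq_inv_mul,
          ENNReal.mul_inv (by simp) (by simp)]
        exact le_of_eq (by ring)
  have hC : (2 * B) ≠ ∞ := ENNReal.mul_ne_top (by simp) hBt
  have hlim : ∀ t ξ, ∃ a, Tendsto (fun n => U n t ξ) atTop (𝓝 a) := fun t ξ =>
    cauchySeq_tendsto_of_complete (cauchySeq_of_edist_le_geometric_two _ hC fun n => hstep n t ξ)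
  choose v hv using hlim
  have hvm : Measurable (Function.uncurry v) := by
    refine measurable_of_tendsto_metrizable (fun n => (hprop n).1) ?_
    rw [tendsto_pi_nhds]
    exact fun z => hv z.1 z.2
  have hvV : ∀ t ξ, ‖v t ξ‖ₑ ≤ V ξ := fun t ξ =>
    le_of_tendsto ((hv t ξ).enorm) (Eventually.of_forall fun n => (hprop n).2 t ξ)
  have hdist : ∀ n t ξ, ‖U n t ξ - v t ξ‖ₑ ≤ 2 * (2 * B) / 2 ^ n := fun n t ξ => by
    rw [← edist_eq_enorm_sub]
    exact edist_le_of_edist_le_geometric_two_of_tendsto _ (fun n => hstep n t ξ) (hv t ξ) n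
  have hfix : ∀ t ξ, v t ξ = Γ v t ξ := by
    intro t ξ
    refine tendsto_nhds_unique ((tendsto_add_atTop_iff_nat 1).2 (hv t ξ)) ?_
    rw [tendsto_iff_edist_tendsto_0]
    have h0 : Tendsto (fun n : ℕ => (2⁻¹ * (2 * (2 * B))) * (2⁻¹ : ℝ≥0∞) ^ n) atTop (𝓝 0) := by
      have := ENNReal.Tendsto.const_mul (a := 2⁻¹ * (2 * (2 * B)))
        (ENNReal.tendsto_pow_atTop_nhds_zero_of_lt_one (r := (2⁻¹ : ℝ≥0∞)) (by simp))
        (Or.inr (ENNReal.mul_ne_top (by simp) (ENNReal.mul_ne_top (by simp) hC)))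
      simpa using this
    refine tendsto_of_tendsto_of_tendsto_of_le_of_le tendsto_const_nhds h0 (fun _ => zero_le)
      fun n => ?_
    simp only [hU, edist_eq_enorm_sub]
    refine (enorm_picardMap_sub_picardMap_le μ σ k hω hV hs hBt hB hI c hT hcontr
      (hprop n).1 hvm (hprop n).2 hvV (hdist n) t ξ).trans (le_of_eq ?_)
    rw [ENNReal.div_eq_inv_mul, ENNReal.inv_pow]
    ring
  refine ⟨v, hvm, hvV, fun ξ => ?_, hfix⟩
  -- Continuity in time is read off the fixed-point equation: the right-hand side is a primitive
  -- composed with the continuous clamp.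
  have h1 := (intervalIntegral.continuous_primitive
    (fun a b => intervalIntegrable_profileNonlinearity μ σ k hω hV hs hBt hB hI hvm hvV ξ a b)
    0).comp (continuous_clamp T)
  have h2 : (fun t => v t ξ) = fun t => g₀ ξ + c * ((fun b => ∫ x in 0..b,
      profileNonlinearity μ σ k ω v x ξ) ∘ clamp T) t := by
    funext t
    exact hfix t ξ
  rw [h2]
  exact continuous_const.add (continuous_const.mul h1)

end Picard
end NLS
end

/-! ### Fourier analysis on ℝ^{d₁} × ℤ^{d₂}: measure, characters, uniqueness -/

noncomputable section

namespace NLS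

section Frequency

variable {d₁ d₂ : ℕ}

lemma count_eq_pi_count (n : ℕ) :
    (Measure.count : Measure (Fin n → ℤ)) = Measure.pi fun _ => Measure.count := by
  refine Measure.ext_of_singleton fun f => ?_
  rw [Measure.pi_singleton]
  simp

instance : SigmaFinite (freqMeasure d₁ d₂) := by unfold freqMeasure; infer_instance

instance : (freqMeasure d₁ d₂).IsAddLeftInvariant := by unfold freqMeasure; infer_instance

instance : (freqMeasure d₁ d₂).IsNegInvariant := by
  unfold freqMeasure
  refine ⟨?_⟩
  have h : MeasurePreserving (Prod.map (fun x : EuclideanSpace ℝ (Fin d₁) => -x)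
      (fun n : Fin d₂ → ℤ => -n)) (volume.prod Measure.count) (volume.prod Measure.count) :=
    (Measure.measurePreserving_neg _).prod (Measure.measurePreserving_neg _)
  exact h.map_eq

/-- The frequency domain as a subset of `ℝ^{d₁ + d₂}`. -/
def coord (ξ : Freq d₁ d₂) : Cover d₁ d₂ :=
  WithLp.toLp 2 (Sum.elim (fun i => ξ.1 i) fun j => (ξ.2 j : ℝ))

lemma coord_inl (ξ : Freq d₁ d₂) (i : Fin d₁) : coord ξ (Sum.inl i) = ξ.1 i := rfl

lemma coord_inr (ξ : Freq d₁ d₂) (j : Fin d₂) : coord ξ (Sum.inr j) = ξ.2 j := rfl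

lemma coord_add (ξ η : Freq d₁ d₂) : coord (ξ + η) = coord ξ + coord η := by
  ext i
  rcases i with i | j
  · simp [coord]
  · simp [coord]

lemma coord_neg (ξ : Freq d₁ d₂) : coord (-ξ) = -coord ξ := by
  ext i
  rcases i with i | j
  · simp [coord]
  · simp [coord]

lemma coord_sub (ξ η : Freq d₁ d₂) : coord (ξ - η) = coord ξ - coord η := by
  rw [sub_eq_add_neg, coord_add, coord_neg, sub_eq_add_neg]

lemma norm_coord_sq (ξ : Freq d₁ d₂) :
    ‖coord ξ‖ ^ 2 = ‖ξ.1‖ ^ 2 + ∑ j, (ξ.2 j : ℝ) ^ 2 := by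
  simp [EuclideanSpace.norm_sq_eq, coord]

lemma bracket_eq (ξ : Freq d₁ d₂) : bracket ξ = √(1 + ‖coord ξ‖ ^ 2) := by
  rw [bracket, norm_coord_sq]

lemma bracket_sq (ξ : Freq d₁ d₂) : bracket ξ ^ 2 = 1 + ‖coord ξ‖ ^ 2 := by
  rw [bracket_eq, Real.sq_sqrt (by positivity)]

lemma one_le_bracket (ξ : Freq d₁ d₂) : 1 ≤ bracket ξ := by
  rw [bracket_eq, Real.one_le_sqrt]
  nlinarith [sq_nonneg ‖coord ξ‖]

lemma bracket_pos (ξ : Freq d₁ d₂) : 0 < bracket ξ := one_pos.trans_le (one_le_bracket ξ)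

lemma norm_coord_le_bracket (ξ : Freq d₁ d₂) : ‖coord ξ‖ ≤ bracket ξ := by
  rw [bracket_eq]
  exact Real.le_sqrt_of_sq_le (by linarith)

lemma bracket_le (ξ : Freq d₁ d₂) : bracket ξ ≤ 1 + ‖coord ξ‖ := by
  rw [bracket_eq]
  exact Real.sqrt_le_iff.2 ⟨by positivity, by nlinarith [norm_nonneg (coord ξ)]⟩

lemma measurable_coord : Measurable (coord : Freq d₁ d₂ → Cover d₁ d₂) := by
  unfold coord
  refine (WithLp.measurable_toLp 2 _).comp (measurable_pi_lambda _ fun i => ?_)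
  rcases i with i | j
  · simp only [Sum.elim_inl]
    fun_prop
  · simp only [Sum.elim_inr]
    exact (measurable_from_top (f := fun n : ℤ => (n : ℝ))).comp
      ((measurable_pi_apply j).comp measurable_snd)

lemma coord_injective : Function.Injective (coord : Freq d₁ d₂ → Cover d₁ d₂) := by
  intro ξ η h
  refine Prod.ext ?_ ?_
  · ext i
    rw [← coord_inl, ← coord_inl, h]
  · funext j
    have := congrFun (congrArg WithLp.ofLp h) (Sum.inr j)
    simpa [coord] using this

lemma measurableEmbedding_coord :
    MeasurableEmbedding (coord : Freq d₁ d₂ → Cover d₁ d₂) :=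
  measurable_coord.measurableEmbedding coord_injective

lemma measurable_bracket : Measurable (bracket : Freq d₁ d₂ → ℝ) := by
  have : (bracket : Freq d₁ d₂ → ℝ) = fun ξ => √(1 + ‖coord ξ‖ ^ 2) := funext bracket_eq
  rw [this]
  exact ((measurable_coord.norm.pow_const 2).const_add 1).sqrt

lemma proj_surjective : Function.Surjective (proj : Cover d₁ d₂ → Space d₁ d₂) := by
  rintro ⟨x, z⟩
  choose y hy using fun j => QuotientAddGroup.mk_surjective (z j)
  refine ⟨WithLp.toLp 2 (Sum.elim (fun i => x i) y), ?_⟩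
  refine Prod.ext ?_ ?_
  · ext i
    simp [proj]
  · funext j
    simpa [proj] using hy j

/-- Lifting to the Euclidean cover turns a character into one exponential; modulus, additivity,
conjugation and differentiation are all deduced from this form. -/
lemma character_proj (ξ : Freq d₁ d₂) (y : Cover d₁ d₂) :
    character ξ (proj y) = Complex.exp (((inner ℝ (coord ξ) y : ℝ) : ℂ) * Complex.I) := by
  have h : (inner ℝ (coord ξ) y : ℝ) = inner ℝ ξ.1 (proj y).1 +
      ∑ j, (ξ.2 j : ℝ) * y (Sum.inr j) := by
    simp [PiLp.inner_apply, coord, proj, mul_comm]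
  rw [h, character, Complex.ofReal_add, add_mul, Complex.exp_add, mul_comm Complex.I]
  congr 1
  rw [Complex.ofReal_sum, Finset.sum_mul, Complex.exp_sum]
  refine Finset.prod_congr rfl fun j _ => ?_
  simp only [proj]
  rw [fourier_coe_apply]
  congr 1
  push_cast
  field_simp

lemma norm_character (ξ : Freq d₁ d₂) (x : Space d₁ d₂) : ‖character ξ x‖ = 1 := by
  obtain ⟨y, rfl⟩ := proj_surjective x
  rw [character_proj, Complex.norm_exp_ofReal_mul_I]

lemma character_add (ξ η : Freq d₁ d₂) (x : Space d₁ d₂) :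
    character (ξ + η) x = character ξ x * character η x := by
  obtain ⟨y, rfl⟩ := proj_surjective x
  rw [character_proj, character_proj, character_proj, ← Complex.exp_add, ← add_mul, coord_add,
    inner_add_left, Complex.ofReal_add]

lemma character_neg (ξ : Freq d₁ d₂) (x : Space d₁ d₂) :
    character (-ξ) x = starRingEnd ℂ (character ξ x) := by
  obtain ⟨y, rfl⟩ := proj_surjective x
  rw [character_proj, character_proj, ← Complex.exp_conj, coord_neg, inner_neg_left]
  simp

lemma measurable_character (x : Space d₁ d₂) : Measurable fun ξ : Freq d₁ d₂ => character ξ x := by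
  obtain ⟨y, rfl⟩ := proj_surjective x
  simp only [character_proj]
  refine Complex.continuous_exp.measurable.comp (Measurable.mul_const ?_ _)
  exact Complex.measurable_ofReal.comp (measurable_coord.inner_const)

lemma integrable_mul_character {g : Freq d₁ d₂ → ℂ} (hg : Integrable g (freqMeasure d₁ d₂))
    (x : Space d₁ d₂) : Integrable (fun ξ => g ξ * character ξ x) (freqMeasure d₁ d₂) :=
  hg.mul_bdd (c := 1) (measurable_character x).aestronglyMeasurable
    (Eventually.of_forall fun ξ => (norm_character ξ x).le)

lemma integrable_count_int : Integrable (fun n : ℤ => (1 + (n : ℝ) ^ 2)⁻¹) Measure.count := by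
  rw [integrable_count_iff]
  refine Summable.of_nonneg_of_le (f := fun n : ℤ => 2 * (1 / ((|n| : ℝ) + 1) ^ 2))
    (fun n => by positivity) (fun n => ?_) ?_
  · rw [Real.norm_of_nonneg (by positivity), ← one_div, ← sq_abs, mul_one_div,
      div_le_div_iff₀ (by positivity) (by positivity)]
    nlinarith [sq_nonneg (|(n : ℝ)| - 1)]
  · refine Summable.mul_left 2 ?_
    refine Summable.of_nat_of_neg (f := fun n : ℤ => 1 / ((|n| : ℝ) + 1) ^ 2) ?_ ?_
    · have := (summable_nat_add_iff 1).2 (Real.summable_one_div_nat_pow.2 one_lt_two)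
      refine this.congr fun n => ?_
      simp
    · have := (summable_nat_add_iff 1).2 (Real.summable_one_div_nat_pow.2 one_lt_two)
      refine this.congr fun n => ?_
      simp

/-- Of the d₁ + 1 + d₂ powers of 1 + |ξ|², the first d₁ + 1 make the Euclidean variable integrable
and the remaining d₂ pay for one integer variable each. -/
lemma integrable_bracket :
    Integrable (fun ξ : Freq d₁ d₂ => (bracket ξ ^ (2 * (d₁ + 1 + d₂)))⁻¹)
      (freqMeasure d₁ d₂) := by
  have h1 : Integrable (fun x : EuclideanSpace ℝ (Fin d₁) =>
      (1 + ‖x‖ ^ 2) ^ (-((d₁ : ℝ) + 1) / 2)) volume :=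
    integrable_rpow_neg_one_add_norm_sq (by simp)
  have h2 : Integrable (fun n : Fin d₂ → ℤ => ∏ j, (1 + (n j : ℝ) ^ 2)⁻¹) Measure.count := by
    rw [count_eq_pi_count]
    exact Integrable.fintype_prod (fun _ => integrable_count_int)
  refine (h1.mul_prod h2).mono' ?_ (Eventually.of_forall fun ξ => ?_)
  · exact (measurable_bracket.pow_const _).inv.aestronglyMeasurable
  · have hb := one_le_bracket ξ
    have hS : ‖coord ξ‖ ^ 2 = ‖ξ.1‖ ^ 2 + ∑ j, (ξ.2 j : ℝ) ^ 2 := norm_coord_sq ξ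
    rw [norm_inv, norm_pow, Real.norm_of_nonneg (bracket_pos ξ).le, pow_mul, bracket_sq, pow_add,
      mul_inv]
    refine mul_le_mul ?_ ?_ (by positivity) (by positivity)
    · have hle : (1 + ‖ξ.1‖ ^ 2) ≤ 1 + ‖coord ξ‖ ^ 2 := by
        rw [hS]
        have : 0 ≤ ∑ j, (ξ.2 j : ℝ) ^ 2 := Finset.sum_nonneg fun _ _ => sq_nonneg _
        linarith
      rw [neg_div, Real.rpow_neg (by positivity)]
      refine inv_anti₀ (by positivity) ?_
      calc (1 + ‖ξ.1‖ ^ 2) ^ (((d₁ : ℝ) + 1) / 2) ≤ (1 + ‖ξ.1‖ ^ 2) ^ (((d₁ + 1 : ℕ)) : ℝ) := by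
            refine Real.rpow_le_rpow_of_exponent_le (by nlinarith [sq_nonneg ‖ξ.1‖]) ?_
            push_cast
            linarith [(Nat.cast_nonneg d₁ : (0 : ℝ) ≤ d₁)]
        _ = (1 + ‖ξ.1‖ ^ 2) ^ (d₁ + 1) := Real.rpow_natCast _ _
        _ ≤ _ := by gcongr
    · rw [Finset.prod_inv_distrib]
      refine inv_anti₀ (Finset.prod_pos fun _ _ => by positivity) ?_
      calc ∏ j, (1 + (ξ.2 j : ℝ) ^ 2) ≤ ∏ _j : Fin d₂, (1 + ‖coord ξ‖ ^ 2) := by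
            refine Finset.prod_le_prod (fun _ _ => by positivity) fun j _ => ?_
            rw [hS]
            have := Finset.single_le_sum (f := fun j => (ξ.2 j : ℝ) ^ 2)
              (fun _ _ => sq_nonneg _) (Finset.mem_univ j)
            nlinarith [sq_nonneg ‖ξ.1‖]
        _ = _ := by simp

lemma weightedNorm_natCast (k : ℕ) (g : Freq d₁ d₂ → ℂ) :
    weightedNorm (k : ℝ) g = eLpNorm (fun ξ => bracket ξ ^ k • g ξ) 2 (freqMeasure d₁ d₂) := by
  simp only [weightedNorm, Real.rpow_natCast]

lemma IsFourierTransform.memLp {f : Space d₁ d₂ → ℂ} {g : Freq d₁ d₂ → ℂ}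
    (h : IsFourierTransform f g) (k : ℕ) :
    MemLp (fun ξ => bracket ξ ^ k • g ξ) 2 (freqMeasure d₁ d₂) :=
  ⟨(measurable_bracket.pow_const k).aestronglyMeasurable.smul h.1, by
    rw [← weightedNorm_natCast]; exact h.2 k⟩

/-- Cauchy–Schwarz against an inverse power of the bracket, which is square integrable. -/
lemma IsFourierTransform.integrable {f : Space d₁ d₂ → ℂ} {g : Freq d₁ d₂ → ℂ}
    (h : IsFourierTransform f g) : Integrable g (freqMeasure d₁ d₂) := by
  set K := d₁ + 1 + d₂
  have h1 : MemLp (fun ξ : Freq d₁ d₂ => (bracket ξ ^ K)⁻¹) 2 (freqMeasure d₁ d₂) := by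
    have hm : Measurable fun ξ : Freq d₁ d₂ => (bracket ξ ^ K)⁻¹ :=
      (measurable_bracket.pow_const K).inv
    rw [memLp_two_iff_integrable_sq hm.aestronglyMeasurable]
    refine integrable_bracket.congr (Eventually.of_forall fun ξ => ?_)
    simp only [K, inv_pow]
    ring
  have h2 := h1.integrable_mul (p := 2) (q := 2) (h.memLp K).norm
  refine h2.mono' h.1 (Eventually.of_forall fun ξ => ?_)
  have hb : 0 < bracket ξ ^ K := pow_pos (bracket_pos ξ) K
  simp only [Pi.mul_apply, norm_smul, Real.norm_of_nonneg hb.le]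
  rw [inv_mul_cancel_left₀ hb.ne']

/-- The positive and negative parts of r are densities of finite measures. Pushed forward to the
cover they have equal characteristic functions, hence coincide, and injectivity of `coord` brings
the equality back. -/
lemma ae_eq_zero_of_real {r : Freq d₁ d₂ → ℝ} (hr : Integrable r (freqMeasure d₁ d₂))
    (h : ∀ y : Cover d₁ d₂, ∫ ξ, (r ξ : ℂ) * character ξ (proj y) ∂(freqMeasure d₁ d₂) = 0) :
    r =ᵐ[freqMeasure d₁ d₂] 0 := by
  set μ := freqMeasure d₁ d₂
  have hneg := hr.neg
  have hfin : ∀ {f : Freq d₁ d₂ → ℝ}, Integrable f μ →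
      IsFiniteMeasure (μ.withDensity fun ξ => ENNReal.ofReal (f ξ)) := fun hf =>
    isFiniteMeasure_withDensity_ofReal hf.2
  have := hfin hr
  have := hfin hneg
  have hchar : ∀ {f : Freq d₁ d₂ → ℝ}, Integrable f μ → ∀ y : Cover d₁ d₂,
      charFun ((μ.withDensity fun ξ => ENNReal.ofReal (f ξ)).map coord) y
        = ∫ ξ, ((max (f ξ) 0 : ℝ) : ℂ) * character ξ (proj y) ∂μ := by
    intro f hf y
    rw [charFun_apply, measurableEmbedding_coord.integral_map,
      integral_withDensity_eq_integral_toReal_smul₀ hf.1.aemeasurable.ennreal_ofReal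
        (Eventually.of_forall fun _ => ENNReal.ofReal_lt_top)]
    refine integral_congr_ae (Eventually.of_forall fun ξ => ?_)
    simp only [character_proj, ENNReal.toReal_ofReal', Complex.real_smul]
  have heq : (μ.withDensity fun ξ => ENNReal.ofReal (r ξ)).map coord
      = (μ.withDensity fun ξ => ENNReal.ofReal (-r ξ)).map coord := by
    have := (μ.withDensity fun ξ => ENNReal.ofReal (r ξ)).isFiniteMeasure_map
      (coord : Freq d₁ d₂ → Cover d₁ d₂)
    have := (μ.withDensity fun ξ => ENNReal.ofReal (-r ξ)).isFiniteMeasure_map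
      (coord : Freq d₁ d₂ → Cover d₁ d₂)
    refine Measure.ext_of_charFun (funext fun y => ?_)
    rw [hchar hr, hchar (f := fun ξ => -r ξ) hneg, ← sub_eq_zero, ← integral_sub]
    · rw [← h y]
      refine integral_congr_ae (Eventually.of_forall fun ξ => ?_)
      simp only
      rw [← sub_mul, ← Complex.ofReal_sub]
      congr 2
      rcases le_total (r ξ) 0 with h0 | h0
      · rw [max_eq_right h0, max_eq_left (by linarith)]; ring
      · rw [max_eq_left h0, max_eq_right (by linarith)]; ring
    · exact integrable_mul_character hr.pos_part.ofReal _
    · exact integrable_mul_character hneg.pos_part.ofReal _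
  have heq2 : (μ.withDensity fun ξ => ENNReal.ofReal (r ξ))
      = (μ.withDensity fun ξ => ENNReal.ofReal (-r ξ)) := by
    have := congrArg (Measure.comap coord) heq
    rwa [measurableEmbedding_coord.comap_map, measurableEmbedding_coord.comap_map] at this
  have h3 := (withDensity_eq_iff_of_sigmaFinite hr.1.aemeasurable.ennreal_ofReal
    hneg.1.aemeasurable.ennreal_ofReal).1 heq2
  filter_upwards [h3] with ξ hξ
  simp only [Pi.zero_apply]
  rcases le_total (r ξ) 0 with h0 | h0
  · rw [ENNReal.ofReal_of_nonpos h0] at hξ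
    have := ENNReal.ofReal_eq_zero.1 hξ.symm
    simp only [Pi.neg_apply] at this
    linarith
  · have h4 : ENNReal.ofReal (-r ξ) = 0 := ENNReal.ofReal_eq_zero.2 (by linarith)
    have h5 := ENNReal.ofReal_eq_zero.1 (hξ.trans h4)
    linarith

/-- Injectivity of the Fourier transform on integrable functions. -/
lemma ae_eq_zero_of_integral_character {h : Freq d₁ d₂ → ℂ}
    (hi : Integrable h (freqMeasure d₁ d₂))
    (h0 : ∀ x, ∫ ξ, h ξ * character ξ x ∂(freqMeasure d₁ d₂) = 0) :
    h =ᵐ[freqMeasure d₁ d₂] 0 := by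
  -- Conjugation of h corresponds to conjugation and y ↦ -y on the transform, so the conjugate also
  -- has zero transform; real and imaginary parts can then be treated separately.
  have hconj : ∀ y : Cover d₁ d₂,
      ∫ ξ, starRingEnd ℂ (h ξ) * character ξ (proj y) ∂(freqMeasure d₁ d₂) = 0 := by
    intro y
    have h1 := congrArg (starRingEnd ℂ) (h0 (proj (-y)))
    rw [← integral_conj, map_zero] at h1
    rw [← h1]
    refine integral_congr_ae (Eventually.of_forall fun ξ => ?_)
    simp only [map_mul, character_proj, ← Complex.exp_conj, inner_neg_right]
    simp
  have hic : Integrable (fun ξ => starRingEnd ℂ (h ξ)) (freqMeasure d₁ d₂) :=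
    hi.mono (Complex.continuous_conj.comp_aestronglyMeasurable hi.1)
      (Eventually.of_forall fun ξ => by simp)
  have hre := ae_eq_zero_of_real (r := fun ξ => (h ξ).re) hi.re fun y => by
    have e : ∀ ξ : Freq d₁ d₂, (((h ξ).re : ℝ) : ℂ) * character ξ (proj y)
        = 2⁻¹ * (h ξ * character ξ (proj y))
          + 2⁻¹ * (starRingEnd ℂ (h ξ) * character ξ (proj y)) := fun ξ => by
      rw [Complex.re_eq_add_conj]; ring
    simp only [e]
    rw [integral_add ((integrable_mul_character hi _).const_mul _)
      ((integrable_mul_character hic _).const_mul _), integral_const_mul, integral_const_mul, h0,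
      hconj]
    simp
  have him := ae_eq_zero_of_real (r := fun ξ => (h ξ).im) hi.im fun y => by
    have e : ∀ ξ : Freq d₁ d₂, (((h ξ).im : ℝ) : ℂ) * character ξ (proj y)
        = (2 * Complex.I)⁻¹ * (h ξ * character ξ (proj y))
          - (2 * Complex.I)⁻¹ * (starRingEnd ℂ (h ξ) * character ξ (proj y)) := fun ξ => by
      rw [Complex.im_eq_sub_conj]; ring
    simp only [e]
    rw [integral_sub ((integrable_mul_character hi _).const_mul _)
      ((integrable_mul_character hic _).const_mul _), integral_const_mul, integral_const_mul, h0,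
      hconj]
    simp
  filter_upwards [hre, him] with ξ h1 h2
  exact Complex.ext h1 h2

lemma IsFourierTransform.ae_eq {f : Space d₁ d₂ → ℂ} {g g' : Freq d₁ d₂ → ℂ}
    (h : IsFourierTransform f g) (h' : IsFourierTransform f g') :
    g =ᵐ[freqMeasure d₁ d₂] g' := by
  have := ae_eq_zero_of_integral_character (h := fun ξ => g ξ - g' ξ)
    (h.integrable.sub h'.integrable) fun x => by
      simp only [sub_mul]
      rw [integral_sub (integrable_mul_character h.integrable _)
        (integrable_mul_character h'.integrable _), sub_eq_zero]
      have e := (h.3 x).symm.trans (h'.3 x)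
      refine mul_left_cancel₀ ?_ e
      exact Complex.ofReal_ne_zero.2 (Real.rpow_pos_of_pos (by positivity) _).ne'
  filter_upwards [this] with ξ hξ
  exact sub_eq_zero.1 hξ

/-- Uniqueness makes the choice in `fourierTransform` harmless: Sobolev norms may be computed from
any explicit transform. -/
lemma IsFourierTransform.sobolevNorm_eq {f : Space d₁ d₂ → ℂ} {g : Freq d₁ d₂ → ℂ}
    (h : IsFourierTransform f g) (s : ℝ) : sobolevNorm s f = weightedNorm s g := by
  have hm : MemHInfty f := ⟨g, h⟩
  have hc : fourierTransform f = hm.choose := by simp [fourierTransform, hm]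
  rw [sobolevNorm, hc, weightedNorm, weightedNorm]
  refine eLpNorm_congr_ae ?_
  filter_upwards [hm.choose_spec.ae_eq h] with ξ hξ
  rw [hξ]

lemma IsFourierTransform.sub {f f' : Space d₁ d₂ → ℂ} {g g' : Freq d₁ d₂ → ℂ}
    (h : IsFourierTransform f g) (h' : IsFourierTransform f' g') :
    IsFourierTransform (f - f') (fun ξ => g ξ - g' ξ) where
  aestronglyMeasurable := h.1.sub h'.1
  weightedNorm_lt_top k := by
    rw [weightedNorm_natCast]
    simp only [smul_sub]
    exact ((h.memLp k).sub (h'.memLp k)).2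
  inversion x := by
    simp only [sub_mul, Pi.sub_apply]
    rw [integral_sub (integrable_mul_character h.integrable _)
      (integrable_mul_character h'.integrable _), h.3, h'.3, mul_sub]

end Frequency
end NLS
end

noncomputable section

namespace NLS

/-! ### Rapidly decreasing majorants and Fourier inversion -/

section Inversion

variable {d₁ d₂ : ℕ}

/-- The normalizing constant `(2π)^{-d/2}` of the unitary Fourier transform. -/
def fourierConst (d₁ d₂ : ℕ) : ℝ := (2 * π) ^ (-(((d₁ + d₂ : ℕ) : ℝ) / 2))

lemma fourierConst_pos (d₁ d₂ : ℕ) : 0 < fourierConst d₁ d₂ :=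
  Real.rpow_pos_of_pos (by positivity) _

/-- The inverse Fourier transform. -/
def fourierInv (g : Freq d₁ d₂ → ℂ) (x : Space d₁ d₂) : ℂ :=
  (fourierConst d₁ d₂ : ℂ) * ∫ ξ, g ξ * character ξ x ∂(freqMeasure d₁ d₂)

/-- Bounded nonnegative functions all of whose moments are finite. -/
structure RapidlyDecreasing (V : Freq d₁ d₂ → ℝ) : Prop where
  measurable : Measurable V
  nonneg : ∀ ξ, 0 ≤ V ξ
  bounded : ∃ B, ∀ ξ, V ξ ≤ B
  moments : ∀ k : ℕ, Integrable (fun ξ => bracket ξ ^ k * V ξ) (freqMeasure d₁ d₂)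

lemma RapidlyDecreasing.integrable {V : Freq d₁ d₂ → ℝ} (h : RapidlyDecreasing V) :
    Integrable V (freqMeasure d₁ d₂) := by
  simpa using h.moments 0

lemma RapidlyDecreasing.memLp {V : Freq d₁ d₂ → ℝ} (h : RapidlyDecreasing V) (k : ℕ) :
    MemLp (fun ξ => bracket ξ ^ k * V ξ) 2 (freqMeasure d₁ d₂) := by
  have hm : Measurable fun ξ : Freq d₁ d₂ => bracket ξ ^ k * V ξ :=
    (measurable_bracket.pow_const k).mul h.measurable
  rw [memLp_two_iff_integrable_sq hm.aestronglyMeasurable]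
  obtain ⟨B, hB⟩ := h.bounded
  refine ((h.moments (2 * k)).const_mul B).mono' (hm.pow_const 2).aestronglyMeasurable
    (Eventually.of_forall fun ξ => ?_)
  rw [Real.norm_of_nonneg (sq_nonneg _), mul_pow, ← pow_mul, mul_comm k 2, sq (V ξ)]
  have h1 : 0 ≤ bracket ξ ^ (2 * k) * V ξ :=
    mul_nonneg (pow_nonneg (bracket_pos ξ).le _) (h.nonneg ξ)
  calc bracket ξ ^ (2 * k) * (V ξ * V ξ) = V ξ * (bracket ξ ^ (2 * k) * V ξ) := by ring
    _ ≤ _ := mul_le_mul_of_nonneg_right (hB ξ) h1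

lemma RapidlyDecreasing.add {V W : Freq d₁ d₂ → ℝ} (hV : RapidlyDecreasing V)
    (hW : RapidlyDecreasing W) : RapidlyDecreasing (fun ξ => V ξ + W ξ) where
  measurable := hV.1.add hW.1
  nonneg ξ := add_nonneg (hV.2 ξ) (hW.2 ξ)
  bounded := by
    obtain ⟨B, hB⟩ := hV.3
    obtain ⟨C, hC⟩ := hW.3
    exact ⟨B + C, fun ξ => add_le_add (hB ξ) (hC ξ)⟩
  moments k := by
    simp only [mul_add]
    exact (hV.4 k).add (hW.4 k)

lemma RapidlyDecreasing.const_mul {V : Freq d₁ d₂ → ℝ} (hV : RapidlyDecreasing V) {c : ℝ}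
    (hc : 0 ≤ c) : RapidlyDecreasing (fun ξ => c * V ξ) where
  measurable := hV.1.const_mul c
  nonneg ξ := mul_nonneg hc (hV.2 ξ)
  bounded := by
    obtain ⟨B, hB⟩ := hV.3
    exact ⟨c * B, fun ξ => by gcongr; exact hB ξ⟩
  moments k := by
    simp only [mul_left_comm _ c]
    exact (hV.4 k).const_mul c

/-- Moments and boundedness of V give square integrability with every polynomial weight, which a
pointwise bound passes on to g. -/
lemma RapidlyDecreasing.isFourierTransform {V : Freq d₁ d₂ → ℝ} (hV : RapidlyDecreasing V)
    {g : Freq d₁ d₂ → ℂ} (hg : Measurable g) (hgV : ∀ ξ, ‖g ξ‖ ≤ V ξ) :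
    IsFourierTransform (fourierInv g) g where
  aestronglyMeasurable := hg.aestronglyMeasurable
  weightedNorm_lt_top k := by
    rw [weightedNorm_natCast]
    refine (eLpNorm_mono_real fun ξ => ?_).trans_lt (hV.memLp k).2
    rw [norm_smul, Real.norm_of_nonneg (pow_nonneg (bracket_pos ξ).le _)]
    exact mul_le_mul_of_nonneg_left (hgV ξ) (pow_nonneg (bracket_pos ξ).le _)
  inversion x := rfl

/-- The exponential weight. -/
def expWeight (a : ℝ) (ξ : Freq d₁ d₂) : ℝ≥0∞ := ENNReal.ofReal (Real.exp (a * ‖coord ξ‖))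

lemma measurable_expWeight (a : ℝ) : Measurable (expWeight a : Freq d₁ d₂ → ℝ≥0∞) :=
  (Real.measurable_exp.comp (measurable_coord.norm.const_mul a)).ennreal_ofReal

lemma expWeight_add_le {a : ℝ} (ha : 0 ≤ a) (ξ η : Freq d₁ d₂) :
    expWeight a (ξ + η) ≤ expWeight a ξ * expWeight a η := by
  unfold expWeight
  rw [← ENNReal.ofReal_mul (Real.exp_pos _).le, ← Real.exp_add, ← mul_add, coord_add]
  gcongr
  exact norm_add_le _ _

lemma one_le_expWeight {a : ℝ} (ha : 0 ≤ a) (ξ : Freq d₁ d₂) : 1 ≤ expWeight a ξ := by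
  rw [expWeight, ← ENNReal.ofReal_one]
  exact ENNReal.ofReal_le_ofReal (Real.one_le_exp (by positivity))

lemma exists_bracket_pow_le {a : ℝ} (ha : 0 < a) (k : ℕ) :
    ∃ C : ℝ, 0 ≤ C ∧ ∀ ξ : Freq d₁ d₂, bracket ξ ^ k ≤ C * Real.exp (a * ‖coord ξ‖) := by
  refine ⟨k.factorial / a ^ k * Real.exp a, by positivity, fun ξ => ?_⟩
  have h := Real.pow_div_factorial_le_exp (a * (1 + ‖coord ξ‖)) (by positivity) k
  rw [div_le_iff₀ (by positivity), mul_pow, mul_add, mul_one, Real.exp_add] at h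
  calc bracket ξ ^ k ≤ (1 + ‖coord ξ‖) ^ k :=
        pow_le_pow_left₀ (bracket_pos ξ).le (bracket_le ξ) k
    _ = a ^ k * (1 + ‖coord ξ‖) ^ k / a ^ k := by field_simp
    _ ≤ (Real.exp a * Real.exp (a * ‖coord ξ‖) * k.factorial) / a ^ k := by gcongr
    _ = _ := by ring

/-- A single exponential moment dominates all polynomial ones. This is why the Picard scheme carries
one exponential weight in place of a sequence of Sobolev norms. -/
lemma rapidlyDecreasing_toReal {a : ℝ} (ha : 0 < a) {V : Freq d₁ d₂ → ℝ≥0∞} (hV : Measurable V)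
    {B : ℝ≥0∞} (hBt : B ≠ ∞) (hB : ∀ ξ, V ξ ≤ B)
    (hw : ∫⁻ ξ, expWeight a ξ * V ξ ∂(freqMeasure d₁ d₂) ≠ ∞) :
    RapidlyDecreasing fun ξ => (V ξ).toReal where
  measurable := hV.ennreal_toReal
  nonneg _ := ENNReal.toReal_nonneg
  bounded := ⟨B.toReal, fun ξ => ENNReal.toReal_mono hBt (hB ξ)⟩
  moments k := by
    obtain ⟨C, hC0, hC⟩ := exists_bracket_pow_le (d₁ := d₁) (d₂ := d₂) ha k
    have h1 := integrable_toReal_of_lintegral_ne_top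
      ((measurable_expWeight a).mul hV).aemeasurable hw
    refine (h1.const_mul C).mono'
      ((measurable_bracket.pow_const k).mul hV.ennreal_toReal).aestronglyMeasurable
      (Eventually.of_forall fun ξ => ?_)
    rw [Real.norm_of_nonneg (mul_nonneg (pow_nonneg (bracket_pos ξ).le _) ENNReal.toReal_nonneg)]
    simp only [Pi.mul_apply, ENNReal.toReal_mul, expWeight,
      ENNReal.toReal_ofReal (Real.exp_pos _).le, ← mul_assoc]
    exact mul_le_mul_of_nonneg_right (hC ξ) ENNReal.toReal_nonneg

end Inversion

/-! ### Products of functions and convolutions of transforms -/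

section ConvolutionTheorem

variable {d₁ d₂ : ℕ}

lemma integrable_twist {g : Freq d₁ d₂ → ℂ} (hg : Integrable g (freqMeasure d₁ d₂)) (b : Bool) :
    Integrable (twist b g) (freqMeasure d₁ d₂) := by
  cases b with
  | true =>
    have e : twist true g = g := funext fun ξ => by simp [twist]
    rwa [e]
  | false =>
    have e : twist false g = fun ξ => starRingEnd ℂ (g (-ξ)) := funext fun ξ => by simp [twist]
    rw [e]
    exact hg.comp_neg.mono (Complex.continuous_conj.comp_aestronglyMeasurable hg.comp_neg.1)
      (Eventually.of_forall fun ξ => by simp)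

lemma integral_twist_mul_character (g : Freq d₁ d₂ → ℂ) (b : Bool) (x : Space d₁ d₂) :
    ∫ ξ, twist b g ξ * character ξ x ∂(freqMeasure d₁ d₂)
      = if b then ∫ ξ, g ξ * character ξ x ∂(freqMeasure d₁ d₂)
        else starRingEnd ℂ (∫ ξ, g ξ * character ξ x ∂(freqMeasure d₁ d₂)) := by
  cases b with
  | true => simp [twist]
  | false =>
    simp only [twist, Bool.false_eq_true, if_false]
    rw [← integral_neg_eq_self, ← integral_conj]
    refine integral_congr_ae (Eventually.of_forall fun ξ => ?_)
    simp [character_neg]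

lemma cpow_succ_eq_convolution (σ : ℕ → Bool) (g : Freq d₁ d₂ → ℂ) (k : ℕ) :
    cpow (freqMeasure d₁ d₂) σ g (k + 1) = convolution (cpow (freqMeasure d₁ d₂) σ g k)
      (twist (σ (k + 1)) g) (ContinuousLinearMap.mul ℂ ℂ) (freqMeasure d₁ d₂) := rfl

lemma integrable_cpow {g : Freq d₁ d₂ → ℂ} (hg : Integrable g (freqMeasure d₁ d₂))
    (σ : ℕ → Bool) (k : ℕ) : Integrable (cpow (freqMeasure d₁ d₂) σ g k) (freqMeasure d₁ d₂) := by
  induction k with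
  | zero => exact integrable_twist hg _
  | succ k ih =>
    rw [cpow_succ_eq_convolution]
    exact ih.integrable_convolution _ (integrable_twist hg _)

/-- Characters are multiplicative in the frequency, so integrating a convolution against one
factorises. -/
lemma integral_cpow_mul_character {g : Freq d₁ d₂ → ℂ} (hg : Integrable g (freqMeasure d₁ d₂))
    (σ : ℕ → Bool) (k : ℕ) (x : Space d₁ d₂) :
    ∫ ξ, cpow (freqMeasure d₁ d₂) σ g k ξ * character ξ x ∂(freqMeasure d₁ d₂)
      = ∏ j ∈ Finset.range (k + 1),
        ∫ ξ, twist (σ j) g ξ * character ξ x ∂(freqMeasure d₁ d₂) := by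
  induction k with
  | zero => simp [cpow]
  | succ k ih =>
    rw [Finset.prod_range_succ, ← ih]
    have h := integral_convolution (μ := freqMeasure d₁ d₂) (ν := freqMeasure d₁ d₂)
      (ContinuousLinearMap.mul ℂ ℂ)
      (integrable_mul_character (integrable_cpow hg σ k) x)
      (integrable_mul_character (integrable_twist hg (σ (k + 1))) x)
    rw [ContinuousLinearMap.mul_apply'] at h
    rw [← h]
    refine integral_congr_ae (Eventually.of_forall fun ξ => ?_)
    simp only [convolution, ContinuousLinearMap.mul_apply', cpow]
    rw [← integral_mul_const]
    refine integral_congr_ae (Eventually.of_forall fun η => ?_)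
    have := character_add η (ξ - η) x
    rw [add_sub_cancel] at this
    simp only [this]
    ring

/-- Each of the p factors carries one normalising constant. The first q factors are untwisted and
give u; the other p - q give its conjugate. -/
lemma fourierConst_mul_integral_cpow {g : Freq d₁ d₂ → ℂ}
    (hg : Integrable g (freqMeasure d₁ d₂)) {p q : ℕ} (hp : 1 ≤ p) (hq : q ≤ p)
    (x : Space d₁ d₂) :
    (fourierConst d₁ d₂ : ℂ) ^ p * ∫ ξ, cpow (freqMeasure d₁ d₂) (fun j => decide (j < q)) g (p - 1) ξ
        * character ξ x ∂(freqMeasure d₁ d₂)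
      = fourierInv g x ^ q * starRingEnd ℂ (fourierInv g x) ^ (p - q) := by
  rw [integral_cpow_mul_character hg, Nat.sub_add_cancel hp]
  obtain ⟨r, rfl⟩ := Nat.exists_eq_add_of_le hq
  rw [Finset.prod_range_add, add_tsub_cancel_left]
  have h1 : ∀ j ∈ Finset.range q, ∫ ξ, twist (decide (j < q)) g ξ * character ξ x
      ∂(freqMeasure d₁ d₂) = ∫ ξ, g ξ * character ξ x ∂(freqMeasure d₁ d₂) := fun j hj => by
    rw [integral_twist_mul_character]; simp [Finset.mem_range.1 hj]
  have h2 : ∀ j ∈ Finset.range r, ∫ ξ, twist (decide (q + j < q)) g ξ * character ξ x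
      ∂(freqMeasure d₁ d₂) = starRingEnd ℂ (∫ ξ, g ξ * character ξ x ∂(freqMeasure d₁ d₂)) :=
    fun j hj => by rw [integral_twist_mul_character]; simp
  rw [Finset.prod_congr rfl h1, Finset.prod_congr rfl h2, Finset.prod_const, Finset.prod_const,
    Finset.card_range, Finset.card_range, fourierInv, map_mul, Complex.conj_ofReal]
  ring

end ConvolutionTheorem

/-! ### Differentiation under the integral: time derivative and Laplacian -/

section Derivatives

variable {d₁ d₂ : ℕ}

/-- The form relative to a convex set covers one-sided derivatives at the endpoints of [0, T]. The
mean value inequality bounds the slopes, and dominated convergence applies to them. -/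
lemma hasDerivWithinAt_integral_of_dominated {α : Type*} [MeasurableSpace α] {μ : Measure α}
    {f f' : ℝ → α → ℂ} {s : Set ℝ} (hs : Convex ℝ s) (hf : ∀ t ∈ s, Integrable (f t) μ)
    {bound : α → ℝ} (hb : Integrable bound μ)
    (hd : ∀ t ∈ s, ∀ a, HasDerivWithinAt (fun τ => f τ a) (f' t a) s t)
    (hf' : ∀ t ∈ s, ∀ a, ‖f' t a‖ ≤ bound a) {t : ℝ} (ht : t ∈ s) :
    HasDerivWithinAt (fun τ => ∫ a, f τ a ∂μ) (∫ a, f' t a ∂μ) s t := by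
  rw [hasDerivWithinAt_iff_tendsto_slope]
  have hmem : ∀ᶠ τ in 𝓝[s \ {t}] t, τ ∈ s :=
    eventually_mem_nhdsWithin.mono fun τ hτ => hτ.1
  have e : (fun τ => ∫ a, slope (fun τ => f τ a) t τ ∂μ) =ᶠ[𝓝[s \ {t}] t]
      slope (fun τ => ∫ a, f τ a ∂μ) t := by
    filter_upwards [hmem] with τ hτ
    simp only [slope_def_module]
    rw [integral_smul, integral_sub (hf τ hτ) (hf t ht)]
  refine Tendsto.congr' e ?_
  refine tendsto_integral_filter_of_dominated_convergence bound ?_ ?_ hb ?_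
  · filter_upwards [hmem] with τ hτ
    simp only [slope_def_module]
    exact (((hf τ hτ).sub (hf t ht)).smul _).1
  · filter_upwards [hmem] with τ hτ
    refine Eventually.of_forall fun a => ?_
    have h := hs.norm_image_sub_le_of_norm_hasDerivWithin_le (f := fun τ => f τ a)
      (fun x hx => hd x hx a) (fun x hx => hf' x hx a) ht hτ
    rw [slope_def_module, norm_smul, norm_inv]
    rcases eq_or_ne τ t with rfl | hne
    · simpa using (norm_nonneg _).trans (hf' τ ht a)
    · have : 0 < ‖τ - t‖ := norm_pos_iff.2 (sub_ne_zero.2 hne)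
      rw [inv_mul_le_iff₀ this, mul_comm]
      exact h
  · exact Eventually.of_forall fun a => (hasDerivWithinAt_iff_tendsto_slope.1 (hd t ht a))

variable {E : Type*} [NormedAddCommGroup E] [NormedSpace ℂ E]

/-- The derivative of a plane wave with vector amplitude, without its oscillating factor. -/
def waveDeriv (a : Cover d₁ d₂) (z : E) : Cover d₁ d₂ →L[ℝ] E :=
  (innerSL ℝ a).smulRight (Complex.I • z)

lemma waveDeriv_apply (a : Cover d₁ d₂) (z : E) (v : Cover d₁ d₂) :
    waveDeriv a z v = (inner ℝ a v : ℝ) • Complex.I • z := by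
  simp [waveDeriv]

lemma norm_waveDeriv (a : Cover d₁ d₂) (z : E) : ‖waveDeriv a z‖ = ‖a‖ * ‖z‖ := by
  simp [waveDeriv, norm_smul]

lemma continuous_waveDeriv :
    Continuous (Function.uncurry (waveDeriv : Cover d₁ d₂ → E → Cover d₁ d₂ →L[ℝ] E)) := by
  have h := (ContinuousLinearMap.smulRightL ℝ (Cover d₁ d₂) E).continuous₂
  exact h.comp (((innerSL ℝ).continuous.comp continuous_fst).prodMk
    (continuous_snd.const_smul Complex.I))

lemma aestronglyMeasurable_waveDeriv {g : Freq d₁ d₂ → E}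
    (hg : AEStronglyMeasurable g (freqMeasure d₁ d₂)) :
    AEStronglyMeasurable (fun ξ => waveDeriv (coord ξ) (g ξ)) (freqMeasure d₁ d₂) := by
  have h1 : AEStronglyMeasurable (coord : Freq d₁ d₂ → Cover d₁ d₂) (freqMeasure d₁ d₂) :=
    measurable_coord.aestronglyMeasurable
  exact continuous_waveDeriv.comp_aestronglyMeasurable₂ h1 hg

lemma hasFDerivAt_wave (ξ : Freq d₁ d₂) (z : E) (y : Cover d₁ d₂) :
    HasFDerivAt (fun y => character ξ (proj y) • z)
      (character ξ (proj y) • waveDeriv (coord ξ) z) y := by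
  have h1 : HasFDerivAt (fun y : Cover d₁ d₂ => (inner ℝ (coord ξ) y : ℝ))
      (innerSL ℝ (coord ξ)) y := (innerSL ℝ (coord ξ)).hasFDerivAt
  have h2 := ((Complex.ofRealCLM.hasFDerivAt.comp y h1).mul_const Complex.I).cexp.smul_const z
  have e : (fun y : Cover d₁ d₂ => character ξ (proj y) • z) =
      fun y => Complex.exp ((Complex.ofRealCLM ∘ fun y => inner ℝ (coord ξ) y) y * Complex.I) • z :=
    funext fun y => by rw [character_proj]; rfl
  rw [e]
  refine h2.congr_fderiv ?_
  ext v
  rw [character_proj]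
  simp only [ContinuousLinearMap.smulRight_apply, smul_apply, waveDeriv_apply,
    ContinuousLinearMap.comp_apply, innerSL_apply_apply, Complex.ofRealCLM_apply, smul_eq_mul,
    Function.comp_apply]
  rw [← Complex.coe_smul (inner ℝ (coord ξ) v), smul_smul, smul_smul]
  congr 1
  ring

/-- The derivative of a superposition of plane waves is again one, with amplitudes in a space of
linear maps. Vector-valued amplitudes allow the lemma to be applied to its own output. -/
lemma hasFDerivAt_integral_wave {g : Freq d₁ d₂ → E}
    (hg : Integrable g (freqMeasure d₁ d₂))
    (hg' : Integrable (fun ξ => ‖coord ξ‖ * ‖g ξ‖) (freqMeasure d₁ d₂)) (y : Cover d₁ d₂) :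
    HasFDerivAt (fun y => ∫ ξ, character ξ (proj y) • g ξ ∂(freqMeasure d₁ d₂))
      (∫ ξ, character ξ (proj y) • waveDeriv (coord ξ) (g ξ) ∂(freqMeasure d₁ d₂)) y := by
  have hm : ∀ {F : Type _} [NormedAddCommGroup F] [NormedSpace ℂ F] {h : Freq d₁ d₂ → F},
      AEStronglyMeasurable h (freqMeasure d₁ d₂) → ∀ y : Cover d₁ d₂,
      AEStronglyMeasurable (fun ξ => character ξ (proj y) • h ξ) (freqMeasure d₁ d₂) :=
    fun hh y => (measurable_character _).aestronglyMeasurable.smul hh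
  refine hasFDerivAt_integral_of_dominated_of_fderiv_le (s := Set.univ) univ_mem
    (Eventually.of_forall fun y => hm hg.1 y) ?_ (hm ?_ y)
    (F' := fun y ξ => character ξ (proj y) • waveDeriv (coord ξ) (g ξ))
    (bound := fun ξ => ‖coord ξ‖ * ‖g ξ‖) ?_ hg' ?_
  · refine hg.mono (hm hg.1 y) (Eventually.of_forall fun ξ => ?_)
    rw [norm_smul, norm_character, one_mul]
  · exact aestronglyMeasurable_waveDeriv hg.1
  · refine Eventually.of_forall fun ξ y _ => ?_
    rw [norm_smul, norm_character, one_mul, norm_waveDeriv]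
  · exact Eventually.of_forall fun ξ y _ => hasFDerivAt_wave ξ (g ξ) y

lemma laplacian_integral_wave {g : Freq d₁ d₂ → ℂ} (hg : Integrable g (freqMeasure d₁ d₂))
    (hg1 : Integrable (fun ξ => ‖coord ξ‖ * ‖g ξ‖) (freqMeasure d₁ d₂))
    (hg2 : Integrable (fun ξ => ‖coord ξ‖ ^ 2 * ‖g ξ‖) (freqMeasure d₁ d₂)) (y : Cover d₁ d₂) :
    Δ (fun y : Cover d₁ d₂ => ∫ ξ, character ξ (proj y) • g ξ ∂(freqMeasure d₁ d₂)) y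
      = -∫ ξ, ((‖coord ξ‖ ^ 2 : ℝ) : ℂ) * (character ξ (proj y) * g ξ) ∂(freqMeasure d₁ d₂) := by
  have hw1 : Integrable (fun ξ => waveDeriv (coord ξ) (g ξ)) (freqMeasure d₁ d₂) :=
    hg1.mono' (aestronglyMeasurable_waveDeriv hg.1) (Eventually.of_forall fun ξ => (norm_waveDeriv _ _).le)
  have e1 : fderiv ℝ (fun y : Cover d₁ d₂ =>
      ∫ ξ, character ξ (proj y) • g ξ ∂(freqMeasure d₁ d₂)) =
      fun y => ∫ ξ, character ξ (proj y) • waveDeriv (coord ξ) (g ξ) ∂(freqMeasure d₁ d₂) :=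
    funext fun y => (hasFDerivAt_integral_wave hg hg1 y).fderiv
  -- Each derivative costs one factor |ξ|, so the second application needs the second moment.
  have hn2 : ∀ ξ : Freq d₁ d₂, ‖coord ξ‖ * ‖waveDeriv (coord ξ) (g ξ)‖ = ‖coord ξ‖ ^ 2 * ‖g ξ‖ :=
    fun ξ => by rw [norm_waveDeriv]; ring
  have e2 := (hasFDerivAt_integral_wave hw1 (by simpa only [hn2] using hg2) y).fderiv
  have hw2 : Integrable (fun ξ => character ξ (proj y) •
      waveDeriv (coord ξ) (waveDeriv (coord ξ) (g ξ))) (freqMeasure d₁ d₂) :=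
    hg2.mono' ((measurable_character _).aestronglyMeasurable.smul 
      (aestronglyMeasurable_waveDeriv (aestronglyMeasurable_waveDeriv hg.1)))
      (Eventually.of_forall fun ξ => by
        rw [norm_smul, norm_character, one_mul, norm_waveDeriv, hn2])
  rw [InnerProductSpace.laplacian_eq_iteratedFDeriv_orthonormalBasis _
    (EuclideanSpace.basisFun (Fin d₁ ⊕ Fin d₂) ℝ)]
  simp only [iteratedFDeriv_two_apply, e1, e2, Matrix.cons_val_zero, Matrix.cons_val_one]
  have e3 : ∀ i, (∫ ξ, character ξ (proj y) •
      waveDeriv (coord ξ) (waveDeriv (coord ξ) (g ξ)) ∂(freqMeasure d₁ d₂))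
        (EuclideanSpace.basisFun (Fin d₁ ⊕ Fin d₂) ℝ i)
        (EuclideanSpace.basisFun (Fin d₁ ⊕ Fin d₂) ℝ i)
      = ∫ ξ, -(((coord ξ i) ^ 2 : ℝ) : ℂ) * (character ξ (proj y) * g ξ) ∂(freqMeasure d₁ d₂) := by
    intro i
    rw [ContinuousLinearMap.integral_apply hw2, ContinuousLinearMap.integral_apply
      (hw2.apply_continuousLinearMap _)]
    refine integral_congr_ae (Eventually.of_forall fun ξ => ?_)
    have hin : (inner ℝ (coord ξ) (EuclideanSpace.basisFun (Fin d₁ ⊕ Fin d₂) ℝ i) : ℝ)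
        = coord ξ i := by simp [EuclideanSpace.inner_single_right]
    simp only [smul_apply, waveDeriv_apply, hin, Complex.real_smul,
      smul_eq_mul]
    have := Complex.I_mul_I
    push_cast
    linear_combination (((coord ξ i : ℝ) : ℂ) ^ 2 * character ξ (proj y) * g ξ) * this
  simp only [e3]
  rw [← integral_finsetSum, ← integral_neg]
  · refine integral_congr_ae (Eventually.of_forall fun ξ => ?_)
    simp only
    rw [← Finset.sum_mul, EuclideanSpace.real_norm_sq_eq, Finset.sum_neg_distrib, neg_mul]
    push_cast
    rfl
  · intro i _
    refine hg2.mono' ?_ (Eventually.of_forall fun ξ => ?_)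
    · refine AEStronglyMeasurable.mul ?_
        ((measurable_character _).aestronglyMeasurable.mul hg.1)
      have : Measurable fun ξ : Freq d₁ d₂ => coord ξ i :=
        (EuclideanSpace.proj (𝕜 := ℝ) i).continuous.measurable.comp measurable_coord
      exact (Complex.measurable_ofReal.comp (this.pow_const 2)).neg.aestronglyMeasurable
    · rw [norm_mul, norm_mul, norm_character, one_mul, norm_neg, Complex.norm_real, norm_pow]
      gcongr
      exact PiLp.norm_apply_le (coord ξ) i

end Derivatives
end NLS
end

/-! ### From the profile to a smooth solution -/

noncomputable section

namespace NLS

section Solution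

variable {d₁ d₂ : ℕ}

/-- The symbol `|ξ|²` of `-Δ`. -/
def symbol (ξ : Freq d₁ d₂) : ℝ := ‖coord ξ‖ ^ 2

lemma symbol_nonneg (ξ : Freq d₁ d₂) : 0 ≤ symbol ξ := sq_nonneg _

lemma symbol_le_bracket_sq (ξ : Freq d₁ d₂) : symbol ξ ≤ bracket ξ ^ 2 := by
  rw [bracket_sq, symbol]; linarith

lemma measurable_symbol : Measurable (symbol : Freq d₁ d₂ → ℝ) :=
  measurable_coord.norm.pow_const 2

lemma hasDerivAt_phase {G : Type*} (ω : G → ℝ) (t : ℝ) (ξ : G) :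
    HasDerivAt (fun t => phase ω t ξ) (-(Complex.I * ω ξ) * phase ω t ξ) t := by
  have h1 : HasDerivAt (fun t : ℝ => -(t * ω ξ)) (-(ω ξ)) t := by
    have h := ((hasDerivAt_id t).mul_const (ω ξ)).neg
    rw [one_mul] at h
    exact h
  have h2 := (h1.ofReal_comp.mul_const Complex.I).cexp
  refine h2.congr_deriv ?_
  simp only [phase]
  push_cast
  ring

/-- The Fourier transform of the solution with profile `v`. -/
def evolve (v : ℝ → Freq d₁ d₂ → ℂ) (t : ℝ) (ξ : Freq d₁ d₂) : ℂ := phase symbol t ξ * v t ξ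

variable {a : ℝ} (ha : 0 < a) {V : Freq d₁ d₂ → ℝ≥0∞} (hV : Measurable V)
  (hs : ∀ ξ, V (-ξ) = V ξ) {B : ℝ≥0∞} (hBt : B ≠ ∞) (hB : ∀ ξ, V ξ ≤ B)
  (hw : ∫⁻ ξ, expWeight a ξ * V ξ ∂(freqMeasure d₁ d₂) ≠ ∞)

include ha hw in
lemma lintegral_ne_top_of_expWeight : ∫⁻ ξ, V ξ ∂(freqMeasure d₁ d₂) ≠ ∞ :=
  ne_top_of_le_ne_top hw (lintegral_mono fun ξ => by
    simpa using mul_le_mul' (one_le_expWeight ha.le ξ) (le_refl (V ξ)))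

include ha hV hBt hB hw in
lemma rapidlyDecreasing_lpow (k : ℕ) :
    RapidlyDecreasing fun ξ => (lpow (freqMeasure d₁ d₂) V k ξ).toReal := by
  refine rapidlyDecreasing_toReal ha (measurable_lpow _ hV k)
    (B := (∫⁻ ξ, V ξ ∂(freqMeasure d₁ d₂)) ^ k * B) ?_ (lpow_le _ hV hB k) ?_
  · exact ENNReal.mul_ne_top (ENNReal.pow_ne_top (lintegral_ne_top_of_expWeight ha hw)) hBt
  · exact ne_top_of_le_ne_top (ENNReal.pow_ne_top hw) (lintegral_weight_mul_lpow_le _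
      (measurable_expWeight a) hV (expWeight_add_le ha.le) k)

variable {σ : ℕ → Bool} {k : ℕ} {c : ℂ} {T : ℝ} {g₀ : Freq d₁ d₂ → ℂ} {v : ℝ → Freq d₁ d₂ → ℂ}
  (hvm : Measurable (Function.uncurry v)) (hvV : ∀ t ξ, ‖v t ξ‖ₑ ≤ V ξ)
  (hvc : ∀ ξ, Continuous fun t => v t ξ)
  (hfix : ∀ t ξ, v t ξ = picardMap (freqMeasure d₁ d₂) σ k symbol c T g₀ v t ξ)

include hvm in
lemma measurable_evolve (t : ℝ) : Measurable (evolve v t) :=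
  (measurable_phase_mul measurable_symbol hvm).comp (measurable_prodMk_left (x := t))

include hvV in
lemma enorm_evolve_le (t : ℝ) (ξ : Freq d₁ d₂) : ‖evolve v t ξ‖ₑ ≤ V ξ := by
  rw [evolve, enorm_mul, enorm_phase, one_mul]
  exact hvV t ξ

include hvV hBt hB in
lemma norm_evolve_le (t : ℝ) (ξ : Freq d₁ d₂) : ‖evolve v t ξ‖ ≤ (V ξ).toReal := by
  rw [← toReal_enorm]
  exact ENNReal.toReal_mono ((hB ξ).trans_lt hBt.lt_top).ne (enorm_evolve_le hvV t ξ)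

/-- The right-hand side of the equation for the Fourier transform of the solution. -/
def evolveDeriv (σ : ℕ → Bool) (k : ℕ) (c : ℂ) (v : ℝ → Freq d₁ d₂ → ℂ) (t : ℝ)
    (ξ : Freq d₁ d₂) : ℂ :=
  -(Complex.I * symbol ξ) * evolve v t ξ + c * cpow (freqMeasure d₁ d₂) σ (evolve v t) k ξ

include ha hV hs hBt hB hw hvV in
-- A time-independent bound losing two powers of the bracket, from the symbol |ξ|². It is the
-- dominating function for time derivatives and for Sobolev continuity.
lemma norm_evolveDeriv_le (t : ℝ) (ξ : Freq d₁ d₂) :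
    ‖evolveDeriv σ k c v t ξ‖ ≤ bracket ξ ^ 2 *
      ((V ξ).toReal + ‖c‖ * (lpow (freqMeasure d₁ d₂) V k ξ).toReal) := by
  have h1 := norm_evolve_le hBt hB hvV t ξ
  have h2 : ‖cpow (freqMeasure d₁ d₂) σ (evolve v t) k ξ‖ ≤
      (lpow (freqMeasure d₁ d₂) V k ξ).toReal := by
    rw [← toReal_enorm]
    exact ENNReal.toReal_mono
      (lpow_lt_top _ hV hBt hB (lintegral_ne_top_of_expWeight ha hw) k ξ).ne
      (enorm_cpow_le _ hs (enorm_evolve_le hvV t) σ k ξ)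
  have h3 : 1 ≤ bracket ξ ^ 2 := one_le_pow₀ (one_le_bracket ξ)
  calc _ ≤ symbol ξ * (V ξ).toReal + ‖c‖ * (lpow (freqMeasure d₁ d₂) V k ξ).toReal := by
        refine (norm_add_le _ _).trans ?_
        rw [norm_mul, norm_mul, norm_neg, norm_mul, Complex.norm_I, one_mul, Complex.norm_real,
          Real.norm_of_nonneg (symbol_nonneg ξ)]
        gcongr
        exact symbol_nonneg ξ
    _ ≤ bracket ξ ^ 2 * (V ξ).toReal
        + bracket ξ ^ 2 * (‖c‖ * (lpow (freqMeasure d₁ d₂) V k ξ).toReal) := by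
        refine add_le_add ?_ (le_mul_of_one_le_left (by positivity) h3)
        gcongr
        exact symbol_le_bracket_sq ξ
    _ = _ := by ring

include ha hV hs hBt hB hw hvm hvV hvc hfix in
lemma hasDerivWithinAt_evolve {t : ℝ} (ht : t ∈ Set.Icc 0 T) (ξ : Freq d₁ d₂) :
    HasDerivWithinAt (fun τ => evolve v τ ξ) (evolveDeriv σ k c v t ξ) (Set.Icc 0 T) t := by
  have hI := lintegral_ne_top_of_expWeight ha hw
  have hcont : Continuous fun s =>
      profileNonlinearity (freqMeasure d₁ d₂) σ k symbol v s ξ := by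
    unfold profileNonlinearity
    refine ((continuous_phase symbol ξ).comp continuous_neg).mul ?_
    exact continuousOn_cpow _ hV hBt hB hI hs (measurable_evolve hvm) (enorm_evolve_le hvV)
      (fun η => (continuous_phase symbol η).mul (hvc η)) σ k ξ
  have h1 : HasDerivAt (fun τ => g₀ ξ + c * ∫ s in 0..τ,
      profileNonlinearity (freqMeasure d₁ d₂) σ k symbol v s ξ)
      (c * profileNonlinearity (freqMeasure d₁ d₂) σ k symbol v t ξ) t :=
    ((intervalIntegral.integral_hasDerivAt_right (hcont.intervalIntegrable 0 t)
      (hcont.stronglyMeasurableAtFilter _ _) hcont.continuousAt).const_mul c).const_add _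
  -- On [0, T] the clamp is the identity, so the profile is there an honest primitive of a
  -- continuous function.
  have h2 : HasDerivWithinAt (fun τ => v τ ξ)
      (c * profileNonlinearity (freqMeasure d₁ d₂) σ k symbol v t ξ) (Set.Icc 0 T) t := by
    refine h1.hasDerivWithinAt.congr (fun τ hτ => ?_) ?_
    · rw [hfix τ ξ, picardMap, clamp_of_mem hτ]
    · rw [hfix t ξ, picardMap, clamp_of_mem ht]
  refine ((hasDerivAt_phase symbol t ξ).hasDerivWithinAt.mul h2).congr_deriv ?_
  rw [evolveDeriv, profileNonlinearity]
  have h3 := phase_mul_neg symbol t ξ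
  have h4 : (fun η => phase symbol t η * v t η) = evolve v t := rfl
  rw [h4, evolve]
  linear_combination (c * cpow (freqMeasure d₁ d₂) σ (evolve v t) k ξ) * h3

include ha hV hBt hB hw hvm hvV in
lemma isFourierTransform_evolve (t : ℝ) :
    IsFourierTransform (fourierInv (evolve v t)) (evolve v t) :=
  (rapidlyDecreasing_toReal ha hV hBt hB hw).isFourierTransform (measurable_evolve hvm t)
    (norm_evolve_le hBt hB hvV t)

include ha hV hs hBt hB hw hvm hvV hvc hfix in
-- The solution is Lipschitz in time with values in H^n, the constant being an H^(n+2)-type norm of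
-- the majorant.
lemma tendsto_sobolevNorm_evolve (n : ℕ) {t₀ : ℝ} (ht₀ : t₀ ∈ Set.Icc 0 T) :
    Tendsto (fun t => sobolevNorm (n : ℝ) (fourierInv (evolve v t) - fourierInv (evolve v t₀)))
      (𝓝[Set.Icc 0 T] t₀) (𝓝 0) := by
  have hY := (rapidlyDecreasing_toReal ha hV hBt hB hw).add
    ((rapidlyDecreasing_lpow ha hV hBt hB hw k).const_mul (norm_nonneg c))
  set Y : Freq d₁ d₂ → ℝ := fun ξ =>
    (V ξ).toReal + ‖c‖ * (lpow (freqMeasure d₁ d₂) V k ξ).toReal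
  set K := eLpNorm (fun ξ => bracket ξ ^ (n + 2) * Y ξ) 2 (freqMeasure d₁ d₂)
  have hK : K ≠ ∞ := (hY.memLp (n + 2)).2.ne
  have hbound : ∀ t ∈ Set.Icc 0 T,
      sobolevNorm (n : ℝ) (fourierInv (evolve v t) - fourierInv (evolve v t₀))
        ≤ ENNReal.ofReal |t - t₀| * K := by
    intro t ht
    rw [((isFourierTransform_evolve ha hV hBt hB hw hvm hvV t).sub
      (isFourierTransform_evolve ha hV hBt hB hw hvm hvV t₀)).sobolevNorm_eq,
      weightedNorm_natCast]
    refine eLpNorm_le_mul_eLpNorm_of_ae_le_mul (Eventually.of_forall fun ξ => ?_) 2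
    have h := (convex_Icc 0 T).norm_image_sub_le_of_norm_hasDerivWithin_le
      (f := fun τ => evolve v τ ξ)
      (fun x hx => hasDerivWithinAt_evolve ha hV hs hBt hB hw hvm hvV hvc hfix hx ξ)
      (fun x _ => norm_evolveDeriv_le ha hV hs hBt hB hw hvV x ξ) ht₀ ht
    have hb := pow_nonneg (bracket_pos ξ).le n
    rw [norm_smul, Real.norm_of_nonneg hb, Real.norm_of_nonneg (mul_nonneg
      (pow_nonneg (bracket_pos ξ).le _) (hY.nonneg ξ))]
    calc bracket ξ ^ n * ‖evolve v t ξ - evolve v t₀ ξ‖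
        ≤ bracket ξ ^ n * (bracket ξ ^ 2 * Y ξ * ‖t - t₀‖) := mul_le_mul_of_nonneg_left h hb
      _ = _ := by rw [Real.norm_eq_abs, pow_add]; ring
  have hlim : Tendsto (fun t => ENNReal.ofReal |t - t₀| * K) (𝓝[Set.Icc 0 T] t₀) (𝓝 0) := by
    have h1 : Tendsto (fun t => |t - t₀|) (𝓝[Set.Icc 0 T] t₀) (𝓝 0) := by
      have : Continuous fun t : ℝ => |t - t₀| := by fun_prop
      simpa using (this.tendsto t₀).mono_left nhdsWithin_le_nhds
    have h2 := ENNReal.Tendsto.mul_const (ENNReal.tendsto_ofReal h1) (Or.inr hK)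
    simpa using h2
  refine tendsto_of_tendsto_of_tendsto_of_le_of_le' tendsto_const_nhds hlim
    (Eventually.of_forall fun _ => zero_le) ?_
  filter_upwards [self_mem_nhdsWithin] with t ht using hbound t ht

include ha hV hs hBt hB hw hvm hvV hvc hfix in
lemma hasDerivWithinAt_fourierInv_evolve {t : ℝ} (ht : t ∈ Set.Icc 0 T) (x : Space d₁ d₂) :
    HasDerivWithinAt (fun τ => fourierInv (evolve v τ) x)
      (fourierInv (evolveDeriv σ k c v t) x) (Set.Icc 0 T) t := by
  have hY := (rapidlyDecreasing_toReal ha hV hBt hB hw).add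
    ((rapidlyDecreasing_lpow ha hV hBt hB hw k).const_mul (norm_nonneg c))
  refine HasDerivWithinAt.const_mul _ ?_
  refine hasDerivWithinAt_integral_of_dominated (convex_Icc 0 T)
    (f := fun τ ξ => evolve v τ ξ * character ξ x)
    (f' := fun τ ξ => evolveDeriv σ k c v τ ξ * character ξ x)
    (fun τ _ => integrable_mul_character
      (isFourierTransform_evolve ha hV hBt hB hw hvm hvV τ).integrable x)
    (hY.moments 2) (fun τ hτ ξ => ?_) (fun τ _ ξ => ?_) ht
  · exact (hasDerivWithinAt_evolve ha hV hs hBt hB hw hvm hvV hvc hfix hτ ξ).mul_const _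
  · rw [norm_mul, norm_character, mul_one]
    exact norm_evolveDeriv_le ha hV hs hBt hB hw hvV τ ξ

include ha hV hs hBt hB hw hvm hvV hvc hfix in
-- In `c`, the factor -iν comes from solving the equation for the time derivative. The power p - 1
-- of the Fourier constant is what remains of its p-th power after one factor is used by the
-- inversion formula.
theorem isSmoothSolution_evolve (hT : 0 < T) {p q : ℕ} (hp : 1 ≤ p) (hq : q ≤ p)
    (hσ : σ = fun j => decide (j < q)) (hk : k = p - 1) {ν : ℂ}
    (hc : c = -(Complex.I * (ν * (fourierConst d₁ d₂ : ℂ) ^ (p - 1)))) :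
    IsSmoothSolution p q ν (fourierInv g₀) T (fun t => fourierInv (evolve v t)) where
  mem_HInfty t _ := ⟨_, isFourierTransform_evolve ha hV hBt hB hw hvm hvV t⟩
  continuous n t₀ ht₀ :=
    tendsto_sobolevNorm_evolve ha hV hs hBt hB hw hvm hvV hvc hfix n ht₀
  differentiable t ht x :=
    (hasDerivWithinAt_fourierInv_evolve ha hV hs hBt hB hw hvm hvV hvc hfix ht
      x).differentiableWithinAt
  equation t ht y := by
    have hR := rapidlyDecreasing_toReal ha hV hBt hB hw
    have hg := (isFourierTransform_evolve ha hV hBt hB hw hvm hvV t).integrable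
    have hle := norm_evolve_le hBt hB hvV t
    have hg1 : Integrable (fun ξ => ‖coord ξ‖ * ‖evolve v t ξ‖) (freqMeasure d₁ d₂) := by
      refine (hR.moments 1).mono' (measurable_coord.norm.aestronglyMeasurable.mul
        (measurable_evolve hvm t).norm.aestronglyMeasurable) (Eventually.of_forall fun ξ => ?_)
      rw [Real.norm_of_nonneg (by positivity), pow_one]
      exact mul_le_mul (norm_coord_le_bracket ξ) (hle ξ) (norm_nonneg _) (bracket_pos ξ).le
    have hg2 : Integrable (fun ξ => ‖coord ξ‖ ^ 2 * ‖evolve v t ξ‖) (freqMeasure d₁ d₂) := by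
      refine (hR.moments 2).mono' ((measurable_coord.norm.pow_const 2).aestronglyMeasurable.mul
        (measurable_evolve hvm t).norm.aestronglyMeasurable) (Eventually.of_forall fun ξ => ?_)
      rw [Real.norm_of_nonneg (by positivity)]
      exact mul_le_mul (symbol_le_bracket_sq ξ) (hle ξ) (norm_nonneg _) (by positivity)
    have hL : Δ (fun y' : Cover d₁ d₂ => fourierInv (evolve v t) (proj y')) y
        = -((fourierConst d₁ d₂ : ℂ) * ∫ ξ, (symbol ξ : ℂ) * (evolve v t ξ * character ξ (proj y))
          ∂(freqMeasure d₁ d₂)) := by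
      have e1 : (fun y' : Cover d₁ d₂ => fourierInv (evolve v t) (proj y')) =
          fun y' => ∫ ξ, character ξ (proj y') • ((fourierConst d₁ d₂ : ℂ) * evolve v t ξ)
            ∂(freqMeasure d₁ d₂) := by
        funext y'
        rw [fourierInv, ← integral_const_mul]
        refine integral_congr_ae (Eventually.of_forall fun ξ => ?_)
        simp only [smul_eq_mul]
        ring
      rw [e1, laplacian_integral_wave (hg.const_mul _), ← integral_const_mul]
      · congr 1
        refine integral_congr_ae (Eventually.of_forall fun ξ => ?_)
        simp only [symbol]
        ring
      · refine (hg1.const_mul ‖(fourierConst d₁ d₂ : ℂ)‖).congr (Eventually.of_forall fun ξ => ?_)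
        simp only [norm_mul]
        ring
      · refine (hg2.const_mul ‖(fourierConst d₁ d₂ : ℂ)‖).congr (Eventually.of_forall fun ξ => ?_)
        simp only [norm_mul]
        ring
    have hi1 : Integrable (fun ξ => (symbol ξ : ℂ) * (evolve v t ξ * character ξ (proj y)))
        (freqMeasure d₁ d₂) := by
      refine hg2.mono' ((Complex.measurable_ofReal.comp measurable_symbol).aestronglyMeasurable.mul
        (integrable_mul_character hg _).1) (Eventually.of_forall fun ξ => ?_)
      rw [norm_mul, norm_mul, norm_character, mul_one, Complex.norm_real,
        Real.norm_of_nonneg (symbol_nonneg ξ), symbol]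
    have hi2 := integrable_mul_character (integrable_cpow hg σ k) (proj y)
    have hD : fourierInv (evolveDeriv σ k c v t) (proj y) = (fourierConst d₁ d₂ : ℂ) *
        (-Complex.I * (∫ ξ, (symbol ξ : ℂ) * (evolve v t ξ * character ξ (proj y))
          ∂(freqMeasure d₁ d₂)) + c * ∫ ξ, cpow (freqMeasure d₁ d₂) σ (evolve v t) k ξ *
            character ξ (proj y) ∂(freqMeasure d₁ d₂)) := by
      rw [fourierInv, ← integral_const_mul (-Complex.I), ← integral_const_mul c,
        ← integral_add (hi1.const_mul _) (hi2.const_mul _)]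
      congr 1
      refine integral_congr_ae (Eventually.of_forall fun ξ => ?_)
      simp only [evolveDeriv]
      ring
    have hN := fourierConst_mul_integral_cpow hg hp hq (proj y)
    rw [(hasDerivWithinAt_fourierInv_evolve ha hV hs hBt hB hw hvm hvV hvc hfix ht
      (proj y)).derivWithin (uniqueDiffOn_Icc hT t ht), hL, hD, mul_assoc ν, ← hN, hc, ← hσ, ← hk]
    have hpow : (fourierConst d₁ d₂ : ℂ) ^ p = fourierConst d₁ d₂ ^ k * fourierConst d₁ d₂ := by
      rw [hk, ← pow_succ, Nat.sub_add_cancel hp]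
    rw [hpow]
    have hII := Complex.I_mul_I
    linear_combination (-(fourierConst d₁ d₂ : ℂ) * (∫ ξ, (symbol ξ : ℂ) * (evolve v t ξ *
      character ξ (proj y)) ∂(freqMeasure d₁ d₂)) - (fourierConst d₁ d₂ : ℂ) * ν *
      fourierConst d₁ d₂ ^ k * ∫ ξ, cpow (freqMeasure d₁ d₂) σ (evolve v t) k ξ *
            character ξ (proj y) ∂(freqMeasure d₁ d₂)) * hII
  initial := by
    congr 1
    funext ξ
    rw [evolve, hfix 0 ξ, picardMap, clamp_of_mem ⟨le_rfl, hT.le⟩]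
    simp [phase]

end Solution
end NLS
end

/-! ### Homogeneity and gauge invariance of the convolution power -/

noncomputable section

set_option linter.unusedSectionVars false

namespace NLS

section Scaling

variable {G : Type*} [AddCommGroup G] [MeasurableSpace G] (μ : Measure G)

lemma twist_const_mul (z : ℂ) (g : G → ℂ) (b : Bool) (ξ : G) :
    twist b (fun η => z * g η) ξ = (if b then z else starRingEnd ℂ z) * twist b g ξ := by
  cases b <;> simp [twist]

lemma cpow_const_mul (σ : ℕ → Bool) (z : ℂ) (g : G → ℂ) (k : ℕ) (ξ : G) :
    cpow μ σ (fun η => z * g η) k ξ =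
      (∏ j ∈ Finset.range (k + 1), if σ j then z else starRingEnd ℂ z) * cpow μ σ g k ξ := by
  induction k generalizing ξ with
  | zero => simp [cpow, twist_const_mul]
  | succ k ih =>
    simp only [cpow]
    rw [Finset.prod_range_succ, ← integral_const_mul]
    refine integral_congr_ae (Eventually.of_forall fun η => ?_)
    simp only [ih, twist_const_mul]
    ring

lemma cpow_ofReal_mul (σ : ℕ → Bool) (h : ℝ) (g : G → ℂ) (k : ℕ) (ξ : G) :
    cpow μ σ (fun η => (h : ℂ) * g η) k ξ = (h : ℂ) ^ (k + 1) * cpow μ σ g k ξ := by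
  rw [cpow_const_mul]
  simp

/-- When p = 2q there are as many factors z as conjugate factors, and they cancel. This is what
frees the balanced nonlinearities from the restriction T ≪ N^(-2). -/
lemma cpow_unimodular_mul {z : ℂ} (hz : ‖z‖ = 1) {p q : ℕ} (hp : p = 2 * q) (hq : 1 ≤ q)
    (g : G → ℂ) (ξ : G) :
    cpow μ (fun j => decide (j < q)) (fun η => z * g η) (p - 1) ξ =
      cpow μ (fun j => decide (j < q)) g (p - 1) ξ := by
  have hp1 : p - 1 + 1 = q + q := by omega
  rw [cpow_const_mul, hp1, Finset.prod_range_add]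
  have h1 : ∀ j ∈ Finset.range q, (if decide (j < q) = true then z else starRingEnd ℂ z) = z :=
    fun j hj => by simp [Finset.mem_range.1 hj]
  rw [Finset.prod_congr rfl h1]
  simp only [Nat.not_lt.2 (Nat.le_add_right q _), decide_false, Bool.false_eq_true, if_false,
    Finset.prod_const, Finset.card_range]
  rw [← mul_pow, Complex.mul_conj, Complex.normSq_eq_norm_sq, hz]
  simp

end Scaling

/-! ### The first Picard iterate dominates -/

section LowerBound

variable {d₁ d₂ : ℕ}

lemma norm_cpow_sub_le_of_lintegral_le {V : Freq d₁ d₂ → ℝ≥0∞} (hV : Measurable V)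
    (hs : ∀ ξ, V (-ξ) = V ξ) {B : ℝ≥0∞} (hBt : B ≠ ∞) (hB : ∀ ξ, V ξ ≤ B) {I : ℝ} (hI0 : 0 ≤ I)
    (hI : ∫⁻ ξ, V ξ ∂(freqMeasure d₁ d₂) ≤ ENNReal.ofReal I) {g h : Freq d₁ d₂ → ℂ}
    (hgm : Measurable g) (hhm : Measurable h) (hg : ∀ ξ, ‖g ξ‖ₑ ≤ V ξ) (hh : ∀ ξ, ‖h ξ‖ₑ ≤ V ξ)
    {D : ℝ} (hD0 : 0 ≤ D) (hD : ∀ ξ, ‖g ξ - h ξ‖ ≤ D) (σ : ℕ → Bool) (k : ℕ) (ξ : Freq d₁ d₂) :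
    ‖cpow (freqMeasure d₁ d₂) σ g k ξ - cpow (freqMeasure d₁ d₂) σ h k ξ‖
      ≤ (k + 1) * I ^ k * D := by
  have h1 := enorm_cpow_sub_le (freqMeasure d₁ d₂) hV hs hBt hB (ne_top_of_le_ne_top ENNReal.ofReal_ne_top hI)
    hgm hhm hg hh (D := ENNReal.ofReal D)
    (fun ξ => by rw [← ofReal_norm]; exact ENNReal.ofReal_le_ofReal (hD ξ)) σ k ξ
  have h2 : (k + 1) * (∫⁻ ξ, V ξ ∂(freqMeasure d₁ d₂)) ^ k * ENNReal.ofReal D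
      ≤ ENNReal.ofReal ((k + 1) * I ^ k * D) := by
    rw [ENNReal.ofReal_mul (by positivity), ENNReal.ofReal_mul (by positivity),
      ENNReal.ofReal_pow hI0, ENNReal.ofReal_add (by positivity) zero_le_one,
      ENNReal.ofReal_natCast, ENNReal.ofReal_one]
    gcongr
  have h3 := h1.trans h2
  rw [← ofReal_norm] at h3
  exact (ENNReal.ofReal_le_ofReal_iff (by positivity)).1 h3

/-- The indicator function of a set of frequencies. -/
def ind (Ω : Set (Freq d₁ d₂)) : Freq d₁ d₂ → ℂ := Ω.indicator fun _ => 1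

lemma ind_of_mem {Ω : Set (Freq d₁ d₂)} {ξ : Freq d₁ d₂} (h : ξ ∈ Ω) : ind Ω ξ = 1 :=
  Set.indicator_of_mem h _

lemma ind_of_notMem {Ω : Set (Freq d₁ d₂)} {ξ : Freq d₁ d₂} (h : ξ ∉ Ω) : ind Ω ξ = 0 :=
  Set.indicator_of_notMem h _

lemma measurable_ind {Ω : Set (Freq d₁ d₂)} (hΩ : MeasurableSet Ω) : Measurable (ind Ω) :=
  measurable_const.indicator hΩ

lemma weightedNorm_const_mul (s : ℝ) (z : ℂ) (g : Freq d₁ d₂ → ℂ) :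
    weightedNorm s (fun ξ => z * g ξ) = ‖z‖ₑ * weightedNorm s g := by
  rw [weightedNorm, weightedNorm, ← eLpNorm_const_smul]
  congr 1
  funext ξ
  simp only [Pi.smul_apply, smul_eq_mul, Complex.real_smul]
  ring

lemma weightedNorm_mono (s : ℝ) {g h : Freq d₁ d₂ → ℂ} (hgh : ∀ ξ, ‖g ξ‖ ≤ ‖h ξ‖) :
    weightedNorm s g ≤ weightedNorm s h := by
  refine eLpNorm_mono fun ξ => ?_
  rw [norm_smul, norm_smul]
  gcongr
  exact hgh ξ

/-- Profiles issued from the data `h 𝟙_Ω`, with a majorant. -/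
lemma exists_profile_of_indicator (σ : ℕ → Bool) (k : ℕ) (c : ℂ) {Ω : Set (Freq d₁ d₂)}
    (hΩm : MeasurableSet Ω) {R : ℝ} (hR : ∀ ξ ∈ Ω, ‖coord ξ‖ ≤ R)
    (hΩ : freqMeasure d₁ d₂ Ω ≠ ∞) {h T : ℝ} (hh : 0 < h) (hT : 0 < T)
    (hsmall : ‖c‖ * T * ((k + 1) * (12 * (h * (freqMeasure d₁ d₂ Ω).toReal)) ^ k) ≤ 1 / 2) :
    ∃ (a : ℝ) (V : Freq d₁ d₂ → ℝ≥0∞) (v : ℝ → Freq d₁ d₂ → ℂ), 0 < a ∧ Measurable V ∧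
      (∀ ξ, V (-ξ) = V ξ) ∧ (∀ ξ, V ξ ≤ ENNReal.ofReal (2 * h)) ∧
      ∫⁻ ξ, expWeight a ξ * V ξ ∂(freqMeasure d₁ d₂) ≤
        ENNReal.ofReal (12 * (h * (freqMeasure d₁ d₂ Ω).toReal)) ∧
      (∀ ξ, ‖(h : ℂ) * ind Ω ξ‖ₑ ≤ V ξ) ∧
      Measurable (Function.uncurry v) ∧ (∀ t ξ, ‖v t ξ‖ₑ ≤ V ξ) ∧
      (∀ ξ, Continuous fun t => v t ξ) ∧
      ∀ t ξ, v t ξ = picardMap (freqMeasure d₁ d₂) σ k symbol c T (fun ξ => (h : ℂ) * ind Ω ξ)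
        v t ξ := by
  set μ := freqMeasure d₁ d₂
  set m := (μ Ω).toReal with hm
  have hm0 : 0 ≤ m := ENNReal.toReal_nonneg
  have hμΩ : μ Ω = ENNReal.ofReal m := (ENNReal.ofReal_toReal hΩ).symm
  -- With this rate the weight is at most e < 3 on the support of the data.
  set a : ℝ := 1 / (|R| + 1)
  have ha : 0 < a := by positivity
  -- The majorant must be even; symmetrising at most doubles the measure. Together with the factor 3
  -- this gives 6 h m, and the majorant iteration doubles it to 12 h m.
  set S : Set (Freq d₁ d₂) := Ω ∪ -Ω
  have hSm : MeasurableSet S := hΩm.union hΩm.neg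
  set M : Freq d₁ d₂ → ℝ≥0∞ := S.indicator fun _ => ENNReal.ofReal h
  have hMm : Measurable M := measurable_const.indicator hSm
  have hMs : ∀ ξ, M (-ξ) = M ξ := by
    intro ξ
    have : -ξ ∈ S ↔ ξ ∈ S := by simp [S, or_comm]
    by_cases hξ : ξ ∈ S
    · simp [M, hξ, this.2 hξ]
    · simp [M, hξ, mt this.1 hξ]
  have hMB : ∀ ξ, M ξ ≤ ENNReal.ofReal h := fun ξ => Set.indicator_le_self' (by simp) ξ
  have hRS : ∀ ξ ∈ S, ‖coord ξ‖ ≤ |R| := by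
    rintro ξ (hξ | hξ)
    · exact (hR ξ hξ).trans (le_abs_self R)
    · have := hR (-ξ) hξ
      rw [coord_neg, norm_neg] at this
      exact this.trans (le_abs_self R)
  have hwM : ∫⁻ ξ, expWeight a ξ * M ξ ∂μ ≤ ENNReal.ofReal (6 * (h * m)) := by
    calc ∫⁻ ξ, expWeight a ξ * M ξ ∂μ ≤ ∫⁻ ξ, S.indicator (fun _ => ENNReal.ofReal (3 * h)) ξ ∂μ := by
          refine lintegral_mono fun ξ => ?_
          by_cases hξ : ξ ∈ S
          · simp only [M, hξ, Set.indicator_of_mem]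
            rw [expWeight, ← ENNReal.ofReal_mul (Real.exp_pos _).le]
            refine ENNReal.ofReal_le_ofReal ?_
            gcongr
            refine le_trans (Real.exp_le_exp.2 ?_) Real.exp_one_lt_three.le
            have := hRS ξ hξ
            simp only [a]
            rw [one_div, inv_mul_le_iff₀ (by positivity)]
            linarith
          · simp [M, hξ]
      _ = ENNReal.ofReal (3 * h) * μ S := by rw [lintegral_indicator hSm, setLIntegral_const]
      _ ≤ ENNReal.ofReal (3 * h) * (ENNReal.ofReal m + ENNReal.ofReal m) := by
          gcongr
          refine (measure_union_le _ _).trans ?_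
          rw [Measure.measure_neg, hμΩ]
      _ = _ := by
          rw [← ENNReal.ofReal_add hm0 hm0, ← ENNReal.ofReal_mul (by positivity)]
          congr 1
          ring
  have h12 : 2 * ∫⁻ ξ, expWeight a ξ * M ξ ∂μ ≤ ENNReal.ofReal (12 * (h * m)) := by
    calc _ ≤ ENNReal.ofReal 2 * ENNReal.ofReal (6 * (h * m)) := by
          rw [ENNReal.ofReal_ofNat]
          gcongr
      _ = _ := by
          rw [← ENNReal.ofReal_mul (by norm_num)]
          congr 1
          ring
  have hsm' : ‖c‖ₑ * ENNReal.ofReal T * ((k + 1) * ENNReal.ofReal (12 * (h * m)) ^ k) ≤ 2⁻¹ := by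
    have h1 := ENNReal.ofReal_le_ofReal hsmall
    rw [ENNReal.ofReal_mul (by positivity), ENNReal.ofReal_mul (by positivity), ofReal_norm,
      ENNReal.ofReal_mul (by positivity), ENNReal.ofReal_pow (by positivity),
      ENNReal.ofReal_add (by positivity) zero_le_one, ENNReal.ofReal_natCast,
      ENNReal.ofReal_one, one_div, ENNReal.ofReal_inv_of_pos (by norm_num),
      ENNReal.ofReal_ofNat] at h1
    exact h1
  obtain ⟨V, hV, hVs, hVB, hwV, hmaj⟩ := exists_majorant μ (measurable_expWeight a) hMm
    (expWeight_add_le ha.le) (one_le_expWeight ha.le) hMs hMB k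
    (a := ‖c‖ₑ * ENNReal.ofReal T) (by
      refine le_trans ?_ hsm'
      gcongr
      calc (2 * ∫⁻ ξ, expWeight a ξ * M ξ ∂μ) ^ k ≤ ENNReal.ofReal (12 * (h * m)) ^ k := by gcongr
        _ ≤ _ := le_mul_of_one_le_left zero_le (by simp))
  have hVB' : ∀ ξ, V ξ ≤ ENNReal.ofReal (2 * h) := fun ξ => (hVB ξ).trans (by
    rw [ENNReal.ofReal_mul (by norm_num), ENNReal.ofReal_ofNat])
  have hwV' := hwV.trans h12
  have hVI : ∫⁻ ξ, V ξ ∂μ ≤ ENNReal.ofReal (12 * (h * m)) := (lintegral_mono fun ξ => by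
    simpa using mul_le_mul' (one_le_expWeight ha.le ξ) (le_refl (V ξ))).trans hwV'
  have hgM : ∀ ξ, ‖(h : ℂ) * ind Ω ξ‖ₑ ≤ M ξ := by
    intro ξ
    by_cases hξ : ξ ∈ Ω
    · have : ξ ∈ S := Or.inl hξ
      simp only [M, this, Set.indicator_of_mem, ind_of_mem hξ, mul_one]
      rw [← ofReal_norm, Complex.norm_real, Real.norm_of_nonneg hh.le]
    · simp [ind_of_notMem hξ]
  have hmaj' : ∀ ξ, ‖(h : ℂ) * ind Ω ξ‖ₑ + ‖c‖ₑ * ENNReal.ofReal T * lpow μ V k ξ ≤ V ξ := fun ξ =>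
    le_trans (by gcongr; exact hgM ξ) (hmaj ξ)
  obtain ⟨v, h1, h2, h3, h4⟩ := exists_profile μ σ k measurable_symbol hV hVs ENNReal.ofReal_ne_top hVB'
    (ne_top_of_le_ne_top ENNReal.ofReal_ne_top hVI) c hT.le ((measurable_ind hΩm).const_mul (h : ℂ)) hmaj'
    (le_trans (by gcongr) hsm')
  exact ⟨a, V, v, ha, hV, hVs, hVB', hwV', fun ξ => le_self_add.trans (hmaj' ξ), h1, h2, h3, h4⟩

/-- The function ω is a model for the symbol on Ω: it is close enough for e^{-itω} to replace the
true phase up to time T, and its phases do not change the interaction on P. The nonlinear term on P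
is then nearly constant in time and its Duhamel integral grows linearly. The thresholds ε and c₀ are
chosen before Ω, so they are uniform along a sequence of frequency sets. -/
theorem exists_solution_lower_bound {p q : ℕ} (hp : 2 ≤ p) (hq : q ≤ p) {ν : ℂ} (hν : ν ≠ 0)
    {κ : ℝ} (hκ : 0 < κ) :
    ∃ ε > 0, ∃ c₀ > 0, ∀ (Ω P : Set (Freq d₁ d₂)) (ω : Freq d₁ d₂ → ℝ) (h T R : ℝ),
      MeasurableSet Ω → Measurable ω → (∀ ξ ∈ Ω, ‖coord ξ‖ ≤ R) →
      freqMeasure d₁ d₂ Ω ≠ ∞ → Disjoint P Ω → 0 < h → 0 < T →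
      T * (h * (freqMeasure d₁ d₂ Ω).toReal) ^ (p - 1) ≤ ε →
      (∀ ξ ∈ Ω, T * |symbol ξ - ω ξ| ≤ ε) → (∀ ξ ∈ P, T * symbol ξ ≤ ε) →
      (∀ t ∈ Set.Icc 0 T, ∀ ξ ∈ P,
        cpow (freqMeasure d₁ d₂) (fun j => decide (j < q)) (fun η => phase ω t η * ind Ω η)
          (p - 1) ξ = cpow (freqMeasure d₁ d₂) (fun j => decide (j < q)) (ind Ω) (p - 1) ξ) →
      (∀ ξ ∈ P, κ * (freqMeasure d₁ d₂ Ω).toReal ^ (p - 1) ≤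
        ‖cpow (freqMeasure d₁ d₂) (fun j => decide (j < q)) (ind Ω) (p - 1) ξ‖) →
      ∃ (φ : Space d₁ d₂ → ℂ) (u : ℝ → Space d₁ d₂ → ℂ), MemHInfty φ ∧
        IsSmoothSolution p q ν φ T u ∧ ∀ s,
          sobolevNorm s φ = ENNReal.ofReal h * weightedNorm s (ind Ω) ∧
          ENNReal.ofReal (c₀ * (T * h * (h * (freqMeasure d₁ d₂ Ω).toReal) ^ (p - 1))) *
            weightedNorm s (ind P) ≤ sobolevNorm s (u T) := by
  set k := p - 1 with hk
  have hkp : k + 1 = p := by omega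
  set c : ℂ := -(Complex.I * (ν * (fourierConst d₁ d₂ : ℂ) ^ k)) with hc
  set C := ‖c‖ with hC
  have hc0 : c ≠ 0 := by
    have : (fourierConst d₁ d₂ : ℂ) ≠ 0 := Complex.ofReal_ne_zero.2 (fourierConst_pos d₁ d₂).ne'
    simp [hc, hν, this]
  have hCpos : 0 < C := norm_pos_iff.2 hc0
  set σ : ℕ → Bool := fun j => decide (j < q) with hσ
  -- K collects the errors in the nonlinearity on P. The first term is the Lipschitz constant of the
  -- convolution power times the deviation from the model evolution; the second comes from the outer
  -- phase e^{it|ξ|²} on P.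
  set K : ℝ := (k + 1) * 12 ^ k * (2 * C * 12 ^ k + 1) + 2 * 12 ^ k with hK
  have hKpos : 0 < K := by positivity
  -- The first bound makes the Picard map a contraction; the second keeps the total error below half
  -- of the main term.
  set ε : ℝ := min (1 / (2 * C * (k + 1) * 12 ^ k)) (κ / (2 * K)) with hε
  have hεpos : 0 < ε := lt_min (by positivity) (by positivity)
  refine ⟨ε, hεpos, C * κ / 2, by positivity, ?_⟩
  intro Ω P ω h T R hΩm hωm hR hΩ hPΩ hh hT hsmall hωΩ hP hphase hlow
  set μ := freqMeasure d₁ d₂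
  set m := (μ Ω).toReal with hm
  have hm0 : 0 ≤ m := ENNReal.toReal_nonneg
  set M := h * m with hM
  have hM0 : 0 ≤ M := by positivity
  have hε1 : C * ε * ((k + 1) * 12 ^ k) ≤ 1 / 2 := by
    calc C * ε * ((k + 1) * 12 ^ k) ≤ C * (1 / (2 * C * (k + 1) * 12 ^ k)) * ((k + 1) * 12 ^ k) := by
          gcongr; exact min_le_left _ _
      _ = 1 / 2 := by field_simp
  have hε2 : ε * K ≤ κ / 2 := by
    calc ε * K ≤ κ / (2 * K) * K := by gcongr; exact min_le_right _ _
      _ = κ / 2 := by field_simp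
  have hsm : C * T * ((k + 1) * (12 * M) ^ k) ≤ 1 / 2 := by
    calc C * T * ((k + 1) * (12 * M) ^ k) = C * (T * M ^ k) * ((k + 1) * 12 ^ k) := by
          rw [mul_pow]; ring
      _ ≤ C * ε * ((k + 1) * 12 ^ k) := by gcongr
      _ ≤ 1 / 2 := hε1
  obtain ⟨a, V, v, ha, hV, hVs, hVB, hwV, hgV, hvm, hvV, hvc, hfix⟩ :=
    exists_profile_of_indicator σ k c hΩm hR hΩ hh hT hsm
  have hBt : ENNReal.ofReal (2 * h) ≠ ∞ := ENNReal.ofReal_ne_top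
  have hwV' := ne_top_of_le_ne_top ENNReal.ofReal_ne_top hwV
  have hVI : ∫⁻ ξ, V ξ ∂μ ≤ ENNReal.ofReal (12 * M) := (lintegral_mono fun ξ => by
    simpa using mul_le_mul' (one_le_expWeight ha.le ξ) (le_refl (V ξ))).trans hwV
  set g₀ : Freq d₁ d₂ → ℂ := fun ξ => (h : ℂ) * ind Ω ξ with hg₀
  have hg₀m : Measurable g₀ := (measurable_ind hΩm).const_mul _
  have hgF : IsFourierTransform (fourierInv g₀) g₀ :=
    (rapidlyDecreasing_toReal ha hV hBt hVB hwV').isFourierTransform hg₀m fun ξ => by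
      rw [← toReal_enorm]
      exact ENNReal.toReal_mono ((hVB ξ).trans_lt hBt.lt_top).ne (hgV ξ)
  refine ⟨fourierInv g₀, fun t => fourierInv (evolve v t), ⟨g₀, hgF⟩,
    isSmoothSolution_evolve ha hV hVs hBt hVB hwV' hvm hvV hvc hfix hT (by omega) hq hσ hk
      hc, fun s => ⟨?_, ?_⟩⟩
  · rw [hgF.sobolevNorm_eq, weightedNorm_const_mul, ← ofReal_norm, Complex.norm_real,
      Real.norm_of_nonneg hh.le]
  have hlp : ∀ ξ, lpow μ V k ξ ≤ ENNReal.ofReal ((12 * M) ^ k * (2 * h)) := fun ξ => by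
    refine (lpow_le μ hV hVB k ξ).trans ?_
    rw [ENNReal.ofReal_mul (by positivity : 0 ≤ (12 * M) ^ k), ENNReal.ofReal_pow (by positivity)]
    gcongr
  have hvg : ∀ t ξ, ‖v t ξ - g₀ ξ‖ ≤ C * T * ((12 * M) ^ k * (2 * h)) := by
    intro t ξ
    have h1 := enorm_picardMap_sub_le μ σ k (ω := symbol) hVs c hT.le (g₀ := g₀) hvV t ξ
    rw [← hfix t ξ] at h1
    have h2 : ‖c‖ₑ * ENNReal.ofReal T * lpow μ V k ξ ≤
        ENNReal.ofReal (C * T * ((12 * M) ^ k * (2 * h))) := by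
      rw [ENNReal.ofReal_mul (by positivity), ENNReal.ofReal_mul (by positivity), hC, ofReal_norm]
      gcongr
      exact hlp ξ
    have h3 := h1.trans h2
    rw [← ofReal_norm] at h3
    exact (ENNReal.ofReal_le_ofReal_iff (by positivity)).1 h3
  set N₀ : Freq d₁ d₂ → ℂ := cpow μ σ g₀ k with hN₀
  have hψ : ∀ t ∈ Set.Icc 0 T, ∀ ξ ∈ P, cpow μ σ (fun η => phase ω t η * g₀ η) k ξ = N₀ ξ := by
    intro t ht ξ hξ
    have e : (fun η => phase ω t η * g₀ η) = fun η => (h : ℂ) * (phase ω t η * ind Ω η) := by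
      funext η; simp only [hg₀]; ring
    rw [e, cpow_ofReal_mul, hphase t ht ξ hξ, hN₀, hg₀, cpow_ofReal_mul]
  have hN₀low : ∀ ξ ∈ P, κ * (h * M ^ k) ≤ ‖N₀ ξ‖ := by
    intro ξ hξ
    rw [hN₀, hg₀, cpow_ofReal_mul, norm_mul, norm_pow, Complex.norm_real,
      Real.norm_of_nonneg hh.le]
    calc κ * (h * M ^ k) = h ^ (k + 1) * (κ * m ^ k) := by rw [hM, mul_pow]; ring
      _ ≤ _ := by gcongr; exact hlow ξ hξ
  have hN₀up : ∀ ξ, ‖N₀ ξ‖ ≤ (12 * M) ^ k * (2 * h) := by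
    intro ξ
    have h3 := (enorm_cpow_le μ hVs hgV σ k ξ).trans (hlp ξ)
    rw [← ofReal_norm] at h3
    exact (ENNReal.ofReal_le_ofReal_iff (by positivity)).1 h3
  -- Two sources of error: the motion of the profile, controlled by T M^k ≤ ε, and the replacement
  -- of |ξ|² by ω on Ω.
  have hdiff : ∀ t ∈ Set.Icc 0 T, ∀ η, ‖evolve v t η - phase ω t η * g₀ η‖ ≤
      h * (ε * (2 * C * 12 ^ k + 1)) := by
    intro t ht η
    have e : evolve v t η - phase ω t η * g₀ η = phase symbol t η * (v t η - g₀ η)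
        + (phase symbol t η - phase ω t η) * g₀ η := by rw [evolve]; ring
    have h1 : ‖(phase symbol t η - phase ω t η) * g₀ η‖ ≤ ε * h := by
      by_cases hη : η ∈ Ω
      · rw [norm_mul]
        have h2 : ‖g₀ η‖ = h := by simp [hg₀, ind_of_mem hη, abs_of_pos hh]
        rw [h2]
        gcongr
        refine (norm_phase_sub_le _ _ _ _).trans (le_trans ?_ (hωΩ η hη))
        gcongr
        rw [abs_of_nonneg ht.1]
        exact ht.2
      · simp [hg₀, ind_of_notMem hη]
        positivity
    calc _ ≤ ‖v t η - g₀ η‖ + ε * h := by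
          rw [e]
          refine (norm_add_le _ _).trans ?_
          rw [norm_mul, norm_phase, one_mul]
          gcongr
      _ ≤ C * T * ((12 * M) ^ k * (2 * h)) + ε * h := by gcongr; exact hvg t η
      _ = (T * M ^ k) * (2 * C * 12 ^ k * h) + ε * h := by rw [mul_pow]; ring
      _ ≤ ε * (2 * C * 12 ^ k * h) + ε * h := by gcongr
      _ = _ := by ring
  have hgV' : ∀ t ξ, ‖phase ω t ξ * g₀ ξ‖ₑ ≤ V ξ := fun t ξ => by
    rw [enorm_mul, enorm_phase, one_mul]; exact hgV ξ
  have hF : ∀ t ∈ Set.Icc 0 T, ∀ ξ ∈ P,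
      ‖profileNonlinearity μ σ k symbol v t ξ - N₀ ξ‖ ≤ κ / 2 * (h * M ^ k) := by
    intro t ht ξ hξ
    have e : profileNonlinearity μ σ k symbol v t ξ - N₀ ξ =
        phase symbol (-t) ξ * (cpow μ σ (evolve v t) k ξ
          - cpow μ σ (fun η => phase ω t η * g₀ η) k ξ)
        + (phase symbol (-t) ξ - phase (fun _ => 0) (-t) ξ) * N₀ ξ := by
      rw [hψ t ht ξ hξ, profileNonlinearity]
      have : phase (fun _ : Freq d₁ d₂ => (0 : ℝ)) (-t) ξ = 1 := by simp [phase]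
      rw [this]
      change phase symbol (-t) ξ * cpow μ σ (evolve v t) k ξ - _ = _
      ring
    have h1 := norm_cpow_sub_le_of_lintegral_le hV hVs hBt hVB (by positivity : 0 ≤ 12 * M) hVI
      (measurable_evolve hvm t) ((measurable_phase_right hωm t).mul hg₀m) (enorm_evolve_le hvV t)
      (hgV' t) (by positivity) (hdiff t ht) σ k ξ
    have h2 : ‖phase symbol (-t) ξ - phase (fun _ => 0) (-t) ξ‖ ≤ ε := by
      refine (norm_phase_sub_le _ _ _ _).trans (le_trans ?_ (hP ξ hξ))
      rw [abs_neg, abs_of_nonneg ht.1, sub_zero, abs_of_nonneg (symbol_nonneg ξ)]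
      have := symbol_nonneg ξ
      gcongr
      exact ht.2
    calc _ ≤ (k + 1) * (12 * M) ^ k * (h * (ε * (2 * C * 12 ^ k + 1)))
          + ε * ((12 * M) ^ k * (2 * h)) := by
          rw [e]
          refine (norm_add_le _ _).trans ?_
          rw [norm_mul, norm_mul, norm_phase, one_mul]
          gcongr
          · exact h1
          · exact hN₀up ξ
      _ = (ε * K) * (h * M ^ k) := by rw [hK, mul_pow]; ring
      _ ≤ κ / 2 * (h * M ^ k) := by gcongr
  -- Off Ω the data vanish, so only the Duhamel term is left. It equals T N₀ up to an error of at
  -- most half the lower bound for T ‖N₀‖.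
  have hlower : ∀ ξ ∈ P, C * κ / 2 * (T * h * M ^ k) ≤ ‖evolve v T ξ‖ := by
    intro ξ hξ
    have hξΩ : ξ ∉ Ω := fun h' => Set.disjoint_left.1 hPΩ hξ h'
    have hI := intervalIntegrable_profileNonlinearity μ σ k measurable_symbol hV hVs hBt hVB
      (ne_top_of_le_ne_top ENNReal.ofReal_ne_top hVI) hvm hvV ξ 0 T
    have e1 : ‖evolve v T ξ‖ = C * ‖∫ s in 0..T, profileNonlinearity μ σ k symbol v s ξ‖ := by
      rw [evolve, norm_mul, norm_phase, one_mul, hfix T ξ, picardMap,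
        clamp_of_mem ⟨hT.le, le_rfl⟩, hC, ← norm_mul]
      have : g₀ ξ = 0 := by simp [hg₀, ind_of_notMem hξΩ]
      rw [this, zero_add]
    have e2 : (∫ s in 0..T, profileNonlinearity μ σ k symbol v s ξ) =
        (∫ s in 0..T, (profileNonlinearity μ σ k symbol v s ξ - N₀ ξ)) + (T : ℂ) * N₀ ξ := by
      rw [intervalIntegral.integral_sub hI intervalIntegrable_const]
      simp
    have h1 : ‖∫ s in 0..T, (profileNonlinearity μ σ k symbol v s ξ - N₀ ξ)‖ ≤
        κ / 2 * (h * M ^ k) * T := by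
      have := intervalIntegral.norm_integral_le_of_norm_le_const (a := 0) (b := T)
        (f := fun s => profileNonlinearity μ σ k symbol v s ξ - N₀ ξ)
        (C := κ / 2 * (h * M ^ k)) fun s hs => by
          rw [Set.uIoc_of_le hT.le] at hs
          exact hF s ⟨hs.1.le, hs.2⟩ ξ hξ
      rwa [sub_zero, abs_of_pos hT] at this
    have h2 : T * (κ * (h * M ^ k)) ≤ ‖(T : ℂ) * N₀ ξ‖ := by
      rw [norm_mul, Complex.norm_real, Real.norm_of_nonneg hT.le]
      gcongr
      exact hN₀low ξ hξ
    have h3 : T * (κ * (h * M ^ k)) - κ / 2 * (h * M ^ k) * T ≤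
        ‖∫ s in 0..T, profileNonlinearity μ σ k symbol v s ξ‖ := by
      rw [e2]
      have := norm_sub_le_norm_add ((T : ℂ) * N₀ ξ)
        (∫ s in 0..T, (profileNonlinearity μ σ k symbol v s ξ - N₀ ξ))
      rw [add_comm] at this
      linarith
    rw [e1]
    calc C * κ / 2 * (T * h * M ^ k)
        = C * (T * (κ * (h * M ^ k)) - κ / 2 * (h * M ^ k) * T) := by ring
      _ ≤ _ := by gcongr
  rw [(isFourierTransform_evolve ha hV hBt hVB hwV' hvm hvV T).sobolevNorm_eq]
  set L := C * κ / 2 * (T * h * M ^ k)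
  have hL0 : 0 ≤ L := by positivity
  have e : ENNReal.ofReal L * weightedNorm s (ind P) =
      weightedNorm s (fun ξ => (L : ℂ) * ind P ξ) := by
    rw [weightedNorm_const_mul, ← ofReal_norm, Complex.norm_real, Real.norm_of_nonneg hL0]
  rw [e]
  refine weightedNorm_mono s fun ξ => ?_
  by_cases hξ : ξ ∈ P
  · rw [ind_of_mem hξ, mul_one, Complex.norm_real, Real.norm_of_nonneg hL0]
    exact hlower ξ hξ
  · rw [ind_of_notMem hξ]
    simp

end LowerBound
end NLS
end

/-! ### Criteria for norm inflation -/

noncomputable section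

namespace NLS

section Inflation

variable {d₁ d₂ : ℕ}

/-- Frequency supports and parameters for which the first Picard iterate of the solution with data
`h 𝟙_Ω` dominates on the set `P`. -/
def InflationData (d₁ d₂ p q : ℕ) (s c₁ c₂ h T v e D E : ℝ) : Prop :=
  ∃ (Ω P : Set (Freq d₁ d₂)) (ω : Freq d₁ d₂ → ℝ) (R : ℝ),
    MeasurableSet Ω ∧ Measurable ω ∧ (∀ ξ ∈ Ω, ‖coord ξ‖ ≤ R) ∧ freqMeasure d₁ d₂ Ω ≠ ∞ ∧
    c₁ * v ≤ (freqMeasure d₁ d₂ Ω).toReal ∧ (freqMeasure d₁ d₂ Ω).toReal ≤ c₂ * v ∧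
    Disjoint P Ω ∧ 0 < h ∧ 0 < T ∧ 0 < v ∧
    (∀ ξ ∈ Ω, T * |symbol ξ - ω ξ| ≤ e) ∧ (∀ ξ ∈ P, T * symbol ξ ≤ e) ∧
    (∀ t ∈ Set.Icc 0 T, ∀ ξ ∈ P,
      cpow (freqMeasure d₁ d₂) (fun j => decide (j < q)) (fun η => phase ω t η * ind Ω η)
        (p - 1) ξ = cpow (freqMeasure d₁ d₂) (fun j => decide (j < q)) (ind Ω) (p - 1) ξ) ∧
    (∀ ξ ∈ P, (c₁ * v) ^ (p - 1) ≤
      ‖cpow (freqMeasure d₁ d₂) (fun j => decide (j < q)) (ind Ω) (p - 1) ξ‖) ∧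
    weightedNorm s (ind Ω) ≤ ENNReal.ofReal D ∧ ENNReal.ofReal E ≤ weightedNorm s (ind P)

/-- The measure of Ω is known only between c₁ v and c₂ v, so the nondegeneracy constant κ becomes
(c₁/c₂)^(p-1). The limits say, in order: short time, negligible phase errors, convergence of the
iteration, small data, large output. -/
theorem normInflation_of_inflationData {p q : ℕ} (hp : 2 ≤ p) (hq : q ≤ p) {ν : ℂ} (hν : ν ≠ 0)
    {s c₁ c₂ : ℝ} (hc₁ : 0 < c₁) (hc₂ : 0 < c₂) {h T v e D E : ℕ → ℝ}
    (hdata : ∀ᶠ n in atTop, InflationData d₁ d₂ p q s c₁ c₂ (h n) (T n) (v n) (e n) (D n) (E n))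
    (hT : Tendsto T atTop (𝓝 0)) (he : Tendsto e atTop (𝓝 0))
    (hTv : Tendsto (fun n => T n * (h n * v n) ^ (p - 1)) atTop (𝓝 0))
    (hD : Tendsto (fun n => h n * D n) atTop (𝓝 0))
    (hE : Tendsto (fun n => T n * h n * (h n * v n) ^ (p - 1) * E n) atTop atTop) :
    NormInflation d₁ d₂ p q ν s := by
  intro δ hδ
  obtain ⟨ε, hε, c₀, hc₀, H⟩ := exists_solution_lower_bound (d₁ := d₁) (d₂ := d₂) hp hq hν
    (κ := (c₁ / c₂) ^ (p - 1)) (by positivity)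
  have h1 : ∀ᶠ n in atTop, T n * (h n * v n) ^ (p - 1) < ε / c₂ ^ (p - 1) :=
    hTv.eventually_lt_const (by positivity)
  have h2 : ∀ᶠ n in atTop, T n < δ := hT.eventually_lt_const hδ
  have h3 : ∀ᶠ n in atTop, e n < ε := he.eventually_lt_const hε
  have h4 : ∀ᶠ n in atTop, h n * D n < δ := hD.eventually_lt_const hδ
  have h5 := hE.eventually_gt_atTop (δ⁻¹ / (c₀ * c₁ ^ (p - 1)))
  obtain ⟨n, ⟨Ω, P, ω, R, hΩm, hωm, hR, hΩ, hvl, hvu, hPΩ, hh, hTp, hv, hωΩ, hP, hph, hlow, hDn,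
    hEn⟩, h1, h2, h3, h4, h5⟩ :=
    (hdata.and (h1.and (h2.and (h3.and (h4.and h5))))).exists
  set k := p - 1
  set m := (freqMeasure d₁ d₂ Ω).toReal
  have hm0 : 0 ≤ m := ENNReal.toReal_nonneg
  obtain ⟨φ, u, hφ, hu, hs⟩ := H Ω P ω (h n) (T n) R hΩm hωm hR hΩ hPΩ hh hTp
    (by
      calc T n * (h n * m) ^ k ≤ T n * (h n * (c₂ * v n)) ^ k := by gcongr
        _ = c₂ ^ k * (T n * (h n * v n) ^ k) := by rw [mul_pow, mul_pow, mul_pow]; ring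
        _ ≤ c₂ ^ k * (ε / c₂ ^ k) := by gcongr
        _ = ε := by field_simp)
    (fun ξ hξ => (hωΩ ξ hξ).trans h3.le) (fun ξ hξ => (hP ξ hξ).trans h3.le) hph
    (fun ξ hξ => by
      refine le_trans ?_ (hlow ξ hξ)
      calc (c₁ / c₂) ^ k * m ^ k ≤ (c₁ / c₂) ^ k * (c₂ * v n) ^ k := by gcongr
        _ = (c₁ * v n) ^ k := by rw [← mul_pow]; congr 1; field_simp)
  refine ⟨φ, T n, u, hφ, ?_, hTp, h2, hu, ?_⟩
  · rw [(hs s).1]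
    calc ENNReal.ofReal (h n) * weightedNorm s (ind Ω)
        ≤ ENNReal.ofReal (h n) * ENNReal.ofReal (D n) := by gcongr
      _ = ENNReal.ofReal (h n * D n) := (ENNReal.ofReal_mul hh.le).symm
      _ < ENNReal.ofReal δ := (ENNReal.ofReal_lt_ofReal_iff hδ).2 h4
  · refine lt_of_lt_of_le ?_ (hs s).2
    have hlt : δ⁻¹ < c₀ * (T n * h n * (h n * m) ^ k) * E n := by
      rw [div_lt_iff₀ (by positivity)] at h5
      have hE0 : 0 < E n := by
        by_contra hneg
        have h6 : T n * h n * (h n * v n) ^ k * E n ≤ 0 :=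
          mul_nonpos_of_nonneg_of_nonpos (by positivity) (not_lt.1 hneg)
        have h7 : T n * h n * (h n * v n) ^ k * E n * (c₀ * c₁ ^ k) ≤ 0 :=
          mul_nonpos_of_nonpos_of_nonneg h6 (by positivity)
        have : 0 < δ⁻¹ := by positivity
        linarith
      calc δ⁻¹ < T n * h n * (h n * v n) ^ k * E n * (c₀ * c₁ ^ k) := h5
        _ = c₀ * (T n * h n * (h n * (c₁ * v n)) ^ k) * E n := by
            rw [mul_pow, mul_pow, mul_pow]; ring
        _ ≤ _ := by gcongr
    calc ENNReal.ofReal δ⁻¹ < ENNReal.ofReal (c₀ * (T n * h n * (h n * m) ^ k) * E n) :=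
          (ENNReal.ofReal_lt_ofReal_iff (lt_trans (by positivity) hlt)).2 hlt
      _ = ENNReal.ofReal (c₀ * (T n * h n * (h n * m) ^ k)) * ENNReal.ofReal (E n) :=
          ENNReal.ofReal_mul (by positivity)
      _ ≤ _ := by gcongr

lemma tendsto_natCast_rpow_zero {x : ℝ} (hx : x < 0) :
    Tendsto (fun n : ℕ => (n : ℝ) ^ x) atTop (𝓝 0) := by
  have := (tendsto_rpow_neg_atTop (neg_pos.2 hx)).comp tendsto_natCast_atTop_atTop
  simpa [Function.comp_def] using this

lemma tendsto_natCast_rpow_atTop {x : ℝ} (hx : 0 < x) :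
    Tendsto (fun n : ℕ => (n : ℝ) ^ x) atTop atTop :=
  (tendsto_rpow_atTop hx).comp tendsto_natCast_atTop_atTop

/-- Norm inflation with parameters which are powers of the frequency. -/
theorem normInflation_of_rpow {p q : ℕ} (hp : 2 ≤ p) (hq : q ≤ p) {ν : ℂ} (hν : ν ≠ 0)
    {s c₁ c₂ C c θ τ β ρ γ η : ℝ} (hc₁ : 0 < c₁) (hc₂ : 0 < c₂) (hc : 0 < c)
    (hdata : ∀ᶠ n : ℕ in atTop, InflationData d₁ d₂ p q s c₁ c₂ ((n : ℝ) ^ θ) ((n : ℝ) ^ (-τ))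
      ((n : ℝ) ^ β) (C * (n : ℝ) ^ ρ) (C * (n : ℝ) ^ γ) (c * (n : ℝ) ^ η))
    (hτ : 0 < τ) (hρ : ρ < 0) (hsmall : -τ + (p - 1 : ℕ) * (θ + β) < 0) (hγ : θ + γ < 0)
    (hlarge : 0 < -τ + θ + (p - 1 : ℕ) * (θ + β) + η) :
    NormInflation d₁ d₂ p q ν s := by
  have hpow : ∀ n : ℕ, 0 < n → ((n : ℝ) ^ θ * (n : ℝ) ^ β) ^ (p - 1)
      = (n : ℝ) ^ ((p - 1 : ℕ) * (θ + β)) := fun n hn => by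
    have hn' : (0 : ℝ) < n := Nat.cast_pos.2 hn
    rw [← Real.rpow_add hn', ← Real.rpow_natCast, ← Real.rpow_mul hn'.le, mul_comm]
  refine normInflation_of_inflationData hp hq hν hc₁ hc₂ hdata
    (tendsto_natCast_rpow_zero (by linarith)) ?_ ?_ ?_ ?_
  · simpa using (tendsto_natCast_rpow_zero hρ).const_mul C
  · refine (tendsto_natCast_rpow_zero hsmall).congr' ?_
    filter_upwards [eventually_gt_atTop 0] with n hn
    rw [hpow n hn, Real.rpow_add (Nat.cast_pos.2 hn)]
  · have := (tendsto_natCast_rpow_zero hγ).const_mul C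
    rw [mul_zero] at this
    refine this.congr' ?_
    filter_upwards [eventually_gt_atTop 0] with n hn
    rw [Real.rpow_add (Nat.cast_pos.2 hn)]
    ring
  · refine ((tendsto_natCast_rpow_atTop hlarge).const_mul_atTop hc).congr' ?_
    filter_upwards [eventually_gt_atTop 0] with n hn
    have hn' : (0 : ℝ) < n := Nat.cast_pos.2 hn
    rw [hpow n hn, Real.rpow_add hn', Real.rpow_add hn', Real.rpow_add hn']
    ring

lemma weightedNorm_ind_eq (s : ℝ) {Ω : Set (Freq d₁ d₂)} :
    weightedNorm s (ind Ω) = eLpNorm (Ω.indicator fun ξ => bracket ξ ^ s) 2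
      (freqMeasure d₁ d₂) := by
  rw [weightedNorm]
  refine eLpNorm_congr_norm_ae (Eventually.of_forall fun ξ => ?_)
  by_cases hξ : ξ ∈ Ω
  · simp [ind_of_mem hξ, hξ]
  · simp [ind_of_notMem hξ, hξ]

lemma eLpNorm_indicator_const_two {Ω : Set (Freq d₁ d₂)} (hΩ : MeasurableSet Ω) {b : ℝ}
    (hb : 0 ≤ b) {m : ℝ} (hm : 0 ≤ m) (h : freqMeasure d₁ d₂ Ω = ENNReal.ofReal m) :
    eLpNorm (Ω.indicator fun _ => b) 2 (freqMeasure d₁ d₂) = ENNReal.ofReal (b * √m) := by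
  rw [eLpNorm_indicator_const hΩ (by simp) (by simp), h, ENNReal.ofReal_mul hb, ← ofReal_norm,
    Real.norm_of_nonneg hb, ENNReal.ofReal_rpow_of_nonneg hm (by simp)]
  congr 2
  rw [Real.sqrt_eq_rpow]
  simp

lemma weightedNorm_ind_le {s : ℝ} (hs : s ≤ 0) {Ω : Set (Freq d₁ d₂)} (hΩ : MeasurableSet Ω)
    {b m : ℝ} (hb : 0 < b) (hbΩ : ∀ ξ ∈ Ω, b ≤ bracket ξ) (hfin : freqMeasure d₁ d₂ Ω ≠ ∞)
    (hm : (freqMeasure d₁ d₂ Ω).toReal ≤ m) :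
    weightedNorm s (ind Ω) ≤ ENNReal.ofReal (b ^ s * √m) := by
  rw [weightedNorm_ind_eq]
  have h1 : eLpNorm (Ω.indicator fun ξ => bracket ξ ^ s) 2 (freqMeasure d₁ d₂) ≤
      eLpNorm (Ω.indicator fun _ => b ^ s) 2 (freqMeasure d₁ d₂) := by
    refine eLpNorm_mono fun ξ => ?_
    by_cases hξ : ξ ∈ Ω
    · simp only [hξ, Set.indicator_of_mem]
      rw [Real.norm_of_nonneg (Real.rpow_nonneg (bracket_pos ξ).le s),
        Real.norm_of_nonneg (Real.rpow_nonneg hb.le s)]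
      exact Real.rpow_le_rpow_of_nonpos hb (hbΩ ξ hξ) hs
    · simp [hξ]
  refine h1.trans ?_
  rw [eLpNorm_indicator_const_two hΩ (Real.rpow_nonneg hb.le s) ENNReal.toReal_nonneg
    (ENNReal.ofReal_toReal hfin).symm]
  gcongr

lemma le_weightedNorm_ind {s : ℝ} (hs : s ≤ 0) {Ω : Set (Freq d₁ d₂)} (hΩ : MeasurableSet Ω)
    {b m : ℝ} (hb : 0 ≤ b) (hbΩ : ∀ ξ ∈ Ω, bracket ξ ≤ b) (hfin : freqMeasure d₁ d₂ Ω ≠ ∞)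
    (hm : m ≤ (freqMeasure d₁ d₂ Ω).toReal) :
    ENNReal.ofReal (b ^ s * √m) ≤ weightedNorm s (ind Ω) := by
  rw [weightedNorm_ind_eq]
  have h1 : eLpNorm (Ω.indicator fun _ => b ^ s) 2 (freqMeasure d₁ d₂) ≤
      eLpNorm (Ω.indicator fun ξ => bracket ξ ^ s) 2 (freqMeasure d₁ d₂) := by
    refine eLpNorm_mono fun ξ => ?_
    by_cases hξ : ξ ∈ Ω
    · simp only [hξ, Set.indicator_of_mem]
      rw [Real.norm_of_nonneg (Real.rpow_nonneg (bracket_pos ξ).le s),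
        Real.norm_of_nonneg (Real.rpow_nonneg hb s)]
      exact Real.rpow_le_rpow_of_nonpos (bracket_pos ξ) (hbΩ ξ hξ) hs
    · simp [hξ]
  refine le_trans ?_ h1
  rw [eLpNorm_indicator_const_two hΩ (Real.rpow_nonneg hb s) ENNReal.toReal_nonneg
    (ENNReal.ofReal_toReal hfin).symm]
  have := Real.rpow_nonneg hb s
  gcongr

lemma integrable_ind {Ω : Set (Freq d₁ d₂)} (hΩ : MeasurableSet Ω)
    (hfin : freqMeasure d₁ d₂ Ω ≠ ∞) : Integrable (ind Ω) (freqMeasure d₁ d₂) :=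
  (integrable_indicator_iff hΩ).2 (integrableOn_const hfin)

/-- Coherent contributions to a convolution power of an indicator function. -/
lemma pow_le_re_cpow_ind (σ : ℕ → Bool) {Ω P Q : Set (Freq d₁ d₂)} (hΩ : MeasurableSet Ω)
    (hfin : freqMeasure d₁ d₂ Ω ≠ ∞) (hP : MeasurableSet P) (hPfin : freqMeasure d₁ d₂ P ≠ ∞)
    (hPQ : P ⊆ Q) (hsub : ∀ ξ ∈ P, ∀ η ∈ P, ξ - η ∈ Q) {x : ℕ → Freq d₁ d₂} (k : ℕ)
    (hx : ∀ j ≤ k, ∀ η, η - x j ∈ Q → twist (σ j) (ind Ω) η = 1) :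
    ∃ f : Freq d₁ d₂ → ℝ, (∀ ξ, 0 ≤ f ξ) ∧
      (∀ ξ, cpow (freqMeasure d₁ d₂) σ (ind Ω) k ξ = f ξ) ∧
      ∀ ξ, ξ - ∑ j ∈ Finset.range (k + 1), x j ∈ P → (freqMeasure d₁ d₂ P).toReal ^ k ≤ f ξ := by
  set μ := freqMeasure d₁ d₂
  set m := (μ P).toReal
  have hm0 : 0 ≤ m := ENNReal.toReal_nonneg
  -- All factors are real and nonnegative, so nothing cancels and any portion of the convolution
  -- integral is a lower bound.
  have hreal : ∀ b, ∃ g : Freq d₁ d₂ → ℝ, (∀ ξ, 0 ≤ g ξ) ∧ ∀ ξ, twist b (ind Ω) ξ = g ξ := by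
    intro b
    refine ⟨fun ξ => if b then Ω.indicator 1 ξ else Ω.indicator 1 (-ξ), fun ξ => ?_, fun ξ => ?_⟩
    · have : ∀ ξ, 0 ≤ Ω.indicator (1 : Freq d₁ d₂ → ℝ) ξ := fun ξ =>
        Set.indicator_nonneg (fun _ _ => zero_le_one) ξ
      cases b <;> simp [this]
    · have : ∀ ξ, ind Ω ξ = ((Ω.indicator (1 : Freq d₁ d₂ → ℝ) ξ : ℝ) : ℂ) := fun ξ => by
        by_cases hξ : ξ ∈ Ω
        · simp [ind_of_mem hξ, hξ]
        · simp [ind_of_notMem hξ, hξ]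
      cases b <;> simp [twist, this]
  induction k with
  | zero =>
    obtain ⟨g, hg0, hg⟩ := hreal (σ 0)
    refine ⟨g, hg0, hg, fun ξ hξ => ?_⟩
    have h1 := hx 0 le_rfl ξ (hPQ (by simpa using hξ))
    rw [hg] at h1
    rw [pow_zero]
    exact (by exact_mod_cast h1.symm : (1 : ℝ) = g ξ).le
  | succ k ih =>
    obtain ⟨f, hf0, hf, hfl⟩ := ih fun j hj => hx j (hj.trans k.le_succ)
    obtain ⟨g, hg0, hg⟩ := hreal (σ (k + 1))
    refine ⟨fun ξ => ∫ η, f η * g (ξ - η) ∂μ,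
      fun ξ => integral_nonneg fun η => mul_nonneg (hf0 η) (hg0 _), fun ξ => ?_, fun ξ hξ => ?_⟩
    · simp only [cpow]
      rw [← integral_complex_ofReal]
      refine integral_congr_ae (Eventually.of_forall fun η => ?_)
      simp only [hf, hg, Complex.ofReal_mul]
    · set S := ∑ j ∈ Finset.range (k + 1), x j
      have hi : Integrable (fun η => f η * g (ξ - η)) μ := by
        have hmeas : Measurable fun η => twist (σ (k + 1)) (ind Ω) (ξ - η) :=
          (measurable_twist (measurable_ind hΩ) _).comp (measurable_const.sub measurable_id)
        have h1 : Integrable (fun η => cpow μ σ (ind Ω) k η * twist (σ (k + 1)) (ind Ω) (ξ - η)) μ := by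
          refine (integrable_cpow (integrable_ind hΩ hfin) σ k).mul_bdd (c := 1)
            hmeas.aestronglyMeasurable (Eventually.of_forall fun η => ?_)
          have h2 := enorm_twist_le (V := fun _ => 1) (fun _ => rfl) (g := ind Ω) (fun ξ => by
            by_cases hξ : ξ ∈ Ω
            · simp [ind_of_mem hξ]
            · simp [ind_of_notMem hξ]) (σ (k + 1)) (ξ - η)
          rw [← ofReal_norm, ← ENNReal.ofReal_one] at h2
          exact (ENNReal.ofReal_le_ofReal_iff zero_le_one).1 h2
        refine h1.re.congr (Eventually.of_forall fun η => ?_)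
        simp only [hf, hg]
        rw [← Complex.ofReal_mul]
        simp
      -- Only η in P translated by the sum of the first centres is kept. For such η the last
      -- argument differs from its own centre by an element of P - P ⊆ Q, where the last factor
      -- equals 1.
      set A : Set (Freq d₁ d₂) := (fun η => η - S) ⁻¹' P
      have hA : MeasurableSet A := (measurable_id.sub_const S) hP
      have hμA : μ A = μ P := by
        have h3 : MeasurePreserving (fun η => η - S) μ μ := measurePreserving_sub_right μ S
        exact h3.measure_preimage hP.nullMeasurableSet
      have hle : ∀ η, A.indicator (fun _ => m ^ k) η ≤ f η * g (ξ - η) := by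
        intro η
        by_cases hη : η ∈ A
        · rw [Set.indicator_of_mem hη]
          have h1 : twist (σ (k + 1)) (ind Ω) (ξ - η) = 1 := by
            refine hx (k + 1) le_rfl _ ?_
            have e : ξ - η - x (k + 1) = (ξ - ∑ j ∈ Finset.range (k + 1 + 1), x j) - (η - S) := by
              rw [Finset.sum_range_succ]
              abel
            rw [e]
            exact hsub _ hξ _ hη
          rw [hg] at h1
          have h2 : g (ξ - η) = 1 := by exact_mod_cast h1
          rw [h2, mul_one]
          exact hfl η hη
        · rw [Set.indicator_of_notMem hη]
          exact mul_nonneg (hf0 η) (hg0 _)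
      calc m ^ (k + 1) = ∫ η, A.indicator (fun _ => m ^ k) η ∂μ := by
            rw [integral_indicator_const _ hA, measureReal_def, hμA, smul_eq_mul, pow_succ]
            ring
        _ ≤ _ := integral_mono ((integrable_indicator_iff hA).2
            (integrableOn_const (by rw [hμA]; exact hPfin))) hi hle

end Inflation

/-! ### Frequency boxes and their measure -/

section Box

variable {d₁ d₂ : ℕ}

/-- The box of frequencies with half-widths `a` and `b`. -/
def box (a : Fin d₁ → ℝ) (b : Fin d₂ → ℝ) : Set (Freq d₁ d₂) :=
  {ξ | (∀ i, |ξ.1 i| ≤ a i) ∧ ∀ j, |(ξ.2 j : ℝ)| ≤ b j}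

lemma box_eq_prod (a : Fin d₁ → ℝ) (b : Fin d₂ → ℝ) :
    box a b = ((MeasurableEquiv.toLp 2 (Fin d₁ → ℝ)).symm ⁻¹' Set.pi Set.univ fun i =>
      Set.Icc (-a i) (a i)) ×ˢ (Set.pi Set.univ fun j => {n : ℤ | |(n : ℝ)| ≤ b j}) := by
  ext ξ
  simp [box, abs_le, Pi.le_def, forall_and]

lemma measurableSet_box (a : Fin d₁ → ℝ) (b : Fin d₂ → ℝ) : MeasurableSet (box a b) := by
  rw [box_eq_prod]
  exact ((MeasurableSet.univ_pi fun i => measurableSet_Icc).preimage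
    (MeasurableEquiv.measurable _)).prod (MeasurableSet.of_discrete)

lemma freqMeasure_prod_pi (A : Fin d₁ → Set ℝ) (B : Fin d₂ → Set ℤ)
    (hA : ∀ i, MeasurableSet (A i)) :
    freqMeasure d₁ d₂ (((MeasurableEquiv.toLp 2 (Fin d₁ → ℝ)).symm ⁻¹' Set.pi Set.univ A) ×ˢ
      (Set.pi Set.univ B)) = (∏ i, volume (A i)) * ∏ j, Measure.count (B j) := by
  rw [freqMeasure, Measure.prod_prod,
    (EuclideanSpace.volume_preserving_symm_measurableEquiv_toLp (Fin d₁)).measure_preimage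
      (MeasurableSet.univ_pi hA).nullMeasurableSet, volume_pi_pi, count_eq_pi_count,
    Measure.pi_pi]

lemma count_abs_le {b : ℝ} (hb : 0 ≤ b) :
    (Measure.count : Measure ℤ) {n : ℤ | |(n : ℝ)| ≤ b} = ENNReal.ofReal (2 * ⌊b⌋₊ + 1) := by
  have e : {n : ℤ | |(n : ℝ)| ≤ b} = (Finset.Icc (-(⌊b⌋₊ : ℤ)) ⌊b⌋₊ : Set ℤ) := by
    ext n
    simp only [Set.mem_ofPred_eq, Finset.coe_Icc, Set.mem_Icc, ← abs_le]
    rw [← Int.cast_abs, Int.abs_eq_natAbs, Int.cast_natCast, Nat.cast_le, Nat.le_floor_iff hb]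
  rw [e, Measure.count_apply_finset, Int.card_Icc]
  have : ((⌊b⌋₊ : ℤ) + 1 - -(⌊b⌋₊ : ℤ)).toNat = 2 * ⌊b⌋₊ + 1 := by omega
  rw [this, ← ENNReal.ofReal_natCast]
  push_cast
  rfl

/-- The measure of a box. -/
def boxVolume (a : Fin d₁ → ℝ) (b : Fin d₂ → ℝ) : ℝ :=
  (∏ i, 2 * a i) * ∏ j, (2 * (⌊b j⌋₊ : ℝ) + 1)

lemma freqMeasure_box {a : Fin d₁ → ℝ} {b : Fin d₂ → ℝ} (ha : ∀ i, 0 ≤ a i) (hb : ∀ j, 0 ≤ b j) :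
    freqMeasure d₁ d₂ (box a b) = ENNReal.ofReal (boxVolume a b) := by
  rw [box_eq_prod, freqMeasure_prod_pi _ _ fun i => measurableSet_Icc, boxVolume,
    ENNReal.ofReal_mul (Finset.prod_nonneg fun i _ => by have := ha i; positivity),
    ENNReal.ofReal_prod_of_nonneg (fun i _ => by have := ha i; positivity),
    ENNReal.ofReal_prod_of_nonneg (fun j _ => by positivity)]
  congr 1
  · refine Finset.prod_congr rfl fun i _ => ?_
    rw [Real.volume_Icc]
    congr 1
    ring
  · exact Finset.prod_congr rfl fun j _ => count_abs_le (hb j)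

lemma boxVolume_nonneg {a : Fin d₁ → ℝ} {b : Fin d₂ → ℝ} (ha : ∀ i, 0 ≤ a i) :
    0 ≤ boxVolume a b :=
  mul_nonneg (Finset.prod_nonneg fun i _ => by have := ha i; positivity)
    (Finset.prod_nonneg fun j _ => by positivity)

lemma toReal_freqMeasure_box {a : Fin d₁ → ℝ} {b : Fin d₂ → ℝ} (ha : ∀ i, 0 ≤ a i)
    (hb : ∀ j, 0 ≤ b j) : (freqMeasure d₁ d₂ (box a b)).toReal = boxVolume a b := by
  rw [freqMeasure_box ha hb, ENNReal.toReal_ofReal (boxVolume_nonneg ha)]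

lemma sub_mem_box {a : Fin d₁ → ℝ} {b : Fin d₂ → ℝ} {ξ η : Freq d₁ d₂}
    (hξ : ξ ∈ box (fun i => a i / 2) fun j => b j / 2)
    (hη : η ∈ box (fun i => a i / 2) fun j => b j / 2) : ξ - η ∈ box a b := by
  refine ⟨fun i => ?_, fun j => ?_⟩
  · have h1 := hξ.1 i
    have h2 := hη.1 i
    have h3 : (ξ - η).1 i = ξ.1 i - η.1 i := rfl
    rw [h3]
    exact (abs_sub _ _).trans (by linarith)
  · have h1 := hξ.2 j
    have h2 := hη.2 j
    have h3 : (ξ - η).2 j = ξ.2 j - η.2 j := rfl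
    rw [h3, Int.cast_sub]
    exact (abs_sub _ _).trans (by linarith)

lemma neg_mem_box {a : Fin d₁ → ℝ} {b : Fin d₂ → ℝ} {ξ : Freq d₁ d₂} (h : ξ ∈ box a b) :
    -ξ ∈ box a b := by
  refine ⟨fun i => ?_, fun j => ?_⟩
  · have h3 : (-ξ).1 i = -ξ.1 i := rfl
    rw [h3, abs_neg]
    exact h.1 i
  · have h3 : (-ξ).2 j = -ξ.2 j := rfl
    rw [h3, Int.cast_neg, abs_neg]
    exact h.2 j

lemma box_mono {a a' : Fin d₁ → ℝ} {b b' : Fin d₂ → ℝ} (ha : ∀ i, a i ≤ a' i)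
    (hb : ∀ j, b j ≤ b' j) : box a b ⊆ box a' b' :=
  fun _ h => ⟨fun i => (h.1 i).trans (ha i), fun j => (h.2 j).trans (hb j)⟩

lemma norm_coord_le_of_mem_box {A : ℝ} (hA : 0 ≤ A) {a : Fin d₁ → ℝ} {b : Fin d₂ → ℝ}
    (ha : ∀ i, a i ≤ A) (hb : ∀ j, b j ≤ A) {ξ : Freq d₁ d₂} (h : ξ ∈ box a b) :
    ‖coord ξ‖ ≤ (d₁ + d₂ : ℕ) * A := by
  rw [← abs_of_nonneg (norm_nonneg (coord ξ)), ← abs_of_nonneg (by positivity : 0 ≤ _ * A),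
    ← sq_le_sq, EuclideanSpace.real_norm_sq_eq, Fintype.sum_sum_type]
  have hsq : ∀ {x y : ℝ}, |x| ≤ y → y ≤ A → x ^ 2 ≤ A ^ 2 := fun {x y} h1 h2 => by
    rw [← sq_abs]
    exact pow_le_pow_left₀ (abs_nonneg _) (h1.trans h2) 2
  have h1 : ∑ i, coord ξ (Sum.inl i) ^ 2 ≤ ∑ _i : Fin d₁, A ^ 2 :=
    Finset.sum_le_sum fun i _ => hsq (h.1 i) (ha i)
  have h2 : ∑ j, coord ξ (Sum.inr j) ^ 2 ≤ ∑ _j : Fin d₂, A ^ 2 :=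
    Finset.sum_le_sum fun j _ => hsq (h.2 j) (hb j)
  simp only [Finset.sum_const, Finset.card_univ, Fintype.card_fin, nsmul_eq_mul] at h1 h2
  have h3 : ((d₁ + d₂ : ℕ) : ℝ) ≤ ((d₁ + d₂ : ℕ) : ℝ) ^ 2 := by
    exact_mod_cast Nat.le_self_pow two_ne_zero _
  rw [mul_pow]
  calc _ ≤ (d₁ : ℝ) * A ^ 2 + d₂ * A ^ 2 := add_le_add h1 h2
    _ = ((d₁ + d₂ : ℕ) : ℝ) * A ^ 2 := by push_cast; ring
    _ ≤ _ := by gcongr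

end Box
end NLS
end

/-! ### Two families of box data -/

noncomputable section

namespace NLS

variable {d₁ d₂ : ℕ}

lemma InflationData.mono {p q : ℕ} {s c₁ c₂ h T v e D E e' D' E' : ℝ}
    (H : InflationData d₁ d₂ p q s c₁ c₂ h T v e D E) (he : e ≤ e') (hD : D ≤ D') (hE : E' ≤ E) :
    InflationData d₁ d₂ p q s c₁ c₂ h T v e' D' E' := by
  obtain ⟨Ω, P, ω, R, h1, h2, h3, h4, h5, h6, h7, h8, h9, h10, h11, h12, h13, h14, h15, h16⟩ := H
  exact ⟨Ω, P, ω, R, h1, h2, h3, h4, h5, h6, h7, h8, h9, h10, fun ξ hξ => (h11 ξ hξ).trans he,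
    fun ξ hξ => (h12 ξ hξ).trans he, h13, h14, h15.trans (ENNReal.ofReal_le_ofReal hD),
    (ENNReal.ofReal_le_ofReal hE).trans h16⟩

lemma coord_zsmul (z : ℤ) (ξ : Freq d₁ d₂) : coord (z • ξ) = (z : ℝ) • coord ξ := by
  have := map_zsmul (AddMonoidHom.mk' (coord : Freq d₁ d₂ → Cover d₁ d₂) coord_add) z ξ
  simpa [Int.cast_smul_eq_zsmul] using this

lemma coord_single_left (i : Fin d₁) (x : ℝ) :
    coord ((EuclideanSpace.single i x, 0) : Freq d₁ d₂) = EuclideanSpace.single (Sum.inl i) x := by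
  ext j
  rcases j with j | j <;> simp [coord_inl, coord_inr]

lemma coord_single_right (i : Fin d₂) (n : ℤ) :
    coord ((0, Pi.single i n) : Freq d₁ d₂) = EuclideanSpace.single (Sum.inr i) (n : ℝ) := by
  ext j
  rcases j with j | j
  · simp [coord_inl]
  · simp only [coord_inr, PiLp.single_apply, Sum.inr.injEq, Pi.single_apply]
    split_ifs <;> simp

lemma exists_norm_coord_eq_one (hd : 1 ≤ d₁ + d₂) : ∃ e : Freq d₁ d₂, ‖coord e‖ = 1 := by
  rcases Nat.eq_zero_or_pos d₁ with h | h
  · exact ⟨(0, Pi.single ⟨0, by omega⟩ 1), by rw [coord_single_right]; simp⟩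
  · exact ⟨(EuclideanSpace.single ⟨0, h⟩ 1, 0), by rw [coord_single_left]; simp⟩

/-- Pairs 1, -1 settle even p; one triple 2, -1, -1 corrects the parity. This is why the data also
need boxes at ±2N e. -/
lemma exists_sum_eq_zero {p : ℕ} (hp : 2 ≤ p) : ∃ z : ℕ → ℤ,
    (∀ j, z j ∈ ({1, -1, 2, -2} : Finset ℤ)) ∧ ∑ j ∈ Finset.range p, z j = 0 := by
  induction p using Nat.strong_induction_on with
  | _ p ih =>
    rcases (by omega : p = 2 ∨ p = 3 ∨ 4 ≤ p) with rfl | rfl | h4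
    · exact ⟨fun j => if j = 0 then 1 else -1, fun j => by dsimp; split_ifs <;> simp, by decide⟩
    · exact ⟨fun j => if j = 0 then 2 else -1, fun j => by dsimp; split_ifs <;> simp, by decide⟩
    · obtain ⟨r, rfl⟩ : ∃ r, p = r + 1 + 1 := ⟨p - 2, by omega⟩
      obtain ⟨z, hz, hs⟩ := ih r (by omega) (by omega)
      refine ⟨fun j => if j < r then z j else if j = r then 1 else -1, fun j => ?_, ?_⟩
      · dsimp
        split_ifs
        · exact hz j
        · simp
        · simp
      · rw [Finset.sum_range_succ, Finset.sum_range_succ, Finset.sum_congr rfl fun j hj =>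
          if_pos (Finset.mem_range.1 hj), hs]
        simp

lemma boxVolume_const_le {A : ℝ} (hA : 1 ≤ A) :
    boxVolume (fun _ : Fin d₁ => A) (fun _ : Fin d₂ => A) ≤ 3 ^ (d₁ + d₂) * A ^ (d₁ + d₂) := by
  have hA0 : 0 < A := by linarith
  have h1 := Nat.floor_le hA0.le
  rw [boxVolume, ← mul_pow, pow_add]
  simp only [Finset.prod_const, Finset.card_univ, Fintype.card_fin]
  gcongr <;> linarith

lemma le_boxVolume_const {A : ℝ} (hA : 0 ≤ A) :
    A ^ (d₁ + d₂) ≤ boxVolume (fun _ : Fin d₁ => A) (fun _ : Fin d₂ => A) := by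
  have h1 := Nat.lt_floor_add_one A
  have h2 : (0 : ℝ) ≤ ⌊A⌋₊ := Nat.cast_nonneg _
  rw [boxVolume, pow_add]
  simp only [Finset.prod_const, Finset.card_univ, Fintype.card_fin]
  gcongr <;> linarith

lemma phase_zero (t : ℝ) (ξ : Freq d₁ d₂) : phase (fun _ => (0 : ℝ)) t ξ = 1 := by simp [phase]

lemma norm_coord_translate_le {x ξ : Freq d₁ d₂} {r : ℝ} (h : ‖coord (ξ - x)‖ ≤ r) :
    ‖coord x‖ - r ≤ ‖coord ξ‖ ∧ ‖coord ξ‖ ≤ ‖coord x‖ + r := by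
  rw [coord_sub] at h
  have h1 := norm_sub_norm_le (coord x) (coord ξ)
  have h2 := norm_sub_norm_le (coord ξ) (coord x)
  rw [norm_sub_rev] at h1
  constructor <;> linarith

lemma freqMeasure_preimage_sub (x : Freq d₁ d₂) {Q : Set (Freq d₁ d₂)} (hQ : MeasurableSet Q) :
    freqMeasure d₁ d₂ ((fun ξ => ξ - x) ⁻¹' Q) = freqMeasure d₁ d₂ Q :=
  (measurePreserving_sub_right (freqMeasure d₁ d₂) x).measure_preimage hQ.nullMeasurableSet

/-- The high frequency data: boxes centred at `±N e` and `±2N e`. -/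
def boxes (A : ℝ) (N : ℕ) (e : Freq d₁ d₂) : Set (Freq d₁ d₂) :=
  ⋃ z ∈ ({1, -1, 2, -2} : Finset ℤ), (fun ξ => ξ - (z * (N : ℤ)) • e) ⁻¹' box (fun _ => A) fun _ => A

lemma mem_boxes {A : ℝ} {N : ℕ} {e ξ : Freq d₁ d₂} : ξ ∈ boxes A N e ↔
    ∃ z ∈ ({1, -1, 2, -2} : Finset ℤ), ξ - (z * (N : ℤ)) • e ∈ box (fun _ => A) fun _ => A := by
  simp only [boxes, Set.mem_iUnion, exists_prop, Set.mem_preimage]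

/-- The boxes have radius at most N/4, around centres of modulus N or 2N. -/
lemma norm_coord_of_mem_boxes {A : ℝ} {N : ℕ} {e ξ : Freq d₁ d₂} (he : ‖coord e‖ = 1)
    (hA : 0 ≤ A) (hAN : 4 * ((d₁ + d₂ : ℕ) * A) ≤ N) (hξ : ξ ∈ boxes A N e) :
    3 / 4 * (N : ℝ) ≤ ‖coord ξ‖ ∧ ‖coord ξ‖ ≤ 3 * N := by
  obtain ⟨z, hz, hξ⟩ := mem_boxes.1 hξ
  have h1 := norm_coord_le_of_mem_box hA (fun _ => le_rfl) (fun _ => le_rfl) hξ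
  obtain ⟨h2, h3⟩ := norm_coord_translate_le h1
  have h4 : ‖coord ((z * (N : ℤ)) • e)‖ = |(z : ℝ)| * N := by
    rw [coord_zsmul, norm_smul, he, mul_one, Real.norm_eq_abs]
    push_cast
    rw [abs_mul, Nat.abs_cast]
  have h5 : (1 : ℝ) ≤ |(z : ℝ)| ∧ |(z : ℝ)| ≤ 2 := by
    simp only [Finset.mem_insert, Finset.mem_singleton] at hz
    rcases hz with rfl | rfl | rfl | rfl <;> norm_num
  have hN : (0 : ℝ) ≤ N := Nat.cast_nonneg N
  rw [h4] at h2 h3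
  constructor <;> nlinarith [h5.1, h5.2]

/-- The set of centres is symmetric, so a conjugate factor sees the same boxes as a plain one; hence
q plays no role for these data. -/
lemma twist_ind_boxes {A : ℝ} {N : ℕ} {e η : Freq d₁ d₂} (b : Bool) {z : ℤ}
    (hz : z ∈ ({1, -1, 2, -2} : Finset ℤ))
    (h : η - (z * (N : ℤ)) • e ∈ box (fun _ => A) fun _ => A) :
    twist b (ind (boxes A N e)) η = 1 := by
  cases b
  · have h1 : -η ∈ boxes A N e := by
      refine mem_boxes.2 ⟨-z, ?_, ?_⟩
      · simp only [Finset.mem_insert, Finset.mem_singleton] at hz ⊢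
        omega
      · have h2 := neg_mem_box h
        have e : -η - (-z * (N : ℤ)) • e = -(η - (z * (N : ℤ)) • e) := by
          rw [neg_mul, neg_smul]
          abel
        rwa [e]
    simp [twist, ind_of_mem h1]
  · simp [twist, ind_of_mem (mem_boxes.2 ⟨z, hz, h⟩)]

/-- The model phase is ω = 0, legitimate once N² T is small, since every frequency involved has
modulus at most 3N. Half-size boxes serve as P because their differences stay in the full box. -/
lemma inflationData_boxes {p q : ℕ} (hp : 2 ≤ p) (hd : 1 ≤ d₁ + d₂) {s h T A E : ℝ} (hs : s ≤ 0)
    (hh : 0 < h) (hT : 0 < T) (hA : 1 ≤ A) {N : ℕ} (hAN : 4 * ((d₁ + d₂ : ℕ) * A) ≤ N)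
    (hE : ENNReal.ofReal E ≤
      weightedNorm s (ind (box (fun _ : Fin d₁ => A / 2) fun _ : Fin d₂ => A / 2))) :
    InflationData d₁ d₂ p q s ((1 / 2) ^ (d₁ + d₂)) (4 * 3 ^ (d₁ + d₂)) h T (A ^ (d₁ + d₂))
      (9 * (N : ℝ) ^ 2 * T) (((N : ℝ) / 2) ^ s * √(4 * 3 ^ (d₁ + d₂) * A ^ (d₁ + d₂))) E := by
  obtain ⟨e, he⟩ := exists_norm_coord_eq_one hd
  have hA0 : 0 ≤ A := by linarith
  have hd' : (1 : ℝ) ≤ (d₁ + d₂ : ℕ) := by exact_mod_cast hd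
  have hdA : 1 ≤ (d₁ + d₂ : ℕ) * A := one_le_mul_of_one_le_of_one_le hd' hA
  have hN : (0 : ℝ) < N := by linarith
  set Q : Set (Freq d₁ d₂) := box (fun _ => A) fun _ => A with hQ
  set P : Set (Freq d₁ d₂) := box (fun _ => A / 2) fun _ => A / 2 with hP
  set Ω := boxes A N e with hΩ
  have hQm : MeasurableSet Q := measurableSet_box _ _
  have hPm : MeasurableSet P := measurableSet_box _ _
  have hΩm : MeasurableSet Ω := Finset.measurableSet_biUnion _ fun z _ =>
    (measurable_id.sub_const _) hQm
  have hPQ : P ⊆ Q := box_mono (fun _ => by linarith) (fun _ => by linarith)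
  have hQv : freqMeasure d₁ d₂ Q = ENNReal.ofReal (boxVolume (fun _ : Fin d₁ => A) fun _ : Fin d₂ => A) :=
    freqMeasure_box (fun _ => hA0) fun _ => hA0
  have hPv : (1 / 2) ^ (d₁ + d₂) * A ^ (d₁ + d₂) ≤ (freqMeasure d₁ d₂ P).toReal := by
    rw [hP, toReal_freqMeasure_box (fun _ => by positivity) fun _ => by positivity, ← mul_pow]
    refine le_trans (le_of_eq ?_) (le_boxVolume_const (by positivity))
    congr 1
    ring
  have hPfin : freqMeasure d₁ d₂ P ≠ ∞ :=
    ne_top_of_le_ne_top (by rw [hQv]; exact ENNReal.ofReal_ne_top) (measure_mono hPQ)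
  have hΩle : freqMeasure d₁ d₂ Ω ≤ ENNReal.ofReal (4 * 3 ^ (d₁ + d₂) * A ^ (d₁ + d₂)) := by
    refine (measure_biUnion_finset_le _ _).trans ?_
    simp only [← hQ, freqMeasure_preimage_sub _ hQm, Finset.sum_const]
    rw [hQv, mul_assoc, ENNReal.ofReal_mul (by norm_num), nsmul_eq_mul]
    gcongr
    · rw [ENNReal.ofReal_ofNat]
      exact_mod_cast Finset.card_le_four
    · exact boxVolume_const_le hA
  have hΩfin : freqMeasure d₁ d₂ Ω ≠ ∞ := ne_top_of_le_ne_top ENNReal.ofReal_ne_top hΩle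
  have hΩr : (freqMeasure d₁ d₂ Ω).toReal ≤ 4 * 3 ^ (d₁ + d₂) * A ^ (d₁ + d₂) :=
    ENNReal.toReal_le_of_le_ofReal (by positivity) hΩle
  have hQΩ : freqMeasure d₁ d₂ P ≤ freqMeasure d₁ d₂ Ω := by
    refine (measure_mono hPQ).trans ?_
    rw [← freqMeasure_preimage_sub ((1 * (N : ℤ)) • e) hQm]
    exact measure_mono fun ξ hξ => mem_boxes.2 ⟨1, by simp, hξ⟩
  have hnorm := fun ξ (hξ : ξ ∈ Ω) => norm_coord_of_mem_boxes he hA0 hAN hξ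
  have hPn : ∀ ξ ∈ P, ‖coord ξ‖ ≤ (N : ℝ) / 4 := fun ξ hξ => by
    have := norm_coord_le_of_mem_box hA0 (fun _ => le_rfl) (fun _ => le_rfl) (hPQ hξ)
    linarith
  refine ⟨Ω, P, fun _ => 0, 3 * N, hΩm, measurable_const, fun ξ hξ => (hnorm ξ hξ).2, hΩfin,
    hPv.trans (ENNReal.toReal_mono hΩfin hQΩ), hΩr, ?_, hh, hT, by positivity, ?_, ?_, ?_, ?_, ?_,
    hE⟩
  · refine Set.disjoint_left.2 fun ξ h1 h2 => ?_
    have := (hnorm ξ h2).1.trans (hPn ξ h1)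
    linarith
  · intro ξ hξ
    rw [sub_zero, abs_of_nonneg (symbol_nonneg ξ), mul_comm]
    refine mul_le_mul_of_nonneg_right ?_ hT.le
    calc ‖coord ξ‖ ^ 2 ≤ (3 * N) ^ 2 := pow_le_pow_left₀ (norm_nonneg _) (hnorm ξ hξ).2 2
      _ = _ := by ring
  · intro ξ hξ
    rw [mul_comm]
    refine mul_le_mul_of_nonneg_right ?_ hT.le
    calc ‖coord ξ‖ ^ 2 ≤ (3 * N) ^ 2 :=
          pow_le_pow_left₀ (norm_nonneg _) ((hPn ξ hξ).trans (by linarith)) 2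
      _ = _ := by ring
  · intro t _ ξ _
    simp only [phase_zero, one_mul]
  · intro ξ hξ
    obtain ⟨z, hz, hz0⟩ := exists_sum_eq_zero hp
    obtain ⟨f, hf0, hf, hfl⟩ := pow_le_re_cpow_ind (fun j => decide (j < q)) hΩm hΩfin hPm hPfin hPQ
      (fun ξ h1 η h2 => sub_mem_box (a := fun _ => A) (b := fun _ => A) h1 h2)
      (x := fun j => (z j * (N : ℤ)) • e) (p - 1)
      (fun j _ η hη => twist_ind_boxes _ (hz j) hη)
    rw [hf, Complex.norm_real, Real.norm_of_nonneg (hf0 ξ)]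
    refine le_trans (pow_le_pow_left₀ (by positivity) hPv _) (hfl ξ ?_)
    rwa [Nat.sub_add_cancel (by omega), ← Finset.sum_smul, ← Finset.sum_mul, hz0, zero_mul,
      zero_smul, sub_zero]
  · refine weightedNorm_ind_le hs hΩm (by positivity) (fun ξ hξ => ?_) hΩfin hΩr
    exact le_trans (by linarith [(hnorm ξ hξ).1]) (norm_coord_le_bracket ξ)

/-- A single box around x suffices when p = 2q: q copies of x cancel against q copies of -x. The
model phase is the constant |x|², so the phase error involves only the variation of |ξ|² over the
box, whatever the size of x. -/
lemma inflationData_box {p q : ℕ} (hpq : p = 2 * q) (hq : 1 ≤ q) {s h T v c₁ c₂ N : ℝ}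
    (hs : s ≤ 0) (hh : 0 < h) (hT : 0 < T) (hv : 0 < v) (hc₁ : 0 ≤ c₁) {x : Freq d₁ d₂}
    {a : Fin d₁ → ℝ} {b : Fin d₂ → ℝ} (ha : ∀ i, 0 ≤ a i) (hb : ∀ j, 0 ≤ b j) (ha1 : ∀ i, a i ≤ 1)
    (hb1 : ∀ j, b j ≤ 1) (hx : N ≤ ‖coord x‖) (hN : 2 * (d₁ + d₂ : ℕ) < N)
    (hinner : ∀ η ∈ box a b, |inner ℝ (coord x) (coord η)| ≤ 1)
    (hlow : c₁ * v ≤ boxVolume (fun i => a i / 2) fun j => b j / 2)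
    (hup : boxVolume a b ≤ c₂ * v) :
    InflationData d₁ d₂ p q s c₁ c₂ h T v ((2 + ((d₁ + d₂ : ℕ) : ℝ) ^ 2) * T)
      ((N / 2) ^ s * √(c₂ * v)) ((1 + (d₁ + d₂ : ℕ)) ^ s * √(c₁ * v)) := by
  set d : ℝ := ((d₁ + d₂ : ℕ) : ℝ)
  have hd0 : 0 ≤ d := Nat.cast_nonneg _
  set Q : Set (Freq d₁ d₂) := box a b with hQ
  set P : Set (Freq d₁ d₂) := box (fun i => a i / 2) fun j => b j / 2 with hP
  set Ω : Set (Freq d₁ d₂) := (fun ξ => ξ - x) ⁻¹' Q with hΩ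
  have hQm : MeasurableSet Q := measurableSet_box _ _
  have hPm : MeasurableSet P := measurableSet_box _ _
  have hΩm : MeasurableSet Ω := (measurable_id.sub_const _) hQm
  have hPQ : P ⊆ Q := box_mono (fun i => by linarith [ha i]) (fun j => by linarith [hb j])
  have hΩv : freqMeasure d₁ d₂ Ω = ENNReal.ofReal (boxVolume a b) :=
    (freqMeasure_preimage_sub x hQm).trans (freqMeasure_box ha hb)
  have hΩfin : freqMeasure d₁ d₂ Ω ≠ ∞ := by rw [hΩv]; exact ENNReal.ofReal_ne_top
  have hΩr : (freqMeasure d₁ d₂ Ω).toReal = boxVolume a b := by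
    rw [hΩv, ENNReal.toReal_ofReal (boxVolume_nonneg ha)]
  have hPv : c₁ * v ≤ (freqMeasure d₁ d₂ P).toReal := by
    rw [hP, toReal_freqMeasure_box (fun i => by linarith [ha i]) fun j => by linarith [hb j]]
    exact hlow
  have hPΩ : freqMeasure d₁ d₂ P ≤ freqMeasure d₁ d₂ Ω := by
    rw [hΩ, freqMeasure_preimage_sub x hQm]
    exact measure_mono hPQ
  have hPfin : freqMeasure d₁ d₂ P ≠ ∞ := ne_top_of_le_ne_top hΩfin hPΩ
  have hQn : ∀ ξ ∈ Q, ‖coord ξ‖ ≤ d := fun ξ hξ => by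
    simpa only [mul_one] using norm_coord_le_of_mem_box zero_le_one ha1 hb1 hξ
  have hnorm := fun ξ (hξ : ξ ∈ Ω) => norm_coord_translate_le (hQn _ hξ)
  refine ⟨Ω, P, fun _ => symbol x, ‖coord x‖ + d, hΩm, measurable_const, fun ξ hξ => (hnorm ξ hξ).2,
    hΩfin, hPv.trans (ENNReal.toReal_mono hΩfin hPΩ), by rw [hΩr]; exact hup, ?_, hh, hT, hv, ?_, ?_,
    ?_, ?_, ?_, ?_⟩
  · refine Set.disjoint_left.2 fun ξ h1 h2 => ?_
    have := (hnorm ξ h2).1.trans (hQn ξ (hPQ h1))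
    linarith
  · intro ξ hξ
    rw [mul_comm]
    refine mul_le_mul_of_nonneg_right ?_ hT.le
    -- With η = ξ - x, |ξ|² - |x|² = 2 x·η + |η|². The hypothesis on inner products bounds the first
    -- term by 2, and |η| ≤ d bounds the second by d².
    have h1 : coord ξ = coord x + coord (ξ - x) := by rw [coord_sub]; abel
    have h2 : symbol ξ - symbol x
        = 2 * inner ℝ (coord x) (coord (ξ - x)) + ‖coord (ξ - x)‖ ^ 2 := by
      rw [symbol, symbol, h1, norm_add_sq_real]
      ring
    rw [h2]
    refine (abs_add_le _ _).trans (add_le_add ?_ ?_)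
    · rw [abs_mul, abs_two]
      linarith [hinner _ hξ]
    · rw [abs_of_nonneg (sq_nonneg _)]
      exact pow_le_pow_left₀ (norm_nonneg _) (hQn _ hξ) 2
  · intro ξ hξ
    rw [mul_comm]
    refine mul_le_mul_of_nonneg_right ?_ hT.le
    have := pow_le_pow_left₀ (norm_nonneg _) (hQn _ (hPQ hξ)) 2
    rw [symbol]
    linarith
  · intro t _ ξ _
    -- A constant ω gives one scalar phase for all frequencies, written here as its value at
    -- frequency 0.
    exact cpow_unimodular_mul _ (norm_phase (fun _ : Freq d₁ d₂ => symbol x) t 0) hpq hq (ind Ω) ξ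
  · intro ξ hξ
    obtain ⟨f, hf0, hf, hfl⟩ := pow_le_re_cpow_ind (fun j => decide (j < q)) hΩm hΩfin hPm hPfin hPQ
      (fun ξ h1 η h2 => sub_mem_box (a := a) (b := b) h1 h2)
      (x := fun j => if j < q then x else -x) (p - 1)
      (fun j _ η hη => by
        by_cases hj : j < q
        · simp only [hj, if_true] at hη
          simp [twist, hj, ind_of_mem (show η ∈ Ω from hη)]
        · simp only [hj, if_false] at hη
          have h1 : -η ∈ Ω := by
            have h2 := neg_mem_box hη
            have h3 : -η - x = -(η - -x) := by abel
            rwa [← h3] at h2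
          simp [twist, hj, ind_of_mem h1])
    rw [hf, Complex.norm_real, Real.norm_of_nonneg (hf0 ξ)]
    refine le_trans (pow_le_pow_left₀ (by positivity) hPv _) (hfl ξ ?_)
    have h1 : p - 1 + 1 = q + q := by omega
    rw [h1, Finset.sum_range_add, Finset.sum_congr rfl fun j hj => if_pos (Finset.mem_range.1 hj)]
    simpa using hξ
  · refine weightedNorm_ind_le hs hΩm (by linarith) (fun ξ hξ => ?_) hΩfin (by rw [hΩr]; exact hup)
    exact le_trans (by linarith [(hnorm ξ hξ).1]) (norm_coord_le_bracket ξ)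
  · refine le_weightedNorm_ind hs hPm (by positivity) (fun ξ hξ => ?_) hPfin hPv
    exact (bracket_le ξ).trans (by linarith [hQn ξ (hPQ hξ)])

end NLS
end

/-! ### Choice of parameters: subcritical, quadratic and balanced cases -/

noncomputable section

namespace NLS

variable {d₁ d₂ : ℕ}

lemma sqrt_rpow_of_pos {x : ℝ} (hx : 0 < x) (y : ℝ) : √(x ^ y) = x ^ (y / 2) := by
  rw [Real.sqrt_eq_rpow, ← Real.rpow_mul hx.le]
  congr 1
  ring

/-- Norm inflation from data supported on boxes of size `N^α` at frequency `N`. -/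
lemma normInflation_of_boxes (hd : 1 ≤ d₁ + d₂) {p q : ℕ} (hp : 2 ≤ p) (hq : q ≤ p) {ν : ℂ}
    (hν : ν ≠ 0) {s α θ τ : ℝ} (hs : s ≤ 0) (hα0 : 0 ≤ α) (hα1 : α < 1) (hτ : 2 < τ)
    (hsmall : -τ + (p - 1 : ℕ) * (θ + α * (d₁ + d₂ : ℕ)) < 0)
    (hγ : θ + (s + α * (d₁ + d₂ : ℕ) / 2) < 0)
    (hlarge : 0 < -τ + θ + (p - 1 : ℕ) * (θ + α * (d₁ + d₂ : ℕ)) +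
      (α * s + α * (d₁ + d₂ : ℕ) / 2)) :
    NormInflation d₁ d₂ p q ν s := by
  set d : ℕ := d₁ + d₂ with hd_def
  set C : ℝ := 9 + (1 / 2) ^ s * √(4 * 3 ^ d)
  refine normInflation_of_rpow (c₁ := (1 / 2) ^ d) (c₂ := 4 * 3 ^ d) (C := C)
    (c := (1 + d : ℝ) ^ s * √((1 / 2) ^ d)) (ρ := 2 - τ) hp hq hν
    (by positivity) (by positivity) (by positivity) ?_ (by linarith) (by linarith) hsmall hγ hlarge
  -- Since α < 1, boxes of size N^α are eventually small compared with N, as the separation of Ω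
  -- from P requires.
  have h1 : ∀ᶠ n : ℕ in atTop, (n : ℝ) ^ (α - 1) < 1 / (4 * d) :=
    (tendsto_natCast_rpow_zero (by linarith : α - 1 < 0)).eventually_lt_const (by positivity)
  filter_upwards [h1, eventually_ge_atTop 1] with n h1 hn
  have hn1 : (1 : ℝ) ≤ n := by exact_mod_cast hn
  have hn0 : (0 : ℝ) < n := by linarith
  have hd0 : (0 : ℝ) < d := by exact_mod_cast hd
  set A : ℝ := (n : ℝ) ^ α with hA_def
  have hA : 1 ≤ A := Real.one_le_rpow hn1 hα0
  have hA0 : 0 < A := by linarith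
  have hAd : A ^ d = (n : ℝ) ^ (α * d) := by
    rw [hA_def, ← Real.rpow_natCast, ← Real.rpow_mul hn0.le]
  have hAN : 4 * ((d : ℝ) * A) ≤ n := by
    rw [Real.rpow_sub hn0, Real.rpow_one, div_lt_div_iff₀ hn0 (by positivity)] at h1
    linarith
  have hP : ∀ ξ ∈ (box (fun _ => A / 2) fun _ => A / 2 : Set (Freq d₁ d₂)),
      bracket ξ ≤ (1 + d) * A := fun ξ hξ => by
    have h2 := norm_coord_le_of_mem_box hA0.le (fun _ => by linarith) (fun _ => by linarith) hξ
    exact (bracket_le ξ).trans (by linarith)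
  have hfin : freqMeasure d₁ d₂ (box (fun _ => A / 2) fun _ => A / 2) ≠ ∞ := by
    rw [freqMeasure_box (fun _ => by positivity) fun _ => by positivity]
    exact ENNReal.ofReal_ne_top
  have hE := le_weightedNorm_ind (m := (A / 2) ^ d) hs (measurableSet_box (fun _ => A / 2) fun _ => A / 2)
    (by positivity) hP hfin (by
      rw [toReal_freqMeasure_box (fun _ => by positivity) fun _ => by positivity]
      exact le_boxVolume_const (by positivity))
  have hdata := inflationData_boxes (q := q) hp hd hs (Real.rpow_pos_of_pos hn0 θ)
    (Real.rpow_pos_of_pos hn0 (-τ)) hA hAN hE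
  rw [← hd_def, hAd] at hdata
  refine hdata.mono ?_ ?_ (le_of_eq ?_)
  · have h3 : (n : ℝ) ^ 2 * (n : ℝ) ^ (-τ) = (n : ℝ) ^ (2 - τ) := by
      rw [sub_eq_add_neg, Real.rpow_add hn0, Real.rpow_two]
    rw [mul_assoc, h3]
    gcongr
    exact le_add_of_nonneg_right (by positivity)
  · rw [Real.sqrt_mul (by positivity), sqrt_rpow_of_pos hn0, Real.rpow_add hn0,
      div_eq_mul_one_div, Real.mul_rpow hn0.le (by norm_num)]
    calc (n : ℝ) ^ s * (1 / 2) ^ s * (√(4 * 3 ^ d) * (n : ℝ) ^ (α * d / 2))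
        = ((1 / 2) ^ s * √(4 * 3 ^ d)) * ((n : ℝ) ^ s * (n : ℝ) ^ (α * d / 2)) := by ring
      _ ≤ _ := by
          gcongr
          exact le_add_of_nonneg_left (by norm_num)
  · rw [div_eq_mul_one_div A, mul_pow, hAd, Real.sqrt_mul (by positivity), sqrt_rpow_of_pos hn0,
      Real.mul_rpow (by positivity) hA0.le, hA_def, ← Real.rpow_mul hn0.le, Real.rpow_add hn0]
    ring

/-- With α = 1 - ε, θ is chosen so that the data have size N^(sε/4), and τ so that T (h v)^(p-1) =
N^(sε/4). The output is then N^(-sε/2). The condition τ > 2 becomes `gap` > Bε + sε/4, where `gap` >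
0 is exactly s < s_c; hence ε is taken with Bε < `gap`. -/
lemma normInflation_of_lt_criticalExponent (hd : 1 ≤ d₁ + d₂) {p q : ℕ} (hp : 2 ≤ p) (hq : q ≤ p)
    {ν : ℂ} (hν : ν ≠ 0) {s : ℝ} (hs : s < min (criticalExponent (d₁ + d₂) p) 0) :
    NormInflation d₁ d₂ p q ν s := by
  obtain ⟨hsc, hs0⟩ := lt_min_iff.1 hs
  set k : ℝ := ((p - 1 : ℕ) : ℝ) with hk_def
  have hk : k = p - 1 := by rw [hk_def, Nat.cast_sub (by omega), Nat.cast_one]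
  have hk1 : 1 ≤ k := by
    rw [hk_def]
    exact_mod_cast (by omega : 1 ≤ p - 1)
  set d : ℝ := ((d₁ + d₂ : ℕ) : ℝ) with hd_def
  have hd1 : 1 ≤ d := by
    rw [hd_def]
    exact_mod_cast hd
  rw [criticalExponent, ← hk, ← hd_def] at hsc
  have hgap : 0 < k * (d / 2 - s) - 2 := by
    have : 2 / k < d / 2 - s := by linarith
    rw [div_lt_iff₀ (by linarith)] at this
    linarith
  set gap := k * (d / 2 - s) - 2 with hgap_def
  set B := k * (-s / 4 + d / 2) with hB_def
  have hB : 0 < B := mul_pos (by linarith) (by linarith)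
  obtain ⟨ε, hε0, hε1, hεB⟩ : ∃ ε, 0 < ε ∧ ε < 1 ∧ B * ε < gap := by
    refine ⟨min (1 / 2) (gap / (2 * B)), lt_min (by norm_num) (by positivity),
      (min_le_left _ _).trans_lt (by norm_num), ?_⟩
    calc B * min (1 / 2) (gap / (2 * B)) ≤ B * (gap / (2 * B)) := by
          gcongr
          exact min_le_right _ _
      _ = gap / 2 := by field_simp
      _ < gap := by linarith
  have hsε : s * ε < 0 := mul_neg_of_neg_of_pos hs0 hε0
  have hkd : 0 < k * d := by positivity
  refine normInflation_of_boxes (α := 1 - ε) (θ := s * ε / 4 - s - (1 - ε) * d / 2)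
    (τ := -s * ε / 4 + k * (s * ε / 4 - s - (1 - ε) * d / 2 + (1 - ε) * d)) hd hp hq hν hs0.le
    (by linarith) (by linarith) ?_ ?_ ?_ ?_
  · have : -s * ε / 4 + k * (s * ε / 4 - s - (1 - ε) * d / 2 + (1 - ε) * d)
        = 2 + gap - B * ε - s * ε / 4 := by
      rw [hgap_def, hB_def]
      ring
    rw [this]
    linarith
  · linarith
  · linarith
  · rw [← hk_def, ← hd_def]
    linarith

/-- Unit boxes with h = N^m, T = N^(-1-m) and 1 < m < -s: T h v = N^(-1), the data have size
N^(m+s), and the output is N^(m-1). -/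
lemma normInflation_of_lt_neg_one (hd : d₁ + d₂ = 1) {q : ℕ} (hq : q ≤ 2) {ν : ℂ} (hν : ν ≠ 0)
    {s : ℝ} (hs : s < -1) : NormInflation d₁ d₂ 2 q ν s := by
  obtain ⟨m, hm1, hm⟩ := exists_between (by linarith : 1 < -s)
  refine normInflation_of_boxes (α := 0) (θ := m) (τ := 1 + m) (by omega) le_rfl hq hν
    (by linarith) le_rfl one_pos (by linarith) ?_ ?_ ?_
  · norm_num
  · norm_num
    linarith
  · norm_num
    linarith

lemma inner_single_left (i : Fin d₁) (x : ℝ) (η : Freq d₁ d₂) :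
    inner ℝ (coord ((EuclideanSpace.single i x, 0) : Freq d₁ d₂)) (coord η) = x * η.1 i := by
  rw [coord_single_left, EuclideanSpace.inner_single_left]
  simp [coord_inl]

lemma inner_single_right (j : Fin d₂) (n : ℤ) (η : Freq d₁ d₂) :
    inner ℝ (coord ((0, Pi.single j n) : Freq d₁ d₂)) (coord η) = n * η.2 j := by
  rw [coord_single_right, EuclideanSpace.inner_single_left]
  simp [coord_inr]

/-- The box has width 1/N along its centre, so v = 1/N and |ξ|² varies by O(1). With h = N^m and T =
N^(3/4-m), T h v = N^(-1/4), the data have size N^(m+s-1/2) and the output is N^(m-3/4). An m with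
3/4 < m < 1/2 - s exists exactly when s < -1/4. -/
lemma normInflation_of_lt_neg_quarter {d : ℕ} (hd : 1 ≤ d) {ν : ℂ} (hν : ν ≠ 0) {s : ℝ}
    (hs : s < -1 / 4) : NormInflation d 0 2 1 ν s := by
  obtain ⟨m, hm1, hm⟩ := exists_between (by linarith : 3 / 4 < 1 / 2 - s)
  set i₀ : Fin d := ⟨0, hd⟩
  set C : ℝ := (2 + (d : ℝ) ^ 2) + (1 / 2) ^ s * √(2 ^ d)
  refine normInflation_of_rpow (c₁ := 1) (c₂ := 2 ^ d) (C := C) (c := (1 + d : ℝ) ^ s)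
    (θ := m) (τ := m - 3 / 4) (β := -1) (ρ := -(m - 3 / 4)) (γ := s - 1 / 2) (η := -1 / 2)
    le_rfl one_le_two hν one_pos (by positivity) (by positivity) ?_ (by linarith) (by linarith)
    (by norm_num; linarith) (by linarith) (by norm_num; linarith)
  filter_upwards [eventually_gt_atTop (2 * d)] with n hn
  have hn0' : 0 < n := by omega
  have hn0 : (0 : ℝ) < n := by exact_mod_cast hn0'
  have hn1 : (1 : ℝ) ≤ n := by exact_mod_cast hn0'
  have hinv : (n : ℝ) ^ (-1 : ℝ) = 1 / n := by rw [Real.rpow_neg_one, one_div]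
  set a : Fin d → ℝ := Function.update 1 i₀ (1 / n) with ha_def
  have hprod : ∀ c : ℝ, ∏ i, c * a i = c ^ d * (1 / n) := fun c => by
    rw [Finset.prod_mul_distrib, ha_def, Finset.prod_update_of_mem (Finset.mem_univ _)]
    simp
  have ha : ∀ i, 0 ≤ a i ∧ a i ≤ 1 := fun i => by
    by_cases hi : i = i₀
    · rw [hi, ha_def, Function.update_self, div_le_one hn0]
      exact ⟨by positivity, hn1⟩
    · simp [ha_def, hi]
  have hsqrt : √((n : ℝ) ^ (-1 : ℝ)) = (n : ℝ) ^ (-1 / 2 : ℝ) := by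
    rw [sqrt_rpow_of_pos hn0]
  have hdata := inflationData_box (d₁ := d) (d₂ := 0) (p := 2) (q := 1) (s := s)
    (h := (n : ℝ) ^ m) (T := (n : ℝ) ^ (-(m - 3 / 4))) (v := (n : ℝ) ^ (-1 : ℝ)) (c₁ := 1)
    (c₂ := 2 ^ d) (N := n) (x := (EuclideanSpace.single i₀ (n : ℝ), 0)) (a := a)
    (b := fun _ => 0) rfl le_rfl (by linarith)
    (by positivity) (by positivity) (by positivity) zero_le_one (fun i => (ha i).1)
    (fun _ => le_rfl) (fun i => (ha i).2) (fun _ => zero_le_one)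
    (by rw [coord_single_left]; simp) (by rw [add_zero]; exact_mod_cast hn)
    (fun η hη => by
      rw [inner_single_left, abs_mul, Nat.abs_cast]
      have h1 := hη.1 i₀
      rw [ha_def, Function.update_self, le_div_iff₀ hn0] at h1
      linarith)
    (by
      rw [boxVolume, hinv]
      simp only [mul_div_cancel₀ _ (two_ne_zero' ℝ), Finset.univ_eq_empty, Finset.prod_empty]
      have := hprod 1
      simp only [one_mul, one_pow] at this
      rw [this]
      simp)
    (by
      rw [boxVolume, hinv, hprod]
      simp)
  simp only [add_zero] at hdata
  refine hdata.mono ?_ ?_ (le_of_eq ?_)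
  · gcongr
    exact le_add_of_nonneg_right (by positivity)
  · rw [Real.sqrt_mul (by positivity), hsqrt, div_eq_mul_one_div (n : ℝ),
      Real.mul_rpow hn0.le (by norm_num), sub_eq_add_neg s, Real.rpow_add hn0]
    calc (n : ℝ) ^ s * (1 / 2) ^ s * (√(2 ^ d) * (n : ℝ) ^ (-1 / 2 : ℝ))
        = ((1 / 2) ^ s * √(2 ^ d)) * ((n : ℝ) ^ s * (n : ℝ) ^ (-(1 / 2) : ℝ)) := by
          rw [neg_div]
          ring
      _ ≤ _ := by
          gcongr
          exact le_add_of_nonneg_left (by positivity)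
  · rw [one_mul, hsqrt]

/-- Norm inflation from data which remain of unit size. -/
lemma normInflation_of_neg {p q : ℕ} (hp : 2 ≤ p) (hq : q ≤ p) {ν : ℂ} (hν : ν ≠ 0) {s c₁ c₂ C c : ℝ}
    (hs : s < 0) (hc₁ : 0 < c₁) (hc₂ : 0 < c₂) (hc : 0 < c)
    (hdata : ∀ h T : ℕ → ℝ, (∀ n, 0 < n → 0 < h n) → (∀ n, 0 < n → 0 < T n) →
      ∀ᶠ n : ℕ in atTop, InflationData d₁ d₂ p q s c₁ c₂ (h n) (T n) 1 (C * T n)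
        (C * (n : ℝ) ^ s) c) :
    NormInflation d₁ d₂ p q ν s := by
  set k : ℝ := ((p - 1 : ℕ) : ℝ) with hk
  have hk0 : 0 ≤ k := Nat.cast_nonneg _
  have hsk : s * k ≤ 0 := mul_nonpos_of_nonpos_of_nonneg hs.le hk0
  -- With h = N^(-s/2) and T = h^(-(k+1/2)), the data have size N^(s/2), T h^k = N^(s/4), and the
  -- output T h^(k+1) = N^(-s/4).
  have h1 := hdata (fun n => (n : ℝ) ^ (-s / 2)) (fun n => (n : ℝ) ^ (-((k + 1 / 2) * (-s / 2))))
    (fun n hn => Real.rpow_pos_of_pos (Nat.cast_pos.2 hn) _)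
    (fun n hn => Real.rpow_pos_of_pos (Nat.cast_pos.2 hn) _)
  refine normInflation_of_rpow (C := C) (c := c) (θ := -s / 2) (τ := (k + 1 / 2) * (-s / 2)) (β := 0)
    (ρ := -((k + 1 / 2) * (-s / 2))) (γ := s) (η := 0) hp hq hν hc₁ hc₂ hc ?_ ?_ ?_ ?_ ?_ ?_
  · simpa only [Real.rpow_zero, mul_one] using h1
  all_goals (try rw [← hk]); nlinarith

/-- The centre lies on a periodic axis, and half-width 0 in the periodic variables leaves a single
integer point there. All offsets are orthogonal to the centre, so Ω keeps unit measure as N grows,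
unlike the thin boxes needed on ℝ^d. -/
lemma normInflation_of_balanced (hd₂ : 1 ≤ d₂) {p q : ℕ} (hpq : p = 2 * q) (hq : 1 ≤ q) {ν : ℂ}
    (hν : ν ≠ 0) {s : ℝ} (hs : s < 0) : NormInflation d₁ d₂ p q ν s := by
  set d := d₁ + d₂ with hd
  set j₀ : Fin d₂ := ⟨0, hd₂⟩
  set C : ℝ := (2 + (d : ℝ) ^ 2) + (1 / 2) ^ s * √(2 ^ d₁)
  refine normInflation_of_neg (c₁ := 1) (c₂ := 2 ^ d₁) (C := C) (c := (1 + d : ℝ) ^ s)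
    (by omega) (by omega) hν hs one_pos (by positivity) (by positivity) fun h T hh hT => ?_
  filter_upwards [eventually_gt_atTop (2 * d)] with n hn
  have hn0' : 0 < n := by omega
  have hn0 : (0 : ℝ) < n := by exact_mod_cast hn0'
  have hT0 := hT n hn0'
  have hdata := inflationData_box (p := p) (q := q) (s := s) (h := h n) (T := T n) (v := 1)
    (c₁ := 1) (c₂ := 2 ^ d₁) (N := n) (x := ((0, Pi.single j₀ (n : ℤ)) : Freq d₁ d₂))
    (a := fun _ => 1) (b := fun _ => 0) hpq hq hs.le (hh n hn0') hT0 one_pos zero_le_one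
    (fun _ => zero_le_one) (fun _ => le_rfl) (fun _ => le_rfl) (fun _ => zero_le_one)
    (by rw [coord_single_right]; simp) (by exact_mod_cast hn)
    (fun η hη => by
      have h1 := hη.2 j₀
      rw [abs_nonpos_iff] at h1
      rw [inner_single_right, h1]
      simp)
    (by simp [boxVolume]) (by simp [boxVolume])
  simp only [mul_one, Real.sqrt_one, ← hd] at hdata
  refine hdata.mono ?_ ?_ le_rfl
  · gcongr
    exact le_add_of_nonneg_right (by positivity)
  · rw [div_eq_mul_one_div (n : ℝ), Real.mul_rpow hn0.le (by norm_num)]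
    calc (n : ℝ) ^ s * (1 / 2) ^ s * √(2 ^ d₁) = ((1 / 2) ^ s * √(2 ^ d₁)) * (n : ℝ) ^ s := by ring
      _ ≤ _ := by
          gcongr
          exact le_add_of_nonneg_left (by positivity)

end NLS
end

/-! ### The critical exponent s = -d/2 -/

noncomputable section

namespace NLS

section Critical

variable {d₁ d₂ : ℕ}

/-- The dyadic cube `[2^j, 2^(j+1))^d`. -/
def dyadicCube (d₁ d₂ j : ℕ) : Set (Freq d₁ d₂) :=
  ((MeasurableEquiv.toLp 2 (Fin d₁ → ℝ)).symm ⁻¹' Set.pi Set.univ fun _ =>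
      Set.Ico (2 ^ j : ℝ) (2 ^ (j + 1))) ×ˢ
    (Set.pi Set.univ fun _ => Set.Ico (2 ^ j : ℤ) (2 ^ (j + 1)))

lemma measurableSet_dyadicCube (j : ℕ) : MeasurableSet (dyadicCube d₁ d₂ j) :=
  ((MeasurableSet.univ_pi fun _ => measurableSet_Ico).preimage
    (MeasurableEquiv.measurable _)).prod MeasurableSet.of_discrete

lemma mem_dyadicCube {j : ℕ} {ξ : Freq d₁ d₂} (h : ξ ∈ dyadicCube d₁ d₂ j) (i : Fin d₁ ⊕ Fin d₂) :
    (2 : ℝ) ^ j ≤ coord ξ i ∧ coord ξ i < 2 ^ (j + 1) := by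
  rcases i with i | i
  · exact h.1 i (Set.mem_univ i)
  · have := h.2 i (Set.mem_univ i)
    rw [coord_inr]
    have h2 : ((ξ.2 i : ℤ) : ℝ) < ((2 ^ (j + 1) : ℤ) : ℝ) := Int.cast_lt.2 this.2
    exact ⟨by exact_mod_cast this.1, by simpa using h2⟩

lemma freqMeasure_dyadicCube (j : ℕ) :
    freqMeasure d₁ d₂ (dyadicCube d₁ d₂ j) = ENNReal.ofReal ((2 ^ j) ^ (d₁ + d₂)) := by
  have h1 : volume (Set.Ico (2 ^ j : ℝ) (2 ^ (j + 1))) = ENNReal.ofReal (2 ^ j) := by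
    rw [Real.volume_Ico]
    congr 1
    ring
  have h2 : Measure.count (Set.Ico (2 ^ j : ℤ) (2 ^ (j + 1))) = ENNReal.ofReal (2 ^ j) := by
    rw [← Finset.coe_Ico, Measure.count_apply_finset, Int.card_Ico]
    have : ((2 : ℤ) ^ (j + 1) - 2 ^ j).toNat = 2 ^ j := by
      rw [pow_succ, mul_two, add_sub_cancel_right]
      exact_mod_cast Int.toNat_natCast (2 ^ j)
    rw [this, ← ENNReal.ofReal_natCast]
    push_cast
    rfl
  rw [dyadicCube, freqMeasure_prod_pi _ _ fun _ => measurableSet_Ico]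
  simp only [h1, h2, Finset.prod_const, Finset.card_univ, Fintype.card_fin]
  rw [← pow_add, ← ENNReal.ofReal_pow (by positivity)]

lemma dyadicCube_subset_box {j n : ℕ} (hj : j < n) :
    dyadicCube d₁ d₂ j ⊆ box (fun _ => 2 ^ n) fun _ => 2 ^ n := by
  have key : ∀ ξ ∈ dyadicCube d₁ d₂ j, ∀ i, |coord ξ i| ≤ 2 ^ n := fun ξ hξ i => by
    obtain ⟨h1, h2⟩ := mem_dyadicCube hξ i
    rw [abs_of_nonneg (le_trans (by positivity) h1)]
    exact h2.le.trans (pow_le_pow_right₀ one_le_two hj)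
  exact fun ξ hξ => ⟨fun i => key ξ hξ (Sum.inl i), fun i => key ξ hξ (Sum.inr i)⟩

lemma disjoint_dyadicCube (hd : 1 ≤ d₁ + d₂) {i j : ℕ} (hij : i ≠ j) :
    Disjoint (dyadicCube d₁ d₂ i) (dyadicCube d₁ d₂ j) := by
  wlog h : i < j generalizing i j
  · exact (this hij.symm (by omega)).symm
  have : Nonempty (Fin d₁ ⊕ Fin d₂) := Fintype.card_pos_iff.1 (by simpa using by omega)
  obtain ⟨l⟩ := this
  refine Set.disjoint_left.2 fun ξ h1 h2 => ?_
  have h3 := (mem_dyadicCube h1 l).2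
  have h4 := (mem_dyadicCube h2 l).1
  have h5 : (2 : ℝ) ^ (i + 1) ≤ 2 ^ j := pow_le_pow_right₀ one_le_two h
  linarith

lemma bracket_le_of_mem_dyadicCube (hd : 1 ≤ d₁ + d₂) {j : ℕ} {ξ : Freq d₁ d₂}
    (h : ξ ∈ dyadicCube d₁ d₂ j) : bracket ξ ≤ 3 * (d₁ + d₂ : ℕ) * 2 ^ j := by
  have h1 := norm_coord_le_of_mem_box (by positivity) (fun _ => le_rfl) (fun _ => le_rfl)
    (dyadicCube_subset_box j.lt_succ_self h)
  have h2 : (1 : ℝ) ≤ (d₁ + d₂ : ℕ) * 2 ^ j :=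
    one_le_mul_of_one_le_of_one_le (by exact_mod_cast hd) (one_le_pow₀ one_le_two)
  refine (bracket_le ξ).trans ?_
  rw [pow_succ] at h1
  linarith

/-- At the exponent `-d/2`, the dyadic shells contribute equally to the norm of the indicator
function of a large box. -/
lemma le_weightedNorm_ind_box (hd : 1 ≤ d₁ + d₂) {s : ℝ} (hs : s = -((d₁ + d₂ : ℕ) : ℝ) / 2)
    (n : ℕ) :
    ENNReal.ofReal (√((3 * (d₁ + d₂ : ℕ)) ^ (2 * s)) * √n) ≤
      weightedNorm s (ind (box (fun _ : Fin d₁ => 2 ^ n) fun _ : Fin d₂ => 2 ^ n)) := by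
  set d : ℝ := ((d₁ + d₂ : ℕ) : ℝ) with hd_def
  have hd0 : 0 < d := by
    rw [hd_def]
    exact_mod_cast hd
  set P : Set (Freq d₁ d₂) := box (fun _ : Fin d₁ => 2 ^ n) fun _ : Fin d₂ => 2 ^ n
  set μ := freqMeasure d₁ d₂
  have h1 : weightedNorm s (ind P) = (∫⁻ ξ, ‖P.indicator (fun ξ => bracket ξ ^ s) ξ‖ₑ ^ (2 : ℝ) ∂μ) ^
      (1 / 2 : ℝ) := by
    rw [weightedNorm_ind_eq, eLpNorm_eq_lintegral_rpow_enorm_toReal (by simp) (by simp)]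
    simp [μ]
  -- The cube has measure 2^(jd) and squared weight of order 2^(2js) = 2^(-jd); the powers of 2
  -- cancel, so each of the n cubes contributes the same constant.
  have h2 : ∀ j ∈ Finset.range n, ENNReal.ofReal ((3 * d) ^ (2 * s)) ≤
      ∫⁻ ξ in dyadicCube d₁ d₂ j, ‖P.indicator (fun ξ => bracket ξ ^ s) ξ‖ₑ ^ (2 : ℝ) ∂μ := by
    intro j hj
    calc ENNReal.ofReal ((3 * d) ^ (2 * s))
        = ∫⁻ ξ in dyadicCube d₁ d₂ j, ENNReal.ofReal ((3 * d * 2 ^ j) ^ (2 * s)) ∂μ := by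
          rw [setLIntegral_const, freqMeasure_dyadicCube, ← ENNReal.ofReal_mul (by positivity),
            Real.mul_rpow (x := 3 * d) (by positivity) (by positivity),
            mul_assoc ((3 * d) ^ (2 * s))]
          congr 1
          have : (2 * s : ℝ) = -d := by rw [hs]; ring
          rw [this, Real.rpow_neg (by positivity : (0 : ℝ) ≤ 2 ^ j), hd_def, Real.rpow_natCast,
            inv_mul_cancel₀ (by positivity), mul_one]
      _ ≤ _ := by
          refine setLIntegral_mono' (measurableSet_dyadicCube j) fun ξ hξ => ?_
          rw [Set.indicator_of_mem (dyadicCube_subset_box (Finset.mem_range.1 hj) hξ),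
            ← ofReal_norm, Real.norm_of_nonneg (Real.rpow_nonneg (bracket_pos ξ).le s),
            ENNReal.ofReal_rpow_of_nonneg (Real.rpow_nonneg (bracket_pos ξ).le s) zero_le_two,
            ← Real.rpow_mul (bracket_pos ξ).le, mul_comm s 2]
          refine ENNReal.ofReal_le_ofReal (Real.rpow_le_rpow_of_nonpos (bracket_pos ξ)
            (bracket_le_of_mem_dyadicCube hd hξ) ?_)
          rw [hs]
          linarith
  have h3 : ENNReal.ofReal ((3 * d) ^ (2 * s) * n) ≤
      ∫⁻ ξ, ‖P.indicator (fun ξ => bracket ξ ^ s) ξ‖ₑ ^ (2 : ℝ) ∂μ := by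
    calc ENNReal.ofReal ((3 * d) ^ (2 * s) * n)
        = ∑ _j ∈ Finset.range n, ENNReal.ofReal ((3 * d) ^ (2 * s)) := by
          rw [Finset.sum_const, Finset.card_range, nsmul_eq_mul, mul_comm,
            ENNReal.ofReal_mul (by positivity), ENNReal.ofReal_natCast]
      _ ≤ ∑ j ∈ Finset.range n, ∫⁻ ξ in dyadicCube d₁ d₂ j,
            ‖P.indicator (fun ξ => bracket ξ ^ s) ξ‖ₑ ^ (2 : ℝ) ∂μ := Finset.sum_le_sum h2
      _ = ∫⁻ ξ in ⋃ j ∈ Finset.range n, dyadicCube d₁ d₂ j,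
            ‖P.indicator (fun ξ => bracket ξ ^ s) ξ‖ₑ ^ (2 : ℝ) ∂μ :=
          (lintegral_biUnion_finset (fun i _ j _ hij => disjoint_dyadicCube hd hij)
            (fun j _ => measurableSet_dyadicCube j) _).symm
      _ ≤ _ := setLIntegral_le_lintegral _ _
  rw [h1, ← Real.sqrt_mul (by positivity), Real.sqrt_eq_rpow,
    ← ENNReal.ofReal_rpow_of_nonneg (by positivity) (by norm_num)]
  gcongr

/-- Box size A = 2^(n+1) and frequency N = 4dA are comparable, so every power of N cancels, thanks
to d(p-1) = 2 and s = -d/2. What remains are the factors n^(-1/16) inserted in h and T, against the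
logarithmic gain √n in the norm of the low-frequency box. -/
lemma normInflation_critical (hd : 1 ≤ d₁ + d₂) {p q : ℕ} (hp : 2 ≤ p) (hq : q ≤ p)
    (hdp : (d₁ + d₂) * (p - 1) = 2) (hp3 : p ≤ 3) {ν : ℂ} (hν : ν ≠ 0) {s : ℝ}
    (hs : s = -((d₁ + d₂ : ℕ) : ℝ) / 2) : NormInflation d₁ d₂ p q ν s := by
  set d : ℕ := d₁ + d₂ with hd_def
  have hd0 : (0 : ℝ) < d := by exact_mod_cast hd
  set A : ℕ → ℝ := fun n => 2 ^ (n + 1) with hA_def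
  have hA : ∀ n, 1 ≤ A n := fun n => one_le_pow₀ one_le_two
  have hA0 : ∀ n, 0 < A n := fun n => one_pos.trans_le (hA n)
  set N : ℕ → ℕ := fun n => 4 * d * 2 ^ (n + 1) with hN_def
  have hN : ∀ n, (N n : ℝ) = 4 * (d * A n) := fun n => by
    simp only [hN_def, hA_def]
    push_cast
    ring
  have hN0 : ∀ n, (0 : ℝ) < N n := fun n => by
    rw [hN]
    have := hA0 n
    positivity
  set h : ℕ → ℝ := fun n => (n : ℝ) ^ (-1 / 16 : ℝ) with hh_def
  set T : ℕ → ℝ := fun n => ((N n : ℝ) ^ 2)⁻¹ * (n : ℝ) ^ (-1 / 16 : ℝ) with hT_def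
  set b : ℝ := √((3 * (d₁ + d₂ : ℕ)) ^ (2 * s)) with hb_def
  have hb : 0 < b := by positivity
  set C : ℝ := (2 * d) ^ s * √(4 * 3 ^ d)
  have hhv : ∀ n, (h n * A n ^ d) ^ (p - 1) = ((n : ℝ) ^ (-1 / 16 : ℝ)) ^ (p - 1) * A n ^ 2 := by
    intro n
    rw [mul_pow, ← pow_mul, hdp]
  have hThv : ∀ n, T n * (h n * A n ^ d) ^ (p - 1) =
      (1 / (4 * d)) ^ 2 * ((n : ℝ) ^ (-1 / 16 : ℝ) * ((n : ℝ) ^ (-1 / 16 : ℝ)) ^ (p - 1)) := by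
    intro n
    have := (hA0 n).ne'
    rw [hhv]
    simp only [hT_def, hN]
    field_simp
  have ht : Tendsto (fun n : ℕ => (n : ℝ) ^ (-1 / 16 : ℝ)) atTop (𝓝 0) :=
    tendsto_natCast_rpow_zero (by norm_num)
  have hp1 : p - 1 ≠ 0 := by omega
  refine normInflation_of_inflationData (c₁ := (1 / 2) ^ d) (c₂ := 4 * 3 ^ d) (h := h) (T := T)
    (v := fun n => A n ^ d) (e := fun n => 9 * (n : ℝ) ^ (-1 / 16 : ℝ))
    (D := fun n => C * (A n ^ s * √(A n ^ d))) (E := fun n => b * √n) hp hq hν (by positivity)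
    (by positivity) ?_ ?_ ?_ ?_ ?_ ?_
  · filter_upwards [eventually_gt_atTop 0] with n hn
    have hn0 : (0 : ℝ) < n := by exact_mod_cast hn
    have hA0n := hA0 n
    have hN0n := hN0 n
    have hE := le_weightedNorm_ind_box hd hs n
    have hhalf : A n / 2 = 2 ^ n := by
      simp only [hA_def, pow_succ]
      ring
    have hdata := inflationData_boxes (q := q) (s := s) (h := h n) (T := T n) (A := A n) (N := N n) hp hd
      (by rw [hs]; linarith) (by positivity) (by positivity) (hA n) (hN n).ge
      (by rw [hhalf]; exact hE)
    refine hdata.mono (le_of_eq ?_) (le_of_eq ?_) le_rfl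
    · simp only [hT_def]
      field_simp
    · have h1 : (N n : ℝ) / 2 = 2 * d * A n := by rw [hN]; ring
      rw [h1, Real.mul_rpow (by positivity) hA0n.le, Real.sqrt_mul (by positivity)]
      ring
  · refine squeeze_zero (fun n => ?_) (fun n => ?_) ht
    · have := hN0 n
      positivity
    · refine mul_le_of_le_one_left (by positivity) (inv_le_one_of_one_le₀ (one_le_pow₀ ?_))
      have : 1 ≤ (d : ℝ) * A n := one_le_mul_of_one_le_of_one_le (by exact_mod_cast hd) (hA n)
      rw [hN]
      linarith
  · simpa using ht.const_mul 9
  · simp only [hThv]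
    have := (ht.mul (ht.pow (p - 1))).const_mul ((1 / (4 * (d : ℝ))) ^ 2)
    simpa [hp1] using this
  · have h2 : ∀ n, A n ^ s * √(A n ^ d) = 1 := by
      intro n
      rw [← Real.rpow_natCast, sqrt_rpow_of_pos (hA0 n), ← Real.rpow_add (hA0 n), hs]
      convert Real.rpow_zero _ using 2
      ring
    simp only [h2, mul_one]
    simpa using ht.mul_const C
  -- One factor n^(-1/16) comes from T and p from h. Since p ≤ 3 there are at most four, and the
  -- exponent is at least 1/2 - 4/16 = 1/4.
  · have hexp : (0 : ℝ) < -1 / 16 + -1 / 16 + (-1 / 16) * (p - 1 : ℕ) + 1 / 2 := by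
      have : ((p - 1 : ℕ) : ℝ) ≤ 2 := by exact_mod_cast (by omega : p - 1 ≤ 2)
      linarith
    refine ((tendsto_natCast_rpow_atTop hexp).const_mul_atTop
      (by positivity : 0 < (1 / (4 * (d : ℝ))) ^ 2 * b)).congr' ?_
    filter_upwards [eventually_gt_atTop 0] with n hn
    have hn0 : (0 : ℝ) < n := by exact_mod_cast hn
    rw [Real.rpow_add hn0, Real.rpow_add hn0, Real.rpow_add hn0, Real.rpow_mul hn0.le,
      Real.rpow_natCast, ← Real.sqrt_eq_rpow]
    calc _ = h n * ((1 / (4 * d)) ^ 2 *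
          ((n : ℝ) ^ (-1 / 16 : ℝ) * ((n : ℝ) ^ (-1 / 16 : ℝ)) ^ (p - 1))) * (b * √n) := by ring
      _ = h n * (T n * (h n * A n ^ d) ^ (p - 1)) * (b * √n) := by rw [hThv]
      _ = _ := by ring

end Critical
end NLS
end

/-! ### Quartic nonlinearities on the circle: exact resonances -/

noncomputable section

namespace NLS

section Resonant

lemma freqMeasure_singleton (ξ : Freq 0 1) : freqMeasure 0 1 {ξ} = 1 := by
  have h : ({ξ} : Set (Freq 0 1)) = ((MeasurableEquiv.toLp 2 (Fin 0 → ℝ)).symm ⁻¹'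
      Set.pi Set.univ fun _ => Set.univ) ×ˢ (Set.pi Set.univ fun j => {ξ.2 j}) := by
    ext η
    rw [Set.mem_singleton_iff, Prod.ext_iff, Set.mem_prod]
    refine and_congr (by simp [eq_iff_true_of_subsingleton]) ?_
    simp [funext_iff]
  rw [h, freqMeasure_prod_pi _ _ fun _ => MeasurableSet.univ]
  simp

lemma integral_eq_sum_of_support {F : Freq 0 1 → ℂ} (S : Finset (Freq 0 1))
    (hF : ∀ η ∉ S, F η = 0) : ∫ η, F η ∂(freqMeasure 0 1) = ∑ η ∈ S, F η := by
  rw [← setIntegral_eq_integral_of_forall_compl_eq_zero (s := (S : Set (Freq 0 1))) hF,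
    setIntegral_finset]
  · simp [measureReal_def, freqMeasure_singleton]
  · rw [← (S : Set (Freq 0 1)).biUnion_of_singleton]
    simp [integrableOn_finset_iUnion, freqMeasure_singleton]

/-- On ℤ every frequency has mass one, so convolving with a function carried by three points is a
sum of three translates. Iterating it makes the fourfold convolution an explicit finite sum. -/
lemma cpow_succ_of_support (σ : ℕ → Bool) {g : Freq 0 1 → ℂ} {x y z : Freq 0 1} (hxy : x ≠ y)
    (hxz : x ≠ z) (hyz : y ≠ z) (hg : ∀ η, η ≠ x → η ≠ y → η ≠ z → g η = 0) (k : ℕ)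
    (ξ : Freq 0 1) :
    cpow (freqMeasure 0 1) σ g (k + 1) ξ = if σ (k + 1) then
      cpow (freqMeasure 0 1) σ g k (ξ - x) * g x + cpow (freqMeasure 0 1) σ g k (ξ - y) * g y
        + cpow (freqMeasure 0 1) σ g k (ξ - z) * g z
      else cpow (freqMeasure 0 1) σ g k (ξ + x) * starRingEnd ℂ (g x)
        + cpow (freqMeasure 0 1) σ g k (ξ + y) * starRingEnd ℂ (g y)
        + cpow (freqMeasure 0 1) σ g k (ξ + z) * starRingEnd ℂ (g z) := by
  classical
  have h1 : cpow (freqMeasure 0 1) σ g (k + 1) ξ = ∫ η, cpow (freqMeasure 0 1) σ g k (ξ - η) *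
      twist (σ (k + 1)) g η ∂(freqMeasure 0 1) := by
    rw [cpow, ← integral_sub_left_eq_self _ _ ξ]
    simp only [sub_sub_cancel]
  rw [h1]
  cases σ (k + 1)
  · rw [integral_eq_sum_of_support {-x, -y, -z}]
    · rw [Finset.sum_insert (by simp [hxy, hxz]), Finset.sum_insert (by simp [hyz]),
        Finset.sum_singleton]
      simp [twist]
      ring
    · intro η hη
      simp only [Finset.mem_insert, Finset.mem_singleton, not_or, ← neg_eq_iff_eq_neg] at hη
      simp [twist, hg _ hη.1 hη.2.1 hη.2.2]
  · rw [integral_eq_sum_of_support {x, y, z}]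
    · rw [Finset.sum_insert (by simp [hxy, hxz]), Finset.sum_insert (by simp [hyz]),
        Finset.sum_singleton]
      simp [twist]
      ring
    · intro η hη
      simp only [Finset.mem_insert, Finset.mem_singleton, not_or] at hη
      simp [twist, hg _ hη.1 hη.2.1 hη.2.2]

/-- The frequency `N j`. -/
def node (N j : ℤ) : Freq 0 1 := (0, fun _ => N * j)

lemma node_add (N i j : ℤ) : node N i + node N j = node N (i + j) := by
  ext l
  · exact l.elim0
  · simp [node, mul_add]

lemma node_sub (N i j : ℤ) : node N i - node N j = node N (i - j) := by
  ext l
  · exact l.elim0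
  · simp [node, mul_sub]

lemma node_zero (N : ℤ) : node N 0 = 0 := by
  ext l
  · exact l.elim0
  · simp [node]

lemma node_inj {N : ℤ} (hN : N ≠ 0) {i j : ℤ} : node N i = node N j ↔ i = j := by
  refine ⟨fun h => ?_, fun h => h ▸ rfl⟩
  have := congr_fun (congr_arg Prod.snd h) 0
  simpa [node, hN] using this

lemma symbol_node (N j : ℤ) : symbol (node N j) = (N : ℝ) ^ 2 * (j : ℝ) ^ 2 := by
  rw [symbol, norm_coord_sq]
  simp [node]
  ring

/-- The resonant interactions between the frequencies `2N`, `-N` and `3N`. -/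
lemma cpow_resonant {N : ℤ} (hN : N ≠ 0) {u : ℂ} (hu : ‖u‖ = 1) {g : Freq 0 1 → ℂ}
    (h2 : g (node N 2) = u ^ 4) (h1 : g (node N (-1)) = u) (h3 : g (node N 3) = u ^ 9)
    (hg : ∀ η, η ≠ node N 2 → η ≠ node N (-1) → η ≠ node N 3 → g η = 0) {q : ℕ}
    (hq : q = 1 ∨ q = 3) :
    cpow (freqMeasure 0 1) (fun j => decide (j < q)) g 3 0 = 3 := by
  have hu' : u * starRingEnd ℂ u = 1 := by
    rw [Complex.mul_conj, Complex.normSq_eq_norm_sq, hu]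
    simp
  have hu9 : u ^ 9 * starRingEnd ℂ u ^ 9 = 1 := by rw [← mul_pow, hu', one_pow]
  have hval : ∀ j : ℤ, g (node N j) = if j = 2 then u ^ 4 else if j = -1 then u else
      if j = 3 then u ^ 9 else 0 := by
    intro j
    split_ifs with e1 e2 e3
    · rw [e1, h2]
    · rw [e2, h1]
    · rw [e3, h3]
    · exact hg _ (mt (node_inj hN).1 e1) (mt (node_inj hN).1 e2) (mt (node_inj hN).1 e3)
  have hstep := fun (σ : ℕ → Bool) => cpow_succ_of_support σ (mt (node_inj hN).1 (by norm_num))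
    (mt (node_inj hN).1 (by norm_num)) (mt (node_inj hN).1 (by norm_num)) hg
  have hstep₀ := fun σ => hstep σ 0
  have hstep₁ := fun σ => hstep σ 1
  have hstep₂ := fun σ => hstep σ 2
  simp only [Nat.reduceAdd] at hstep₀ hstep₁ hstep₂
  have hzero : ∀ (σ : ℕ → Bool) ξ, cpow (freqMeasure 0 1) σ g 0 ξ = twist (σ 0) g ξ :=
    fun _ _ => rfl
  rw [← node_zero N]
  -- The only way to reach frequency 0 is 2 + 2 - 1 - 3 = 0, with 3 on the side of the lone factor.
  -- The entry -1 has three possible positions, and 4 + 4 + 1 = 9 makes each contribution u^9 times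
  -- the conjugate of u^9, that is 1.
  rcases hq with rfl | rfl
  · simp only [hstep₀, hstep₁, hstep₂, hzero, node_add, node_sub, twist]
    norm_num [hval]
    linear_combination 3 * hu9
  · simp only [hstep₀, hstep₁, hstep₂, hzero, node_add, node_sub, twist]
    norm_num [hval]
    linear_combination 3 * hu9

/-- The model phase is the true symbol, so there is no phase error. With u = e^{-itN²} the three
modes carry u^4, u and u^9, and the zero mode of the nonlinearity is constant in time. -/
lemma inflationData_resonant {q : ℕ} (hq : q = 1 ∨ q = 3) {s h T : ℝ} (hs : s ≤ 0) (hh : 0 < h)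
    (hT : 0 < T) {n : ℕ} (hn : 0 < n) :
    InflationData 0 1 4 q s 1 3 h T 1 0 ((n : ℝ) ^ s * √3) 1 := by
  set N : ℤ := (n : ℤ) with hN_def
  have hn0 : (0 : ℝ) < n := by exact_mod_cast hn
  have hN : N ≠ 0 := by omega
  set Ω : Set (Freq 0 1) := {node N 2, node N (-1), node N 3} with hΩ_def
  have hΩm : MeasurableSet Ω := (Set.toFinite Ω).measurableSet
  have hle : freqMeasure 0 1 Ω ≤ ENNReal.ofReal 3 := by
    rw [hΩ_def, Set.insert_eq, Set.insert_eq]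
    calc _ ≤ (1 + (1 + 1) : ℝ≥0∞) := by
          refine (measure_union_le _ _).trans (add_le_add (freqMeasure_singleton _).le ?_)
          exact (measure_union_le _ _).trans
            (add_le_add (freqMeasure_singleton _).le (freqMeasure_singleton _).le)
      _ = ENNReal.ofReal 3 := by
          rw [ENNReal.ofReal_ofNat]
          norm_num
  have hfin : freqMeasure 0 1 Ω ≠ ∞ := ne_top_of_le_ne_top ENNReal.ofReal_ne_top hle
  have hle' : (freqMeasure 0 1 Ω).toReal ≤ 3 := ENNReal.toReal_le_of_le_ofReal (by norm_num) hle
  have hge : 1 ≤ (freqMeasure 0 1 Ω).toReal := by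
    have h1 : freqMeasure 0 1 {node N 2} ≤ freqMeasure 0 1 Ω := measure_mono (by simp [hΩ_def])
    rw [freqMeasure_singleton] at h1
    simpa using ENNReal.toReal_mono hfin h1
  have hnorm : ∀ ξ ∈ Ω, (n : ℝ) ≤ ‖coord ξ‖ ∧ ‖coord ξ‖ ≤ 3 * n := by
    have key : ∀ j : ℤ, ‖coord (node N j)‖ = n * |(j : ℝ)| := fun j => by
      have h1 := symbol_node N j
      rw [symbol, ← mul_pow, ← sq_abs ((N : ℝ) * j)] at h1
      rw [(pow_left_inj₀ (norm_nonneg _) (abs_nonneg _) two_ne_zero).1 h1, abs_mul, hN_def,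
        Int.cast_natCast, Nat.abs_cast]
    rintro ξ (rfl | rfl | rfl) <;> rw [key] <;> constructor <;> norm_num <;> linarith
  have hzero : symbol (0 : Freq 0 1) = 0 := by
    rw [← node_zero N, symbol_node]
    simp
  have hcpow : ∀ t, cpow (freqMeasure 0 1) (fun j => decide (j < q))
      (fun η => phase symbol t η * ind Ω η) 3 0 = 3 := by
    intro t
    have hph : ∀ (j : ℤ) (m : ℕ), (j : ℝ) ^ 2 = m → node N j ∈ Ω →
        phase symbol t (node N j) * ind Ω (node N j) = phase (fun _ => (N : ℝ) ^ 2) t (0 : Freq 0 1) ^ m := by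
      intro j m hj hΩ
      rw [ind_of_mem hΩ, mul_one, phase, phase, symbol_node, hj, ← Complex.exp_nat_mul]
      congr 1
      push_cast
      ring
    refine cpow_resonant hN (u := phase (fun _ => (N : ℝ) ^ 2) t (0 : Freq 0 1)) (norm_phase _ _ _)
      (hph 2 4 (by norm_num) (by simp [hΩ_def])) ?_ (hph 3 9 (by norm_num) (by simp [hΩ_def]))
      (fun η h1 h2 h3 => ?_) hq
    · rw [hph (-1) 1 (by norm_num) (by simp [hΩ_def]), pow_one]
    · rw [ind_of_notMem (by simp [hΩ_def, h1, h2, h3]), mul_zero]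
  have hind : cpow (freqMeasure 0 1) (fun j => decide (j < q)) (ind Ω) 3 0 = 3 := by
    have h1 := hcpow 0
    have h2 : (fun η => phase symbol 0 η * ind Ω η) = ind Ω := by
      funext η
      simp [phase]
    rwa [h2] at h1
  refine ⟨Ω, {0}, symbol, 3 * n, hΩm, measurable_symbol, fun ξ hξ => (hnorm ξ hξ).2, hfin,
    by simpa using hge, by simpa using hle', ?_, hh, hT, one_pos, fun ξ _ => by simp, ?_, ?_, ?_, ?_,
    ?_⟩
  · rw [Set.disjoint_singleton_left]
    intro h0
    have h1 := (hnorm 0 h0).1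
    have h2 : ‖coord (0 : Freq 0 1)‖ ^ 2 = 0 := hzero
    rw [pow_eq_zero_iff two_ne_zero] at h2
    linarith
  · rintro ξ rfl
    rw [hzero, mul_zero]
  · rintro t _ ξ rfl
    rw [hcpow, hind]
  · rintro ξ rfl
    rw [hind]
    norm_num
  · exact weightedNorm_ind_le hs hΩm hn0
      (fun ξ hξ => (hnorm ξ hξ).1.trans (norm_coord_le_bracket ξ)) hfin hle'
  · have h1 := le_weightedNorm_ind (b := 1) (m := 1) hs (measurableSet_singleton (0 : Freq 0 1))
      zero_le_one (fun ξ hξ => by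
        rw [Set.mem_singleton_iff.1 hξ]
        have h2 := bracket_sq (0 : Freq 0 1)
        have h3 : ‖coord (0 : Freq 0 1)‖ ^ 2 = 0 := hzero
        rw [h3, add_zero] at h2
        exact (pow_le_one_iff_of_nonneg (bracket_pos _).le two_ne_zero).1 h2.le)
      (by rw [freqMeasure_singleton]; exact ENNReal.one_ne_top)
      (by rw [freqMeasure_singleton]; simp)
    simpa using h1

lemma normInflation_resonant {q : ℕ} (hq : q = 1 ∨ q = 3) {ν : ℂ} (hν : ν ≠ 0) {s : ℝ}
    (hs : s < 0) : NormInflation 0 1 4 q ν s := by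
  refine normInflation_of_neg (c₁ := 1) (c₂ := 3) (C := √3) (c := 1) (by norm_num) (by omega) hν hs
    one_pos (by norm_num) one_pos fun h T hh hT => ?_
  filter_upwards [eventually_gt_atTop 0] with n hn
  have hT0 := hT n hn
  exact (inflationData_resonant hq hs.le (hh n hn) hT0 hn).mono (by positivity)
    (mul_comm _ _).le le_rfl

end Resonant
end NLS
end

/-! ### Assembly of the cases -/

theorem theorem1p1 (d₁ d₂ p q : ℕ) (ν : ℂ) (s : ℝ)
    (hd : 1 ≤ d₁ + d₂) (hp : 2 ≤ p) (hq : q ≤ p) (hν : ν ≠ 0)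
    (h :
      -- (i)
      s < min (NLS.criticalExponent (d₁ + d₂) p) 0 ∨
      -- (ii)
      (d₁ + d₂ = 1 ∧ p = 3 ∧ s = -1 / 2) ∨
      (d₁ + d₂ = 2 ∧ p = 2 ∧ s = -1) ∨
      -- (iii)
      (d₁ + d₂ = 1 ∧ p = 2 ∧ (q = 0 ∨ q = 2) ∧ s < -1) ∨
      -- (iv)
      (d₂ = 0 ∧ d₁ ≤ 3 ∧ p = 2 ∧ q = 1 ∧ s < -1 / 4) ∨
      -- (v)
      (1 ≤ d₂ ∧ d₁ + d₂ ≤ 3 ∧ p = 2 ∧ q = 1 ∧ s < 0) ∨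
      -- (vi)
      (d₁ = 0 ∧ d₂ = 1 ∧ p = 4 ∧ (q = 1 ∨ q = 2 ∨ q = 3) ∧ s < 0)) :
    NLS.NormInflation d₁ d₂ p q ν s := by
  rcases h with h | ⟨h1, rfl, rfl⟩ | ⟨h1, rfl, rfl⟩ | ⟨h1, rfl, -, h2⟩ | ⟨rfl, -, rfl, rfl, h2⟩ |
    ⟨h1, -, rfl, rfl, h2⟩ | ⟨rfl, rfl, rfl, h1, h2⟩
  · exact NLS.normInflation_of_lt_criticalExponent hd hp hq hν h
  · exact NLS.normInflation_critical hd hp hq (by rw [h1]) le_rfl hν (by rw [h1]; norm_num)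
  · exact NLS.normInflation_critical hd hp hq (by rw [h1]) (by norm_num) hν (by rw [h1]; norm_num)
  · exact NLS.normInflation_of_lt_neg_one h1 hq hν h2
  · exact NLS.normInflation_of_lt_neg_quarter hd hν h2
  · exact NLS.normInflation_of_balanced h1 rfl le_rfl hν h2
  · rcases h1 with rfl | rfl | rfl
    · exact NLS.normInflation_resonant (Or.inl rfl) hν h2
    · exact NLS.normInflation_of_balanced le_rfl rfl one_le_two hν h2
    · exact NLS.normInflation_resonant (Or.inr rfl) hν h2
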